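/- **Setting.** All binary arithmetic is modulo 2. Let $\sigma_{00}=I$, $\sigma_{01}=\sigma_x$, $\sigma_{10}=\sigma_z$, $\sigma_{11}=\sigma_y$, and $\sigma_{(v,w)}=\sigma_{v_1w_1}\otimes\cdots\otimes\sigma_{v_nw_n}$ for $v,w\in\mathbb Z_2^n$. Let $S=\begin{bmatrix}S_z\\S_x\end{bmatrix}\in\mathbb Z_2^{2n\times n}$ have linearly independent columns $s_1,\dots,s_n$ with $S^TPS=0$, $P=\begin{bmatrix}0&I\\I&0\end{bmatrix}$. For $b\in\mathbb Z_2^n$ let $|\psi_b\rangle$ be the stabilizer state represented by $S,b$, i.e. a unit vector with $(-1)^{b_i}\sigma_{s_i}|\psi_b\rangle=|\psi_b\rangle$ for all $i$. Let $p$ be a probability distribution on $\mathbb Z_2^n$ and $\rho=\sum_b p(b)|\psi_b\rangle\langle\psi_b|$. **Protocols.** A breeding protocol with $k$ noisy and $r$ pure copies starts from $\rho^{\otimes k}\otimes(|\psi_0\rangle\langle\psi_0|)^{\otimes r}$, shared by $n$ parties, party $i$ holding the $i$-th qubit of every copy. (i) Every party applies the same circuit of CNOT gates to its $k+r$ qubits,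 acting on basis states by $|x\rangle\mapsto|Ax\rangle$ with $A\in\mathbb Z_2^{(k+r)\times(k+r)}$ orthogonal. (ii) The $r$ initially pure copies are measured: for the $j$-th of them a partition $M$ of $\{1,\dots,n\}$ into three (possibly empty) sets $M_z,M_x,M_y$ is fixed beforehand, and $\sigma_z,\sigma_x,\sigma_y$ is measured on the qubits in $M_z,M_x,M_y$ respectively; the measured copies are discarded. (iii) From the joint outcome one computes a guess of the unknown phase vectors $(b_1,\dots,b_k)$ (the noisy copies being regarded as $|\psi_{b_1}\rangle\otimes\cdots\otimes|\psi_{b_k}\rangle$ with probability $\prod_i p(b_i)$) and applies a local Pauli correction to the $k$ remaining copies. The yield is $(k-r)/k$. A sequence of protocols ($k\to\infty$, $r=r_k$) *succeeds* if the probability of a wrong guess tends to $0$ and the fidelity of the resulting state of the $k$ remaining copies (averaged over the outcomes) with $|\psi_0\rangle^{\otimes k}$ tends to $1$. A number $\gamma$ is *achievable* if some succeeding sequence has $(k-r_k)/k\to\gamma$. **Linear program.** For a partition $M$ let $\mathcal V(M)$ be the space of all $v\in\mathbb Z_2^n$ with $\mathrm{supp}(S_zv)\setminus\mathrm{supp}(S_xv)\subseteq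 M_z$, $\mathrm{supp}(S_xv)\setminus\mathrm{supp}(S_zv)\subseteq M_x$, $\mathrm{supp}(S_zv)\cap\mathrm{supp}(S_xv)\subseteq M_y$, and let $n(M)=\dim\mathcal V(M)$. Let $H=-\sum_b p(b)\log_2p(b)$. For a subspace $\mathcal G\subseteq\mathbb Z_2^n$ let $C(\mathcal G)=-\sum_j p(\Omega_j)\log_2p(\Omega_j)$, where the $\Omega_j$ are the cosets of $\mathcal G^\perp=\{v: g^Tv=0\ \forall g\in\mathcal G\}$. For a function $f$ with $f(M)\in\{0,\dots,n(M)\}$ for all $M$ let $$H_f=\min\ C\Big(\sum_M\mathcal G_f(M)\Big),$$ over all choices of subspaces $\mathcal G_f(M)\subseteq\mathcal V(M)$ of dimension $n(M)-f(M)$. Call a real function $m\ge0$ on the partitions *feasible* if $\sum_M m(M)f(M)>H-H_f$ for all such $f\not\equiv0$. **Theorem.** (1) For every feasible $m$ there is a succeeding sequence of breeding protocols in which the number of copies measured according to $M$, divided by $k$, tends to $m(M)$ for every $M$; in particular its yield tends to $1-\sum_M m(M)$. (2) The largest achievable yield exists and equals $$1-\inf\Big\{\sum_M m(M)\ :\ m\text{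 feasible}\Big\}.$$ -/

import Mathlib

open Filter Topology

noncomputable section

namespace Breeding

/-! ### Pauli operations

A system of qubits labelled by `ι` has computational basis `ι → ZMod 2`; kets are functions
`(ι → ZMod 2) → ℂ` and operators are complex matrices indexed by `ι → ZMod 2`. -/

/-- The one-qubit Pauli matrix with bits `z`, `x`: the bits `00, 01, 10, 11` give
the identity, `σ_x`, `σ_z`, `σ_y`. -/
def sigma : ZMod 2 → ZMod 2 → Matrix (ZMod 2) (ZMod 2) ℂ
  | 0, 0 => !![1, 0; 0, 1]
  | 0, 1 => !![0, 1; 1, 0]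
  | 1, 0 => !![1, 0; 0, -1]
  | 1, 1 => !![0, -Complex.I; Complex.I, 0]

/-- The tensor product of one-qubit operators. -/
def tensorOp {ι : Type} [Fintype ι] (F : ι → Matrix (ZMod 2) (ZMod 2) ℂ) :
    Matrix (ι → ZMod 2) (ι → ZMod 2) ℂ :=
  fun x y => ∏ i, F i (x i) (y i)

/-- The Pauli operation `σ_a` with `a = (z, x)`. -/
def pauli {ι : Type} [Fintype ι] (z x : ι → ZMod 2) : Matrix (ι → ZMod 2) (ι → ZMod 2) ℂ :=
  tensorOp fun i => sigma (z i) (x i)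

/-- The sign `(-1)^b` of a bit. -/
def sign (b : ZMod 2) : ℂ := (-1) ^ b.val

/-- The rank-one operator `|φ⟩⟨φ|`. -/
def ketbra {X : Type} (φ : X → ℂ) : Matrix X X ℂ := Matrix.vecMulVec φ (star φ)

/-! ### Stabilizer states -/

/-- The matrix `P` of the symplectic form; the first half of the indices holds the `z`-bits and
the second half holds the `x`-bits. -/
def symplecticP (n : ℕ) : Matrix (Fin n ⊕ Fin n) (Fin n ⊕ Fin n) (ZMod 2) :=
  Matrix.fromBlocks 0 1 1 0

/-- `S` is the binary matrix of a stabilizer on `n` qubits: its columns are linearly independent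
and the corresponding Pauli operations commute. -/
structure IsStabilizerMatrix {n : ℕ} (S : Matrix (Fin n ⊕ Fin n) (Fin n) (ZMod 2)) : Prop where
  linearIndependent : LinearIndependent (ZMod 2) S.col
  commute : S.transpose * symplecticP n * S = 0

/-- `φ` is a stabilizer state represented by `S` and `b`: a unit vector that is an eigenvector with
eigenvalue `1` of every `(-1)^{b_i} σ_{s_i}`, where `s_i` is the `i`-th column of `S`. -/
structure IsStabilizerState {n : ℕ} (S : Matrix (Fin n ⊕ Fin n) (Fin n) (ZMod 2))
    (b : Fin n → ZMod 2) (φ : (Fin n → ZMod 2) → ℂ) : Prop where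
  unit : ∑ x, ‖φ x‖ ^ 2 = 1
  eigen : ∀ i : Fin n,
    (sign (b i) • pauli (fun q => S (Sum.inl q) i) (fun q => S (Sum.inr q) i)).mulVec φ = φ

/-- The mixed state `∑_b p(b) |ψ_b⟩⟨ψ_b|`. -/
def mixedState {n : ℕ} (ψ : (Fin n → ZMod 2) → (Fin n → ZMod 2) → ℂ)
    (p : (Fin n → ZMod 2) → ℝ) : Matrix (Fin n → ZMod 2) (Fin n → ZMod 2) ℂ :=
  ∑ b, (p b : ℂ) • ketbra (ψ b)

/-! ### Local Pauli measurements -/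

/-- The three Pauli measurements of a qubit. -/
inductive Axis
  | z
  | x
  | y
  deriving DecidableEq

instance : Fintype Axis where
  elems := {Axis.z, Axis.x, Axis.y}
  complete a := by cases a <;> decide

/-- The measured observable `σ_z`, `σ_x` or `σ_y`. -/
def Axis.op : Axis → Matrix (ZMod 2) (ZMod 2) ℂ
  | .z => sigma 1 0
  | .x => sigma 0 1
  | .y => sigma 1 1

/-- The projector on the eigenspace of the measured observable with eigenvalue `(-1)^o`. -/
def Axis.proj (a : Axis) (o : ZMod 2) : Matrix (ZMod 2) (ZMod 2) ℂ :=
  (2⁻¹ : ℂ) • (1 + sign o • a.op)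

/-- A partition of the `n` qubits into (possibly empty) sets `M_z`, `M_x`, `M_y`: the Pauli
measurement that is performed on each qubit of one copy. -/
abbrev Partition (n : ℕ) : Type := Fin n → Axis

/-- The space `𝒱(M)` of those `v` for which the eigenvalue of `σ_{Sv}` can be computed from the
outcomes of the measurements `M`. The three conditions are
`supp(S_z v) \ supp(S_x v) ⊆ M_z`, `supp(S_x v) \ supp(S_z v) ⊆ M_x` and
`supp(S_z v) ∩ supp(S_x v) ⊆ M_y`. -/
def measSpace {n : ℕ} (S : Matrix (Fin n ⊕ Fin n) (Fin n) (ZMod 2)) (M : Partition n) :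
    Submodule (ZMod 2) (Fin n → ZMod 2) where
  carrier := {v | ∀ q : Fin n,
    (S.mulVec v (Sum.inl q) = 1 → S.mulVec v (Sum.inr q) ≠ 1 → M q = .z) ∧
    (S.mulVec v (Sum.inr q) = 1 → S.mulVec v (Sum.inl q) ≠ 1 → M q = .x) ∧
    (S.mulVec v (Sum.inl q) = 1 → S.mulVec v (Sum.inr q) = 1 → M q = .y)}
  zero_mem' := by
    intro q
    simp
  add_mem' := by
    intro v w hv hw q
    have h1 := hv q
    have h2 := hw q
    rw [Matrix.mulVec_add]
    simp only [Pi.add_apply]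
    generalize S.mulVec v (Sum.inl q) = a at *
    generalize S.mulVec v (Sum.inr q) = b at *
    generalize S.mulVec w (Sum.inl q) = c at *
    generalize S.mulVec w (Sum.inr q) = d at *
    generalize M q = e at *
    clear hv hw
    have h01 : ∀ t : ZMod 2, t = 0 ∨ t = 1 := by decide
    have h11 : (1 : ZMod 2) + 1 = 0 := by decide
    rcases h01 a with rfl | rfl <;> rcases h01 b with rfl | rfl <;>
      rcases h01 c with rfl | rfl <;> rcases h01 d with rfl | rfl <;> simp_all
  smul_mem' := by
    intro t v hv q
    have h1 := hv q
    rw [Matrix.mulVec_smul]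
    simp only [Pi.smul_apply, smul_eq_mul]
    generalize S.mulVec v (Sum.inl q) = a at *
    generalize S.mulVec v (Sum.inr q) = b at *
    generalize M q = e at *
    revert a b e t
    decide

/-- `n(M)`, the dimension of `𝒱(M)`. -/
def measDim {n : ℕ} (S : Matrix (Fin n ⊕ Fin n) (Fin n) (ZMod 2)) (M : Partition n) : ℕ :=
  Module.finrank (ZMod 2) (measSpace S M)

/-! ### The linear program -/

/-- The entropy (in bits) of a finite family of probabilities. -/
def entropy {X : Type} [Fintype X] (P : X → ℝ) : ℝ := -∑ a, P a * Real.logb 2 (P a)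

/-- The space of all `v` with `gᵀ v = 0` for all `g ∈ 𝒢`. -/
def perp {n : ℕ} (𝒢 : Submodule (ZMod 2) (Fin n → ZMod 2)) :
    Submodule (ZMod 2) (Fin n → ZMod 2) where
  carrier := {v | ∀ g ∈ 𝒢, g ⬝ᵥ v = 0}
  zero_mem' := by
    intro g _
    simp
  add_mem' := by
    intro v w hv hw g hg
    rw [dotProduct_add, hv g hg, hw g hg, add_zero]
  smul_mem' := by
    intro t v hv g hg
    rw [dotProduct_smul, hv g hg, smul_zero]

open Classical in
/-- `C(𝒢)`: the entropy of the coset of `perp 𝒢` that contains a `p`-distributed `b`. -/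
def cosetEntropy {n : ℕ} (p : (Fin n → ZMod 2) → ℝ)
    (𝒢 : Submodule (ZMod 2) (Fin n → ZMod 2)) : ℝ :=
  entropy fun Ω : (Fin n → ZMod 2) ⧸ perp 𝒢 => ∑ b with Submodule.Quotient.mk b = Ω, p b

/-- `H_f`: the minimum of `C(∑_M 𝒢_f(M))` over all families of subspaces
`𝒢_f(M) ⊆ 𝒱(M)` of dimension `n(M) - f(M)`. For `f ≤ n` the infimum is over a finite
nonempty set. -/
def minEntropy {n : ℕ} (S : Matrix (Fin n ⊕ Fin n) (Fin n) (ZMod 2))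
    (p : (Fin n → ZMod 2) → ℝ) (f : Partition n → ℕ) : ℝ :=
  sInf {c : ℝ | ∃ 𝒢 : Partition n → Submodule (ZMod 2) (Fin n → ZMod 2),
    (∀ M, 𝒢 M ≤ measSpace S M ∧ Module.finrank (ZMod 2) (𝒢 M) + f M = measDim S M) ∧
    c = cosetEntropy p (⨆ M, 𝒢 M)}

/-- The feasible points of the linear program. -/
def Feasible {n : ℕ} (S : Matrix (Fin n ⊕ Fin n) (Fin n) (ZMod 2))
    (p : (Fin n → ZMod 2) → ℝ) (m : Partition n → ℝ) : Prop :=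
  (∀ M, 0 ≤ m M) ∧
  ∀ f : Partition n → ℕ, (∀ M, f M ≤ measDim S M) → f ≠ 0 →
    entropy p - minEntropy S p f < ∑ M, m M * f M

/-- The value of the linear program. -/
def lpValue {n : ℕ} (S : Matrix (Fin n ⊕ Fin n) (Fin n) (ZMod 2))
    (p : (Fin n → ZMod 2) → ℝ) : ℝ :=
  sInf {t : ℝ | ∃ m : Partition n → ℝ, Feasible S p m ∧ t = ∑ M, m M}

/-! ### CNOT circuits -/

/-- A CNOT gate: its control qubit and its target qubit. -/
abbrev Gate (κ : Type) : Type := {e : κ × κ // e.1 ≠ e.2}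

/-- The unitary of a CNOT gate: it adds the control bit to the target bit. -/
def Gate.unitary {κ : Type} [Fintype κ] [DecidableEq κ] (e : Gate κ) :
    Matrix (κ → ZMod 2) (κ → ZMod 2) ℂ :=
  fun x y => if x = y + Pi.single e.1.2 (y e.1.1) then 1 else 0

/-- The binary matrix of a CNOT gate, i.e. its action on computational basis labels. -/
def Gate.matrix {κ : Type} [DecidableEq κ] (e : Gate κ) : Matrix κ κ (ZMod 2) :=
  Matrix.transvection e.1.2 e.1.1 1

/-- The unitary of a circuit of CNOT gates; the last gate of the list is applied first. -/
def circuitUnitary {κ : Type} [Fintype κ] [DecidableEq κ] (L : List (Gate κ)) :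
    Matrix (κ → ZMod 2) (κ → ZMod 2) ℂ :=
  (L.map Gate.unitary).prod

/-- The binary matrix of a circuit of CNOT gates. -/
def circuitMatrix {κ : Type} [Fintype κ] [DecidableEq κ] (L : List (Gate κ)) :
    Matrix κ κ (ZMod 2) :=
  (L.map Gate.matrix).prod

/-! ### The protocol

The copies are labelled by `Fin k ⊕ Fin r` (first the noisy ones, then the pure ones), and
party `i` holds the qubits `(i, j)` for all copies `j`. -/

/-- A breeding protocol for `k` noisy copies and `r` pure copies of an `n`-qubit state. Every party
applies the same circuit of CNOT gates, whose binary matrix `A` is orthogonal. Afterwards qubit `i`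
of the `j`-th initially pure copy is measured along `axes j i`. From the joint outcome, a guess of
the vector of all phase bits of the noisy copies and a Pauli operation on the `k` remaining copies
are computed. -/
structure Protocol (n k r : ℕ) where
  A : Matrix (Fin k ⊕ Fin r) (Fin k ⊕ Fin r) (ZMod 2)
  orthogonal : A * A.transpose = 1
  circuit : List (Gate (Fin k ⊕ Fin r))
  circuit_eq : circuitMatrix circuit = A
  axes : Fin r → Partition n
  decode : (Fin n × Fin r → ZMod 2) → Fin k → Fin n → ZMod 2
  corrZ : (Fin n × Fin r → ZMod 2) → Fin n × Fin k → ZMod 2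
  corrX : (Fin n × Fin r → ZMod 2) → Fin n × Fin k → ZMod 2

/-- The ket `ψ_{b_1} ⊗ ⋯ ⊗ ψ_{b_k} ⊗ ψ_0^{⊗ r}`. -/
def inputKet {n k : ℕ} (r : ℕ) (ψ : (Fin n → ZMod 2) → (Fin n → ZMod 2) → ℂ)
    (b : Fin k → Fin n → ZMod 2) : (Fin n × (Fin k ⊕ Fin r) → ZMod 2) → ℂ :=
  fun x => (∏ j : Fin k, ψ (b j) fun i => x (i, Sum.inl j)) *
    ∏ j : Fin r, ψ 0 fun i => x (i, Sum.inr j)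

/-- The state `ρ^{⊗ k} ⊗ (|ψ_0⟩⟨ψ_0|)^{⊗ r}`. -/
def inputState {n : ℕ} (k r : ℕ) (ψ : (Fin n → ZMod 2) → (Fin n → ZMod 2) → ℂ)
    (p : (Fin n → ZMod 2) → ℝ) :
    Matrix (Fin n × (Fin k ⊕ Fin r) → ZMod 2) (Fin n × (Fin k ⊕ Fin r) → ZMod 2) ℂ :=
  fun x y =>
    (∏ j : Fin k, mixedState ψ p (fun i => x (i, Sum.inl j)) fun i => y (i, Sum.inl j)) *
    ∏ j : Fin r, ketbra (ψ 0) (fun i => x (i, Sum.inr j)) fun i => y (i, Sum.inr j)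

/-- The pure state `ψ_0^{⊗ k}`. -/
def targetKet {n : ℕ} (k : ℕ) (ψ : (Fin n → ZMod 2) → (Fin n → ZMod 2) → ℂ) :
    (Fin n × Fin k → ZMod 2) → ℂ :=
  fun x => ∏ j : Fin k, ψ 0 fun i => x (i, j)

/-- The tensor product over the parties of the unitaries that they apply. -/
def Protocol.unitary {n k r : ℕ} (T : Protocol n k r) :
    Matrix (Fin n × (Fin k ⊕ Fin r) → ZMod 2) (Fin n × (Fin k ⊕ Fin r) → ZMod 2) ℂ :=
  fun x y => ∏ i : Fin n, circuitUnitary T.circuit (fun j => x (i, j)) fun j => y (i, j)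

/-- The projector for the joint measurement outcome `o`; it is the identity on the first `k`
copies. -/
def Protocol.proj {n k r : ℕ} (T : Protocol n k r) (o : Fin n × Fin r → ZMod 2) :
    Matrix (Fin n × (Fin k ⊕ Fin r) → ZMod 2) (Fin n × (Fin k ⊕ Fin r) → ZMod 2) ℂ :=
  tensorOp fun q => Sum.elim (fun _ => 1) (fun j => (T.axes j q.1).proj (o (q.1, j))) q.2

/-- The probability of outcome `o` if the phase bits of the noisy copies are `b`. -/
def Protocol.outcomeProb {n k r : ℕ} (T : Protocol n k r)
    (ψ : (Fin n → ZMod 2) → (Fin n → ZMod 2) → ℂ) (b : Fin k → Fin n → ZMod 2)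
    (o : Fin n × Fin r → ZMod 2) : ℝ :=
  ∑ x, ‖((T.proj o * T.unitary).mulVec (inputKet r ψ b)) x‖ ^ 2

/-- The probability that the unknown phase bits, which are `b` with probability
`∏ j, p (b j)`, are not identified correctly. -/
def Protocol.errorProb {n k r : ℕ} (T : Protocol n k r)
    (ψ : (Fin n → ZMod 2) → (Fin n → ZMod 2) → ℂ) (p : (Fin n → ZMod 2) → ℝ) : ℝ :=
  ∑ b : Fin k → Fin n → ZMod 2, (∏ j, p (b j)) *
    ∑ o : Fin n × Fin r → ZMod 2, if T.decode o = b then 0 else T.outcomeProb ψ b o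

/-- The partial trace over the last `r` copies. -/
def discard {n k r : ℕ}
    (ρ : Matrix (Fin n × (Fin k ⊕ Fin r) → ZMod 2) (Fin n × (Fin k ⊕ Fin r) → ZMod 2) ℂ) :
    Matrix (Fin n × Fin k → ZMod 2) (Fin n × Fin k → ZMod 2) ℂ :=
  fun x y => ∑ t : Fin n × Fin r → ZMod 2,
    ρ (fun q => Sum.elim (fun j => x (q.1, j)) (fun j => t (q.1, j)) q.2)
      (fun q => Sum.elim (fun j => y (q.1, j)) (fun j => t (q.1, j)) q.2)

/-- The final state of the `k` remaining copies, averaged over the measurement outcomes. -/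
def Protocol.output {n k r : ℕ} (T : Protocol n k r)
    (ψ : (Fin n → ZMod 2) → (Fin n → ZMod 2) → ℂ) (p : (Fin n → ZMod 2) → ℝ) :
    Matrix (Fin n × Fin k → ZMod 2) (Fin n × Fin k → ZMod 2) ℂ :=
  ∑ o : Fin n × Fin r → ZMod 2,
    pauli (T.corrZ o) (T.corrX o) *
      discard (T.proj o * (T.unitary * inputState k r ψ p * T.unitary.conjTranspose) *
        (T.proj o).conjTranspose) *
      (pauli (T.corrZ o) (T.corrX o)).conjTranspose

/-- The fidelity of the final state of the `k` remaining copies with `ψ_0^{⊗ k}`. -/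
def Protocol.fidelity {n k r : ℕ} (T : Protocol n k r)
    (ψ : (Fin n → ZMod 2) → (Fin n → ZMod 2) → ℂ) (p : (Fin n → ZMod 2) → ℝ) : ℝ :=
  (star (targetKet k ψ) ⬝ᵥ (T.output ψ p).mulVec (targetKet k ψ)).re

/-- The yield: the number of pure output copies minus the number of pure input copies, per noisy
input copy. -/
def yield (k r : ℕ) : ℝ := ((k : ℝ) - (r : ℝ)) / (k : ℝ)

/-- The protocols `T k` succeed asymptotically: the unknown phase bits are identified with
probability tending to `1`, and the `k` remaining copies approach `ψ_0^{⊗ k}`. -/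
def Succeeds {n : ℕ} (ψ : (Fin n → ZMod 2) → (Fin n → ZMod 2) → ℂ)
    (p : (Fin n → ZMod 2) → ℝ) {r : ℕ → ℕ} (T : ∀ k, Protocol n k (r k)) : Prop :=
  Tendsto (fun k => (T k).errorProb ψ p) atTop (𝓝 0) ∧
  Tendsto (fun k => (T k).fidelity ψ p) atTop (𝓝 1)

/-- `γ` is an asymptotic yield of successful breeding protocols. -/
def Achievable {n : ℕ} (ψ : (Fin n → ZMod 2) → (Fin n → ZMod 2) → ℂ)
    (p : (Fin n → ZMod 2) → ℝ) (γ : ℝ) : Prop :=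
  ∃ (r : ℕ → ℕ) (T : ∀ k, Protocol n k (r k)),
    Succeeds ψ p T ∧ Tendsto (fun k => yield k (r k)) atTop (𝓝 γ)

end Breeding

end

noncomputable section
set_option linter.unusedSectionVars false
namespace Breeding

/-! ### Signs and Weyl operators -/

/-! Everything quantum reduces to linear algebra over `ZMod 2`. An orthogonal CNOT circuit
transforms z-bits and x-bits of Pauli operations by the same matrix, so it sends a product of
stabilizer states with phase vectors `b` to the product with phase vectors `act A b + s`, where the
shift `s` does not depend on `b` (`exists_copyKet_comp_act`). Measuring a copy according to `M`
reveals exactly the bits `v ⬝ᵥ syndrome`, `v ∈ measSpace S M`: two inputs that differ in such a bit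
never share an outcome (`unseen_of_outcomeProb_ne_zero`), and two inputs that agree in all of them
have identical outcome distributions (`outcomeProb_eq_of_unseen`). Once the phases are guessed,
local Paulis restore the target, so the fidelity is at least the probability of a correct guess
(`exists_corrections`). What remains is a source coding problem in which the encoder is an
orthogonal matrix.

Achievability is random coding. Let `W` be the span of the difference of two lists of phase vectors.
A uniformly random orthogonal matrix sends the coordinate vectors of the difference to almost
uniform vectors (`card_orthogonal_map_le`), so the difference stays invisible with probability at
most a constant times `2 ^ (-∑ j, seenDim S W (axes j))` (`card_unseen_le`). About `2 ^ (k * (H -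
C(perp W)))` typical lists compete with a given one in this way. Feasibility for `f = seenDim S W`,
with the subspaces `measSpace S M ⊓ perp W`, says precisely that the product of the two tends to
zero exponentially (`Feasible.entropy_sub_lt`); there are finitely many `W`.

The converse is a counting argument. Choose the subspaces that attain `H_f` and let `G` be their
sum. If the cosets of `perp G` are given away for free, the measurements add only `∑ j, f (axes j)`
bits, so a decoder is right on at most that many bits' worth of lists per coset list. There are
about `2 ^ (k * H_f)` typical coset lists, and each typical list has probability about `2 ^ (-k *
H)`; success therefore forces `∑ j, f (axes j)` to be nearly `k * (H - H_f)`
(`eventually_le_sum_axes`). The observed measurement frequencies, raised by any `δ > 0`, are thus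
eventually feasible. Feasibility is strict and the infimum need not be attained by a feasible point,
so the optimal yield itself is reached by a diagonal sequence (`exists_diagonal`). -/

@[simp] theorem sign_zero : sign 0 = 1 := by simp [sign]

@[simp] theorem sign_one : sign 1 = -1 := by simp [sign, ZMod.val_one]

theorem zmod_two_cases (a : ZMod 2) : a = 0 ∨ a = 1 := by revert a; decide

theorem sign_add (a b : ZMod 2) : sign (a + b) = sign a * sign b := by
  have h11 : (1 : ZMod 2) + 1 = 0 := by decide
  rcases zmod_two_cases a with rfl | rfl <;> rcases zmod_two_cases b with rfl | rfl <;> simp [h11]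

theorem sign_sum {α : Type} (s : Finset α) (f : α → ZMod 2) :
    sign (∑ i ∈ s, f i) = ∏ i ∈ s, sign (f i) := by
  classical
  induction s using Finset.induction_on with
  | empty => simp
  | insert a s ha ih => rw [Finset.sum_insert ha, Finset.prod_insert ha, sign_add, ih]

theorem sign_mul_self (a : ZMod 2) : sign a * sign a = 1 := by
  rcases zmod_two_cases a with rfl | rfl <;> simp

theorem sign_ne_zero (a : ZMod 2) : sign a ≠ 0 := by
  rcases zmod_two_cases a with rfl | rfl <;> simp

theorem norm_sign (a : ZMod 2) : ‖sign a‖ = 1 := by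
  rcases zmod_two_cases a with rfl | rfl <;> simp

theorem star_sign (a : ZMod 2) : star (sign a) = sign a := by
  rcases zmod_two_cases a with rfl | rfl <;> simp

theorem sign_injective : Function.Injective sign := by
  intro a b h
  rcases zmod_two_cases a with rfl | rfl <;> rcases zmod_two_cases b with rfl | rfl <;>
    first | rfl | (norm_num at h)

theorem add_self_bits {α : Type} (x : α → ZMod 2) : x + x = 0 := by
  funext i; exact CharTwo.add_self_eq_zero _

/-- The Weyl operator `Z^z X^x`. -/
def weyl {ι : Type} [Fintype ι] (z x : ι → ZMod 2) (φ : (ι → ZMod 2) → ℂ) : (ι → ZMod 2) → ℂ :=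
  fun y => sign (z ⬝ᵥ y) * φ (y + x)

section weyl
variable {ι : Type} [Fintype ι] [DecidableEq ι]

theorem weyl_smul (z x : ι → ZMod 2) (a : ℂ) (φ : (ι → ZMod 2) → ℂ) :
    weyl z x (a • φ) = a • weyl z x φ := by
  funext y; simp only [weyl, Pi.smul_apply, smul_eq_mul]; ring

theorem weyl_zero_zero (φ : (ι → ZMod 2) → ℂ) : weyl 0 0 φ = φ := by
  funext y; simp [weyl]

theorem weyl_weyl (z x z' x' : ι → ZMod 2) (φ : (ι → ZMod 2) → ℂ) :
    weyl z x (weyl z' x' φ) = sign (z' ⬝ᵥ x) • weyl (z + z') (x + x') φ := by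
  funext y
  simp only [weyl, Pi.smul_apply, smul_eq_mul, dotProduct_add, add_dotProduct, sign_add, add_assoc]
  ring

theorem weyl_comm (z x z' x' : ι → ZMod 2) (φ : (ι → ZMod 2) → ℂ) :
    weyl z x (weyl z' x' φ) = sign (z ⬝ᵥ x' + x ⬝ᵥ z') • weyl z' x' (weyl z x φ) := by
  rw [weyl_weyl, weyl_weyl, add_comm z' z, add_comm x' x, smul_smul, sign_add, mul_right_comm,
    sign_mul_self, one_mul, dotProduct_comm z' x]

theorem sum_norm_sq_weyl (z x : ι → ZMod 2) (φ : (ι → ZMod 2) → ℂ) :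
    ∑ y, ‖weyl z x φ y‖ ^ 2 = ∑ y, ‖φ y‖ ^ 2 := by
  simp only [weyl, norm_mul, norm_sign, one_mul]
  exact Equiv.sum_comp (Equiv.addRight x) fun y => ‖φ y‖ ^ 2

theorem star_weyl_dotProduct_weyl (z x : ι → ZMod 2) (φ χ : (ι → ZMod 2) → ℂ) :
    star (weyl z x φ) ⬝ᵥ weyl z x χ = star φ ⬝ᵥ χ := by
  simp only [weyl, dotProduct, Pi.star_apply, star_mul', star_sign]
  rw [← Equiv.sum_comp (Equiv.addRight x) fun y => star (φ y) * χ y]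
  refine Finset.sum_congr rfl fun y _ => ?_
  rw [mul_mul_mul_comm, sign_mul_self, one_mul]
  rfl

/-- The phase between `σ_{zx}` and `Z^z X^x`. -/
def sigmaPhase (z x : ZMod 2) : ℂ := if z = 1 ∧ x = 1 then -Complex.I else 1

theorem sigma_apply (z x y y' : ZMod 2) :
    sigma z x y y' = if y' = y + x then sigmaPhase z x * sign (z * y) else 0 := by
  have h11 : (1 : ZMod 2) + 1 = 0 := by decide
  rcases zmod_two_cases z with rfl | rfl <;> rcases zmod_two_cases x with rfl | rfl <;>
    rcases zmod_two_cases y with rfl | rfl <;> rcases zmod_two_cases y' with rfl | rfl <;>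
    simp [sigma, sigmaPhase, h11] <;> rfl

/-- The phase between `σ_a` and the Weyl operator. -/
def pauliPhase (z x : ι → ZMod 2) : ℂ := ∏ i, sigmaPhase (z i) (x i)

theorem norm_pauliPhase (z x : ι → ZMod 2) : ‖pauliPhase z x‖ = 1 := by
  rw [pauliPhase, norm_prod]
  refine Finset.prod_eq_one fun i _ => ?_
  rw [sigmaPhase]; split_ifs <;> simp

theorem pauliPhase_ne_zero (z x : ι → ZMod 2) : pauliPhase z x ≠ 0 := by
  rw [← norm_ne_zero_iff, norm_pauliPhase]; exact one_ne_zero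

theorem pauli_mulVec (z x : ι → ZMod 2) (φ : (ι → ZMod 2) → ℂ) :
    (pauli z x).mulVec φ = pauliPhase z x • weyl z x φ := by
  funext y
  have h : ∀ y', pauli z x y y' =
      if y' = y + x then pauliPhase z x * sign (z ⬝ᵥ y) else 0 := by
    intro y'
    simp only [pauli, tensorOp, sigma_apply]
    rw [Finset.prod_ite_zero, Finset.prod_mul_distrib, dotProduct, sign_sum, pauliPhase]
    simp [funext_iff]
  simp only [Matrix.mulVec, dotProduct, h, ite_mul, zero_mul, Finset.sum_ite_eq', Finset.mem_univ,
    if_true, Pi.smul_apply, smul_eq_mul, weyl]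
  ring

end weyl

/-! ### Bases of stabilizer states -/

theorem star_dotProduct_self {X : Type} [Fintype X] (φ : X → ℂ) :
    star φ ⬝ᵥ φ = ((∑ y, ‖φ y‖ ^ 2 : ℝ) : ℂ) := by
  simp only [dotProduct, Pi.star_apply, Complex.ofReal_sum, Complex.ofReal_pow]
  refine Finset.sum_congr rfl fun y _ => ?_
  rw [← Complex.conj_mul']; rfl

theorem sum_norm_sq_smul {X : Type} [Fintype X] (a : ℂ) (φ : X → ℂ) :
    ∑ y, ‖(a • φ) y‖ ^ 2 = ‖a‖ ^ 2 * ∑ y, ‖φ y‖ ^ 2 := by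
  simp only [Pi.smul_apply, smul_eq_mul, norm_mul, mul_pow, Finset.mul_sum]

/-- The matrix with columns `Ψ b` is square by `hc`, so its left inverse, the conjugate transpose,
is also a right inverse. -/
theorem sum_smul_eq_of_orthonormal {X β : Type} [Fintype X] [Fintype β] [DecidableEq β]
    [DecidableEq X]
    (hc : Fintype.card β = Fintype.card X) (Ψ : β → X → ℂ)
    (h : ∀ b b', star (Ψ b) ⬝ᵥ Ψ b' = if b = b' then 1 else 0) (φ : X → ℂ) :
    φ = ∑ b, (star (Ψ b) ⬝ᵥ φ) • Ψ b := by
  let Q : Matrix X β ℂ := fun y b => Ψ b y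
  have h1 : Q.conjTranspose * Q = 1 := by
    ext b b'
    rw [Matrix.one_apply, ← h b b']
    rfl
  have h2 : Q * Q.conjTranspose = 1 := by
    rwa [Matrix.mul_eq_one_comm_of_card_eq]
    exact hc.symm
  calc φ = (Q * Q.conjTranspose).mulVec φ := by rw [h2, Matrix.one_mulVec]
    _ = Q.mulVec (Q.conjTranspose.mulVec φ) := by rw [Matrix.mulVec_mulVec]
    _ = _ := by
      funext y
      simp only [Matrix.mulVec, dotProduct, Finset.sum_apply, Pi.smul_apply, smul_eq_mul, Q,
        Pi.star_apply]
      exact Finset.sum_congr rfl fun b _ => mul_comm _ _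

/-- The states `Ψ b` are joint eigenvectors of as many Weyl operators as there are qubits, and `b`
contains the signs of the eigenvalues. -/
structure StabilizerBasis {ι Γ : Type} [Fintype ι] [Fintype Γ] [DecidableEq ι]
    (Z X : Γ → ι → ZMod 2) (c : Γ → ℂ)
    (Ψ : (Γ → ZMod 2) → (ι → ZMod 2) → ℂ) : Prop where
  card_eq : Fintype.card Γ = Fintype.card ι
  norm_phase : ∀ g, ‖c g‖ = 1
  unit : ∀ b, ∑ y, ‖Ψ b y‖ ^ 2 = 1
  eigen : ∀ g b, weyl (Z g) (X g) (Ψ b) = (c g * sign (b g)) • Ψ b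

namespace StabilizerBasis

variable {ι Γ : Type} [Fintype ι] [Fintype Γ] [DecidableEq ι] [DecidableEq Γ] {Z X : Γ → ι → ZMod 2} {c : Γ → ℂ}
  {Ψ : (Γ → ZMod 2) → (ι → ZMod 2) → ℂ}

/-- Different labels differ at some generator, whose Weyl operator is unitary and has opposite
eigenvalues on the two states. -/
theorem orthonormal (h : StabilizerBasis Z X c Ψ) (b b' : Γ → ZMod 2) :
    star (Ψ b) ⬝ᵥ Ψ b' = if b = b' then 1 else 0 := by
  split_ifs with hb
  · rw [← hb, star_dotProduct_self, h.unit, Complex.ofReal_one]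
  · obtain ⟨g, hg⟩ := Function.ne_iff.1 hb
    have h1 := star_weyl_dotProduct_weyl (Z g) (X g) (Ψ b) (Ψ b')
    have hc : star (c g) * c g = 1 := by
      have := Complex.conj_mul' (c g)
      rw [h.norm_phase] at this
      simpa using this
    rw [h.eigen, h.eigen, star_smul, smul_dotProduct, dotProduct_smul, smul_smul, star_mul',
      star_sign, mul_mul_mul_comm, hc, one_mul, ← sign_add] at h1
    have h2 : b g + b' g = 1 := by
      revert hg; generalize b g = s; generalize b' g = t; revert s t; decide
    rw [h2, sign_one, smul_eq_mul] at h1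
    linear_combination (-1 / 2 : ℂ) * h1

theorem expand (h : StabilizerBasis Z X c Ψ)
    (φ : (ι → ZMod 2) → ℂ) : φ = ∑ b, (star (Ψ b) ⬝ᵥ φ) • Ψ b :=
  sum_smul_eq_of_orthonormal (by simp [h.card_eq]) Ψ h.orthonormal φ

/-- A joint eigenvector of all generators is proportional to a state of the basis. -/
theorem eq_smul_of_eigen (h : StabilizerBasis Z X c Ψ) {φ : (ι → ZMod 2) → ℂ} (hφ : φ ≠ 0)
    {μ : Γ → ℂ} (he : ∀ g, weyl (Z g) (X g) φ = μ g • φ) :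
    ∃ (κ : Γ → ZMod 2) (a : ℂ), φ = a • Ψ κ ∧ ∀ g, μ g = c g * sign (κ g) := by
  -- A nonzero overlap with `Ψ b` forces all eigenvalues of `φ` to be those of `Ψ b`. As eigenvalues
  -- determine the label, only one basis state occurs in the expansion of `φ`.
  have key : ∀ b, star (Ψ b) ⬝ᵥ φ ≠ 0 → ∀ g, μ g = c g * sign (b g) := by
    intro b hb g
    have h1 := star_weyl_dotProduct_weyl (Z g) (X g) (Ψ b) φ
    rw [h.eigen, he, star_smul, smul_dotProduct, dotProduct_smul, smul_smul, smul_eq_mul] at h1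
    have h2 : star (c g * sign (b g)) * μ g = 1 := mul_right_cancel₀ hb (by rw [h1, one_mul])
    have h3 : (c g * sign (b g)) * star (c g * sign (b g)) = 1 := by
      have := Complex.mul_conj' (c g * sign (b g))
      rw [norm_mul, h.norm_phase, norm_sign] at this
      simpa using this
    calc μ g = ((c g * sign (b g)) * star (c g * sign (b g))) * μ g := by rw [h3, one_mul]
      _ = _ := by rw [mul_assoc, h2, mul_one]
  have hex : ∃ b, star (Ψ b) ⬝ᵥ φ ≠ 0 := by
    by_contra! hcon
    apply hφ
    rw [h.expand φ]
    simp [hcon]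
  obtain ⟨κ, hκ⟩ := hex
  refine ⟨κ, star (Ψ κ) ⬝ᵥ φ, ?_, key κ hκ⟩
  conv_lhs => rw [h.expand φ]
  refine Finset.sum_eq_single κ (fun b _ hb => ?_) (by simp)
  by_contra hne
  have hbne : star (Ψ b) ⬝ᵥ φ ≠ 0 := fun h0 => hne (by rw [h0, zero_smul])
  apply hb
  funext g
  apply sign_injective
  have hc : c g ≠ 0 := by rw [← norm_ne_zero_iff, h.norm_phase]; exact one_ne_zero
  exact mul_left_cancel₀ hc ((key b hbne g).symm.trans (key κ hκ g))

theorem phase_ne_zero (h : StabilizerBasis Z X c Ψ) (g : Γ) : c g ≠ 0 := by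
  rw [← norm_ne_zero_iff, h.norm_phase]; exact one_ne_zero

theorem norm_eq_one_of_eq_smul (h : StabilizerBasis Z X c Ψ) {φ : (ι → ZMod 2) → ℂ} {a : ℂ}
    {b : Γ → ZMod 2} (hφ : φ = a • Ψ b) (h1 : ∑ y, ‖φ y‖ ^ 2 = 1) : ‖a‖ = 1 := by
  rw [hφ, sum_norm_sq_smul, h.unit, mul_one] at h1
  exact (pow_eq_one_iff_of_nonneg (norm_nonneg _) two_ne_zero).1 h1

/-- A Weyl operator permutes the states of the basis, up to phases. -/
theorem weyl_eq_smul (h : StabilizerBasis Z X c Ψ) (z x : ι → ZMod 2) (b : Γ → ZMod 2) :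
    ∃ a : ℂ, ‖a‖ = 1 ∧ weyl z x (Ψ b) = a • Ψ (b + fun g => Z g ⬝ᵥ x + X g ⬝ᵥ z) := by
  have hu : ∑ y, ‖weyl z x (Ψ b) y‖ ^ 2 = 1 := by rw [sum_norm_sq_weyl, h.unit]
  have hne : weyl z x (Ψ b) ≠ 0 := by
    intro h0; simp [h0] at hu
  -- Commuting the Weyl operator past generator `g` costs the sign of their symplectic product, so
  -- the image is again a joint eigenvector, with the label shifted by these products.
  obtain ⟨κ, a, h1, h2⟩ := h.eq_smul_of_eigen hne
    (μ := fun g => c g * sign (b g + (Z g ⬝ᵥ x + X g ⬝ᵥ z))) (by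
      intro g
      rw [weyl_comm, h.eigen, weyl_smul, smul_smul, sign_add (b g)]
      congr 1
      ring)
  have hκ : κ = b + fun g => Z g ⬝ᵥ x + X g ⬝ᵥ z := by
    funext g
    exact sign_injective (mul_left_cancel₀ (h.phase_ne_zero g) (h2 g)).symm
  rw [hκ] at h1
  exact ⟨a, h.norm_eq_one_of_eq_smul h1 hu, h1⟩

/-- The states of the basis are eigenvectors of the whole stabilizer group. -/
theorem eigen_sum (h : StabilizerBasis Z X c Ψ) (v : Γ → ZMod 2) :
    ∃ a : ℂ, a ≠ 0 ∧ ∀ b, weyl (∑ g, v g • Z g) (∑ g, v g • X g) (Ψ b) =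
      (a * sign (v ⬝ᵥ b)) • Ψ b := by
  -- The phase `a` collects reordering signs and generator phases and is chosen before `b`;
  -- comparisons of different labels rely on this.
  have key : ∀ s : Finset Γ, ∃ a : ℂ, a ≠ 0 ∧ ∀ b,
      weyl (∑ g ∈ s, v g • Z g) (∑ g ∈ s, v g • X g) (Ψ b) =
        (a * sign (∑ g ∈ s, v g * b g)) • Ψ b := by
    intro s
    induction s using Finset.induction_on with
    | empty => exact ⟨1, one_ne_zero, fun b => by simp [weyl_zero_zero]⟩
    | insert g s hg ih =>
      obtain ⟨a, ha, hs⟩ := ih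
      rcases zmod_two_cases (v g) with hv | hv
      · refine ⟨a, ha, fun b => ?_⟩
        simp only [Finset.sum_insert hg, hv, zero_smul, zero_add, zero_mul, hs]
      · refine ⟨sign ((∑ g ∈ s, v g • Z g) ⬝ᵥ X g) * (a * c g),
          mul_ne_zero (sign_ne_zero _) (mul_ne_zero ha (h.phase_ne_zero g)), fun b => ?_⟩
        have h1 := weyl_weyl (Z g) (X g) (∑ g ∈ s, v g • Z g) (∑ g ∈ s, v g • X g) (Ψ b)
        rw [hs, weyl_smul, h.eigen, smul_smul] at h1
        simp only [Finset.sum_insert hg, hv, one_smul, one_mul, sign_add]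
        have h2 := congrArg (fun w => sign ((∑ g ∈ s, v g • Z g) ⬝ᵥ X g) • w) h1
        simp only [smul_smul, sign_mul_self, one_smul] at h2
        rw [← h2]
        congr 1
        ring
  exact key Finset.univ

end StabilizerBasis

/-! ### Tensor products of one-qubit operators -/

section tensorOp
variable {ι : Type} [Fintype ι] [DecidableEq ι]

theorem tensorOp_mul (F G : ι → Matrix (ZMod 2) (ZMod 2) ℂ) :
    tensorOp F * tensorOp G = tensorOp fun i => F i * G i := by
  ext x y
  simp only [Matrix.mul_apply, tensorOp, ← Finset.prod_mul_distrib]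
  rw [Finset.prod_univ_sum, Fintype.piFinset_univ]

theorem tensorOp_one : tensorOp (fun _ : ι => (1 : Matrix (ZMod 2) (ZMod 2) ℂ)) = 1 := by
  ext x y
  simp only [tensorOp, Matrix.one_apply, Finset.prod_ite_zero, Finset.prod_const_one, funext_iff,
    Finset.mem_univ, true_imp_iff]

theorem conjTranspose_tensorOp (F : ι → Matrix (ZMod 2) (ZMod 2) ℂ) :
    (tensorOp F).conjTranspose = tensorOp fun i => (F i).conjTranspose := by
  ext x y
  simp only [tensorOp, Matrix.conjTranspose_apply, star_prod]

theorem tensorOp_smul (a : ι → ℂ) (F : ι → Matrix (ZMod 2) (ZMod 2) ℂ) :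
    tensorOp (fun i => a i • F i) = (∏ i, a i) • tensorOp F := by
  ext x y
  simp only [tensorOp, Matrix.smul_apply, smul_eq_mul, Finset.prod_mul_distrib]

end tensorOp

namespace Axis

/-- The `z`-bit of the measured observable. -/
def zBit : Axis → ZMod 2
  | .z => 1
  | .x => 0
  | .y => 1

/-- The `x`-bit of the measured observable. -/
def xBit : Axis → ZMod 2
  | .z => 0
  | .x => 1
  | .y => 1

theorem op_mul_op (a : Axis) : a.op * a.op = 1 := by
  ext i j
  rw [Matrix.mul_apply, show (Finset.univ : Finset (ZMod 2)) = {0, 1} from rfl,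
    Finset.sum_pair (by decide)]
  cases a <;> rcases zmod_two_cases i with rfl | rfl <;> rcases zmod_two_cases j with rfl | rfl <;>
    simp [op, sigma_apply, sigmaPhase, show (1 : ZMod 2) + 1 = 0 from rfl]

theorem conjTranspose_op (a : Axis) : a.op.conjTranspose = a.op := by
  ext i j
  rw [Matrix.conjTranspose_apply]
  cases a <;> rcases zmod_two_cases i with rfl | rfl <;> rcases zmod_two_cases j with rfl | rfl <;>
    simp [op, sigma_apply, sigmaPhase, show (1 : ZMod 2) + 1 = 0 from rfl]

theorem sigma_bits (a : Axis) (t : ZMod 2) :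
    sigma (t * a.zBit) (t * a.xBit) = if t = 0 then 1 else a.op := by
  rcases zmod_two_cases t with rfl | rfl
  · simp only [zero_mul, if_true]
    ext i j
    rcases zmod_two_cases i with rfl | rfl <;> rcases zmod_two_cases j with rfl | rfl <;>
      simp [sigma_apply, sigmaPhase]
  · cases a <;> simp [zBit, xBit, op]

theorem op_mul_proj (a : Axis) (o : ZMod 2) : a.op * a.proj o = sign o • a.proj o := by
  rw [proj, mul_smul_comm, mul_add, mul_smul_comm, op_mul_op, mul_one,
    smul_comm (sign o) (2⁻¹ : ℂ)]
  congr 1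
  rw [smul_add, smul_smul, sign_mul_self, one_smul, add_comm]

theorem proj_mul_op (a : Axis) (o : ZMod 2) : a.proj o * a.op = sign o • a.proj o := by
  rw [proj, smul_mul_assoc, add_mul, smul_mul_assoc, op_mul_op, one_mul,
    smul_comm (sign o) (2⁻¹ : ℂ)]
  congr 1
  rw [smul_add, smul_smul, sign_mul_self, one_smul, add_comm]

theorem sigma_mul_proj (a : Axis) (o t : ZMod 2) :
    sigma (t * a.zBit) (t * a.xBit) * a.proj o = sign (t * o) • a.proj o := by
  rw [sigma_bits]
  rcases zmod_two_cases t with rfl | rfl <;> simp [op_mul_proj]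

theorem proj_mul_sigma (a : Axis) (o t : ZMod 2) :
    a.proj o * sigma (t * a.zBit) (t * a.xBit) = sign (t * o) • a.proj o := by
  rw [sigma_bits]
  rcases zmod_two_cases t with rfl | rfl <;> simp [proj_mul_op]

theorem conjTranspose_proj_mul_proj (a : Axis) (o : ZMod 2) :
    (a.proj o).conjTranspose * a.proj o = a.proj o := by
  have h : (a.proj o).conjTranspose = a.proj o := by
    simp [proj, Matrix.conjTranspose_smul, Matrix.conjTranspose_add, conjTranspose_op, star_sign]
  rw [h]
  nth_rewrite 1 [proj]
  rw [smul_mul_assoc, add_mul, one_mul, smul_mul_assoc, op_mul_proj, smul_smul, sign_mul_self,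
    one_smul, ← two_smul ℂ, smul_smul, inv_mul_cancel₀ two_ne_zero, one_smul]

theorem sum_proj (a : Axis) : ∑ o, a.proj o = 1 := by
  rw [show (Finset.univ : Finset (ZMod 2)) = {0, 1} from rfl, Finset.sum_pair (by decide)]
  simp only [proj, sign_zero, sign_one, ← smul_add]
  rw [one_smul, neg_one_smul, add_add_add_comm, add_neg_cancel, add_zero, ← two_smul ℂ, smul_smul,
    inv_mul_cancel₀ two_ne_zero, one_smul]

end Axis

/-! ### Several copies of a stabilizer basis -/

section copies
variable {n : ℕ} {κ : Type} [Fintype κ] [DecidableEq κ]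

theorem sum_prod_copies {R : Type} [CommSemiring R] (F : κ → (Fin n → ZMod 2) → R) :
    ∑ y : Fin n × κ → ZMod 2, ∏ j, F j (fun i => y (i, j)) = ∏ j, ∑ x, F j x := by
  rw [Finset.prod_univ_sum, Fintype.piFinset_univ]
  exact Equiv.sum_comp (((Equiv.prodComm (Fin n) κ).arrowCongr (Equiv.refl (ZMod 2))).trans
    (Equiv.curry κ (Fin n) (ZMod 2))) fun y => ∏ j, F j (y j)

/-- The product of the states with phase vectors `b (·, j)`. -/
def copyKet (ψ : (Fin n → ZMod 2) → (Fin n → ZMod 2) → ℂ) (b : Fin n × κ → ZMod 2) :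
    (Fin n × κ → ZMod 2) → ℂ :=
  fun y => ∏ j, ψ (fun i => b (i, j)) fun i => y (i, j)

/-- The vector `w i` placed on copy `j`, for every generator `(i, j)`. -/
def copyGen (w : Fin n → Fin n → ZMod 2) (g q : Fin n × κ) : ZMod 2 :=
  if g.2 = q.2 then w g.1 q.1 else 0

theorem sum_smul_copyGen (w : Fin n → Fin n → ZMod 2) (v : Fin n × κ → ZMod 2) (q : Fin n × κ) :
    (∑ g, v g • copyGen w g) q = ∑ i, v (i, q.2) * w i q.1 := by
  simp only [Finset.sum_apply, Pi.smul_apply, smul_eq_mul, copyGen, Fintype.sum_prod_type, mul_ite,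
    mul_zero, Finset.sum_ite_eq', Finset.mem_univ, if_true]

theorem copyGen_dotProduct (w : Fin n → Fin n → ZMod 2) (g : Fin n × κ) (y : Fin n × κ → ZMod 2) :
    copyGen w g ⬝ᵥ y = w g.1 ⬝ᵥ fun i => y (i, g.2) := by
  simp only [dotProduct, copyGen, Fintype.sum_prod_type, ite_mul, zero_mul, Finset.sum_ite_eq,
    Finset.mem_univ, if_true]

theorem StabilizerBasis.copies {Z X : Fin n → Fin n → ZMod 2} {c : Fin n → ℂ}
    {ψ : (Fin n → ZMod 2) → (Fin n → ZMod 2) → ℂ} (h : StabilizerBasis Z X c ψ) :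
    StabilizerBasis (copyGen Z) (copyGen X) (fun g : Fin n × κ => c g.1) (copyKet ψ) where
  card_eq := rfl
  norm_phase g := h.norm_phase g.1
  unit b := by
    simp only [copyKet, norm_prod, ← Finset.prod_pow]
    rw [sum_prod_copies fun j x => ‖ψ (fun i => b (i, j)) x‖ ^ 2]
    simp [h.unit]
  eigen g b := by
    obtain ⟨i, j⟩ := g
    funext y
    have h1 := congrFun (h.eigen i fun i => b (i, j)) fun i => y (i, j)
    simp only [weyl, Pi.smul_apply, smul_eq_mul, copyKet, copyGen_dotProduct] at h1 ⊢
    rw [← Finset.mul_prod_erase _ _ (Finset.mem_univ j), ← mul_assoc,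
      ← Finset.mul_prod_erase _ _ (Finset.mem_univ j), ← mul_assoc, ← h1]
    congr 1
    · congr 2
      funext q
      simp [copyGen]
    · refine Finset.prod_congr rfl fun l hl => ?_
      congr 1
      funext q
      simp [copyGen, (Finset.ne_of_mem_erase hl).symm]

/-- The action of a binary matrix on the copies. -/
def act (A : Matrix κ κ (ZMod 2)) (y : Fin n × κ → ZMod 2) : Fin n × κ → ZMod 2 :=
  fun q => A.mulVec (fun l => y (q.1, l)) q.2

theorem act_act (A B : Matrix κ κ (ZMod 2)) (y : Fin n × κ → ZMod 2) :
    act A (act B y) = act (A * B) y := by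
  funext q
  simp only [act, ← Matrix.mulVec_mulVec]

theorem act_one (y : Fin n × κ → ZMod 2) : act 1 y = y := by
  funext q
  simp only [act, Matrix.one_mulVec]

theorem act_add (A : Matrix κ κ (ZMod 2)) (y z : Fin n × κ → ZMod 2) :
    act A (y + z) = act A y + act A z := by
  funext q
  exact congrFun (Matrix.mulVec_add A (fun l => y (q.1, l)) fun l => z (q.1, l)) q.2

theorem act_transpose_dotProduct (A : Matrix κ κ (ZMod 2)) (z y : Fin n × κ → ZMod 2) :
    act A.transpose z ⬝ᵥ y = z ⬝ᵥ act A y := by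
  simp only [dotProduct, Fintype.sum_prod_type]
  refine Finset.sum_congr rfl fun i _ => ?_
  change (A.transpose.mulVec fun l => z (i, l)) ⬝ᵥ (fun l => y (i, l)) =
    (fun l => z (i, l)) ⬝ᵥ A.mulVec fun l => y (i, l)
  rw [Matrix.mulVec_transpose, Matrix.dotProduct_mulVec]

/-- Under a linear permutation of basis labels, x-bits are transformed by the inverse and z-bits by
the transpose. For orthogonal `A` these coincide, so a generator placed on one copy becomes a
combination of the same generator on several copies. -/
theorem weyl_comp_act {A : Matrix κ κ (ZMod 2)} (hA : A * A.transpose = 1)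
    (z x : Fin n × κ → ZMod 2) (φ : (Fin n × κ → ZMod 2) → ℂ) :
    weyl z x (φ ∘ act A.transpose) =
      weyl (act A.transpose z) (act A.transpose x) φ ∘ act A.transpose := by
  funext y
  simp only [weyl, Function.comp_apply, act_add, act_transpose_dotProduct, act_act, hA, act_one]

theorem sum_norm_sq_comp_act {A : Matrix κ κ (ZMod 2)} (hA : A * A.transpose = 1)
    (φ : (Fin n × κ → ZMod 2) → ℂ) :
    ∑ y, ‖(φ ∘ act A.transpose) y‖ ^ 2 = ∑ y, ‖φ y‖ ^ 2 := by
  have hA' : A.transpose * A = 1 := mul_eq_one_comm.1 hA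
  let e : (Fin n × κ → ZMod 2) ≃ (Fin n × κ → ZMod 2) :=
    { toFun := act A.transpose
      invFun := act A
      left_inv := fun y => by rw [act_act, hA, act_one]
      right_inv := fun y => by rw [act_act, hA', act_one] }
  exact Equiv.sum_comp e fun y => ‖φ y‖ ^ 2

/-- An orthogonal CNOT circuit permutes the products of stabilizer states, up to phases. -/
theorem exists_copyKet_comp_act {A : Matrix κ κ (ZMod 2)} (hA : A * A.transpose = 1)
    {Z X : Fin n → Fin n → ZMod 2} {c : Fin n → ℂ}
    {ψ : (Fin n → ZMod 2) → (Fin n → ZMod 2) → ℂ} (h : StabilizerBasis Z X c ψ) :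
    ∃ s : Fin n × κ → ZMod 2, ∀ b, ∃ a : ℂ, ‖a‖ = 1 ∧
      copyKet ψ b ∘ act A.transpose = a • copyKet ψ (act A b + s) := by
  have hN := h.copies (κ := κ)
  -- Generator `g.1` on copy `g.2` is pulled back to the product of the same generator over the
  -- copies selected by row `g.2` of `A`.
  let V : Fin n × κ → Fin n × κ → ZMod 2 := fun g g' => if g'.1 = g.1 then A g.2 g'.2 else 0
  choose a ha hV using fun g => hN.eigen_sum (V g)
  have hgen : ∀ (w : Fin n → Fin n → ZMod 2) (g : Fin n × κ),
      act A.transpose (copyGen w g) = ∑ g', V g g' • copyGen w g' := by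
    intro w g
    funext q
    rw [sum_smul_copyGen]
    simp [act, V, Matrix.mulVec, dotProduct, copyGen]
  have hdot : ∀ g b, V g ⬝ᵥ b = act A b g := by
    intro g b
    simp [V, dotProduct, Fintype.sum_prod_type_right, act, Matrix.mulVec]
  have heig : ∀ b g, weyl (copyGen Z g) (copyGen X g) (copyKet ψ b ∘ act A.transpose) =
      (a g * sign (act A b g)) • (copyKet ψ b ∘ act A.transpose) := by
    intro b g
    rw [weyl_comp_act hA, hgen, hgen, hV, hdot]
    rfl
  have hu : ∀ b, ∑ y, ‖(copyKet ψ b ∘ act A.transpose) y‖ ^ 2 = 1 := fun b => by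
    rw [sum_norm_sq_comp_act hA, hN.unit]
  have hne : ∀ b, copyKet ψ b ∘ act A.transpose ≠ 0 := by
    intro b h0
    have := hu b
    rw [h0] at this
    simp at this
  -- The shift is read off from `b = 0`. It serves all `b` because the phases `a g` are independent
  -- of `b`.
  obtain ⟨s, -, -, hs⟩ := hN.eq_smul_of_eigen (hne 0) (heig 0)
  refine ⟨s, fun b => ?_⟩
  obtain ⟨κ', a', h1, h2⟩ := hN.eq_smul_of_eigen (hne b) (heig b)
  have hκ : κ' = act A b + s := by
    funext g
    apply sign_injective
    have h3 := hs g
    have h0 : act A (0 : Fin n × κ → ZMod 2) g = 0 := by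
      simp [act, Matrix.mulVec, dotProduct]
    rw [h0, sign_zero, mul_one] at h3
    refine mul_left_cancel₀ (h.phase_ne_zero g.1) ?_
    rw [← h2 g, h3, Pi.add_apply, sign_add]
    ring
  rw [hκ] at h1
  exact ⟨a', hN.norm_eq_one_of_eq_smul h1 (hu b), h1⟩

end copies

/-- The states of a family of stabilizer states form a stabilizer basis. -/
theorem exists_stabilizerBasis {n : ℕ} {S : Matrix (Fin n ⊕ Fin n) (Fin n) (ZMod 2)}
    {ψ : (Fin n → ZMod 2) → (Fin n → ZMod 2) → ℂ} (hψ : ∀ b, IsStabilizerState S b (ψ b)) :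
    ∃ c, StabilizerBasis (fun i q => S (Sum.inl q) i) (fun i q => S (Sum.inr q) i) c ψ := by
  refine ⟨fun i => (pauliPhase (fun q => S (Sum.inl q) i) fun q => S (Sum.inr q) i)⁻¹, rfl,
    fun i => by rw [norm_inv, norm_pauliPhase, inv_one], fun b => (hψ b).unit, fun i b => ?_⟩
  have h := (hψ b).eigen i
  rw [Matrix.smul_mulVec, pauli_mulVec] at h
  have h1 := pauliPhase_ne_zero (fun q => S (Sum.inl q) i) fun q => S (Sum.inr q) i
  have h3 := sign_mul_self (b i)
  generalize pauliPhase (fun q => S (Sum.inl q) i) (fun q => S (Sum.inr q) i) = a at h h1 ⊢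
  conv_rhs => rw [← h]
  rw [smul_smul, smul_smul, mul_assoc, mul_assoc, ← mul_assoc (sign (b i)), h3, one_mul,
    inv_mul_cancel₀ h1, one_smul]

/-! ### Solvability of binary linear systems -/

/-- Fredholm alternative: a vector outside the range is separated from it by a linear functional,
which is the dot product with some `v` in the left kernel. -/
theorem exists_mulVec_eq {α β : Type} [Fintype α] [Fintype β] [DecidableEq α]
    (G : Matrix α β (ZMod 2)) (y : α → ZMod 2)
    (h : ∀ v, Matrix.vecMul v G = 0 → v ⬝ᵥ y = 0) : ∃ x, G.mulVec x = y := by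
  classical
  by_contra hy
  have hy' : y ∉ LinearMap.range G.mulVecLin := by
    rintro ⟨x, hx⟩
    exact hy ⟨x, hx⟩
  obtain ⟨f, hf, hle⟩ := Submodule.exists_le_ker_of_notMem hy'
  have hfe : ∀ w, f w = (fun i => f (Pi.single i 1)) ⬝ᵥ w := by
    intro w
    conv_lhs => rw [pi_eq_sum_univ' w]
    simp [dotProduct, mul_comm]
  apply hf
  rw [hfe]
  apply h
  funext j
  rw [Pi.zero_apply, ← hle ⟨Pi.single j 1, rfl⟩, hfe, Matrix.mulVecLin_apply,
    Matrix.dotProduct_mulVec]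
  simp

section stabilizer
variable {n : ℕ} {S : Matrix (Fin n ⊕ Fin n) (Fin n) (ZMod 2)}

/-- For `v` in `measSpace S M`, the operation `σ_{Sv}` is, up to phase, the product of the measured
observables on the qubits with `t q = 1`. -/
theorem exists_bits_of_mem_measSpace {M : Partition n} {v : Fin n → ZMod 2}
    (hv : v ∈ measSpace S M) : ∃ t : Fin n → ZMod 2, ∀ q,
      S.mulVec v (Sum.inl q) = t q * (M q).zBit ∧ S.mulVec v (Sum.inr q) = t q * (M q).xBit := by
  have h : ∀ q, ∃ t : ZMod 2,
      S.mulVec v (Sum.inl q) = t * (M q).zBit ∧ S.mulVec v (Sum.inr q) = t * (M q).xBit := by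
    intro q
    have h1 := hv q
    generalize S.mulVec v (Sum.inl q) = a at *
    generalize S.mulVec v (Sum.inr q) = b at *
    generalize M q = e at *
    clear hv
    rcases zmod_two_cases a with rfl | rfl <;> rcases zmod_two_cases b with rfl | rfl <;>
      simp_all [Axis.zBit, Axis.xBit]
  choose t ht using h
  exact ⟨t, ht⟩

/-- The hypothesis says that `σ_{Sv}` commutes with the measured observable of each qubit; a
one-qubit Pauli that commutes with a nontrivial one is trivial or equal to it. -/
theorem mem_measSpace_of_bits {M : Partition n} {v : Fin n → ZMod 2}
    (h : ∀ q, S.mulVec v (Sum.inl q) * (M q).xBit + S.mulVec v (Sum.inr q) * (M q).zBit = 0) :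
    v ∈ measSpace S M := by
  intro q
  have h1 := h q
  generalize S.mulVec v (Sum.inl q) = a at *
  generalize S.mulVec v (Sum.inr q) = b at *
  generalize M q = e at *
  clear h
  cases e <;> rcases zmod_two_cases a with rfl | rfl <;> rcases zmod_two_cases b with rfl | rfl <;>
      simp_all [Axis.zBit, Axis.xBit]

/-- Paulis along the measured axes reach every change of the phase vector that is not seen by the
measurement. -/
theorem exists_axis_pauli {M : Partition n} {δ : Fin n → ZMod 2}
    (hδ : ∀ v ∈ measSpace S M, v ⬝ᵥ δ = 0) :
    ∃ t : Fin n → ZMod 2, ∀ i, ((fun q => S (Sum.inl q) i) ⬝ᵥ fun q => t q * (M q).xBit) +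
      ((fun q => S (Sum.inr q) i) ⬝ᵥ fun q => t q * (M q).zBit) = δ i := by
  -- A left kernel vector of this system satisfies the commutation condition of
  -- `mem_measSpace_of_bits`, so the left kernel lies in `measSpace S M`, where `δ` is orthogonal by
  -- assumption.
  obtain ⟨t, ht⟩ := exists_mulVec_eq
    (fun i q => S (Sum.inl q) i * (M q).xBit + S (Sum.inr q) i * (M q).zBit) δ (by
      intro v hv
      apply hδ
      apply mem_measSpace_of_bits
      intro q
      have := congrFun hv q
      simp only [Matrix.vecMul, dotProduct, Pi.zero_apply] at this
      rw [← this]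
      simp only [Matrix.mulVec, dotProduct, Finset.sum_mul, ← Finset.sum_add_distrib]
      exact Finset.sum_congr rfl fun i _ => by ring)
  refine ⟨t, fun i => ?_⟩
  rw [← ht]
  simp only [Matrix.mulVec, dotProduct, ← Finset.sum_add_distrib]
  exact Finset.sum_congr rfl fun i _ => by ring

theorem exists_pauli (hS : LinearIndependent (ZMod 2) S.col) (δ : Fin n → ZMod 2) :
    ∃ z x : Fin n → ZMod 2, ∀ i, ((fun q => S (Sum.inl q) i) ⬝ᵥ x) +
      ((fun q => S (Sum.inr q) i) ⬝ᵥ z) = δ i := by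
  obtain ⟨t, ht⟩ := exists_mulVec_eq S.transpose δ (by
    intro v hv
    rw [Matrix.vecMul_transpose] at hv
    have : v = 0 := Matrix.mulVec_injective_iff.2 hS (by rw [hv, Matrix.mulVec_zero])
    rw [this, zero_dotProduct])
  refine ⟨fun q => t (Sum.inr q), fun q => t (Sum.inl q), fun i => ?_⟩
  rw [← ht]
  simp [Matrix.mulVec, dotProduct, Fintype.sum_sum_type]

theorem mulVec_apply_eq_sum (v : Fin n → ZMod 2) (s : Fin n ⊕ Fin n) :
    S.mulVec v s = ∑ i, v i * S s i := by
  simp only [Matrix.mulVec, dotProduct, mul_comm]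

end stabilizer

/-! ### CNOT circuits -/

section circuit
variable {κ : Type} [Fintype κ] [DecidableEq κ]

theorem Gate.matrix_mulVec (e : Gate κ) (y : κ → ZMod 2) :
    e.matrix.mulVec y = y + Pi.single e.1.2 (y e.1.1) := by
  funext j
  simp only [Gate.matrix, Matrix.transvection, Matrix.add_mulVec, Matrix.one_mulVec, Pi.add_apply,
    Matrix.single_mulVec, one_mul]
  rfl

theorem circuitUnitary_apply (L : List (Gate κ)) (x y : κ → ZMod 2) :
    circuitUnitary L x y = if x = (circuitMatrix L).mulVec y then 1 else 0 := by
  induction L generalizing x with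
  | nil => simp [circuitUnitary, circuitMatrix, Matrix.one_apply]
  | cons e L ih =>
    have h1 : circuitUnitary (e :: L) = e.unitary * circuitUnitary L := by simp [circuitUnitary]
    have h2 : circuitMatrix (e :: L) = e.matrix * circuitMatrix L := by simp [circuitMatrix]
    rw [h1, h2, Matrix.mul_apply, ← Matrix.mulVec_mulVec]
    simp only [ih, mul_ite, mul_one, mul_zero, Finset.sum_ite_eq', Finset.mem_univ, if_true]
    rw [Gate.matrix_mulVec]
    rfl

/-- Gaussian elimination writes `A` with transvections, which are CNOT gates, and one diagonal
factor. Over `ZMod 2` an invertible diagonal matrix is the identity. -/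
theorem exists_circuit (A : Matrix κ κ (ZMod 2)) (hA : A.det ≠ 0) :
    ∃ L : List (Gate κ), circuitMatrix L = A := by
  have htr : ∀ t : Matrix.TransvectionStruct κ (ZMod 2),
      ∃ L : List (Gate κ), circuitMatrix L = t.toMatrix := by
    intro t
    rcases zmod_two_cases t.c with hc | hc
    · exact ⟨[], by simp [circuitMatrix, Matrix.TransvectionStruct.toMatrix, hc]⟩
    · exact ⟨[⟨(t.j, t.i), t.hij.symm⟩], by
        simp [circuitMatrix, Gate.matrix, Matrix.TransvectionStruct.toMatrix, hc]⟩
  have hmul : ∀ L L' : List (Gate κ),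
      circuitMatrix (L ++ L') = circuitMatrix L * circuitMatrix L' := by
    intro L L'; simp [circuitMatrix]
  have hlist : ∀ l : List (Matrix.TransvectionStruct κ (ZMod 2)),
      ∃ L : List (Gate κ), circuitMatrix L = (l.map Matrix.TransvectionStruct.toMatrix).prod := by
    intro l
    induction l with
    | nil => exact ⟨[], by simp [circuitMatrix]⟩
    | cons t l ih =>
      obtain ⟨L1, h1⟩ := htr t
      obtain ⟨L2, h2⟩ := ih
      exact ⟨L1 ++ L2, by rw [hmul, h1, h2, List.map_cons, List.prod_cons]⟩
  obtain ⟨l, l', D, h⟩ := Matrix.Pivot.exists_list_transvec_mul_diagonal_mul_list_transvec A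
  have hD : Matrix.diagonal D = 1 := by
    have hdet : A.det = ∏ i, D i := by
      rw [h]; simp [Matrix.det_mul]
    rw [← Matrix.diagonal_one]
    congr 1
    funext i
    rcases zmod_two_cases (D i) with h0 | h0
    · exact absurd (hdet.trans (Finset.prod_eq_zero (Finset.mem_univ i) h0)) hA
    · exact h0
  obtain ⟨L1, h1⟩ := hlist l
  obtain ⟨L2, h2⟩ := hlist l'
  exact ⟨L1 ++ L2, by rw [hmul, h1, h2, h, hD, mul_one]⟩

end circuit

/-! ### Outcome probabilities -/

/-- The phase vectors of all copies. -/
def allPhases {n k : ℕ} (r : ℕ) (b : Fin k → Fin n → ZMod 2) : Fin n × (Fin k ⊕ Fin r) → ZMod 2 :=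
  fun q => Sum.elim (fun j => b j q.1) (fun _ => 0) q.2

theorem allPhases_sub {n k : ℕ} (r : ℕ) (b b' : Fin k → Fin n → ZMod 2) :
    allPhases r (b - b') = allPhases r b - allPhases r b' := by
  funext ⟨i, j⟩
  cases j <;> simp [allPhases]

theorem inputKet_eq_copyKet {n k : ℕ} (r : ℕ) (ψ : (Fin n → ZMod 2) → (Fin n → ZMod 2) → ℂ)
    (b : Fin k → Fin n → ZMod 2) : inputKet r ψ b = copyKet ψ (allPhases r b) := by
  funext x
  simp only [inputKet, copyKet, Fintype.prod_sum_type]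
  rfl

/-- The part of the phase vectors of the measured copies that stems from the noisy copies. -/
def syndrome {n k r : ℕ} (A : Matrix (Fin k ⊕ Fin r) (Fin k ⊕ Fin r) (ZMod 2))
    (b : Fin k → Fin n → ZMod 2) (j : Fin r) : Fin n → ZMod 2 :=
  ∑ l, A (Sum.inr j) (Sum.inl l) • b l

theorem act_allPhases_inr {n k r : ℕ} (A : Matrix (Fin k ⊕ Fin r) (Fin k ⊕ Fin r) (ZMod 2))
    (b : Fin k → Fin n → ZMod 2) (i : Fin n) (j : Fin r) :
    act A (allPhases r b) (i, Sum.inr j) = syndrome A b j i := by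
  simp [act, allPhases, syndrome, Matrix.mulVec, dotProduct, Fintype.sum_sum_type]

theorem syndrome_sub {n k r : ℕ} (A : Matrix (Fin k ⊕ Fin r) (Fin k ⊕ Fin r) (ZMod 2))
    (b b' : Fin k → Fin n → ZMod 2) (j : Fin r) :
    syndrome A (b - b') j = syndrome A b j - syndrome A b' j := by
  simp [syndrome, smul_sub, Finset.sum_sub_distrib]

/-- The measurement `axes` does not see the difference `Δ` of two lists of phase vectors. -/
def Unseen {n k r : ℕ} (S : Matrix (Fin n ⊕ Fin n) (Fin n) (ZMod 2))
    (A : Matrix (Fin k ⊕ Fin r) (Fin k ⊕ Fin r) (ZMod 2)) (axes : Fin r → Partition n)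
    (Δ : Fin k → Fin n → ZMod 2) : Prop :=
  ∀ j, ∀ v ∈ measSpace S (axes j), v ⬝ᵥ syndrome A Δ j = 0

namespace Protocol
variable {n k r : ℕ} (T : Protocol n k r)

theorem unitary_mulVec (φ : (Fin n × (Fin k ⊕ Fin r) → ZMod 2) → ℂ) :
    T.unitary.mulVec φ = φ ∘ act T.A.transpose := by
  have hA : T.A.transpose * T.A = 1 := mul_eq_one_comm.1 T.orthogonal
  funext x
  have h : ∀ y, T.unitary x y = if y = act T.A.transpose x then 1 else 0 := by
    intro y
    simp only [unitary, circuitUnitary_apply, T.circuit_eq, Finset.prod_ite_zero,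
      Finset.prod_const_one]
    congr 1
    apply propext
    constructor
    · intro h
      have : x = act T.A y := by
        funext q; exact congrFun (h q.1 (Finset.mem_univ _)) q.2
      rw [this, act_act, hA, act_one]
    · rintro rfl i -
      have : x = act T.A (act T.A.transpose x) := by rw [act_act, T.orthogonal, act_one]
      funext l
      exact congrFun this (i, l)
  simp [Matrix.mulVec, dotProduct, h]

/-- On the measured qubits the Pauli is trivial or the measured observable; on the remaining copies
it is arbitrary, since the projector is the identity there. -/
theorem proj_mul_pauli (o t : Fin n × Fin r → ZMod 2) {z x : Fin n × (Fin k ⊕ Fin r) → ZMod 2}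
    (hz : ∀ i j, z (i, Sum.inr j) = t (i, j) * (T.axes j i).zBit)
    (hx : ∀ i j, x (i, Sum.inr j) = t (i, j) * (T.axes j i).xBit) :
    T.proj o * pauli z x = pauli z x * T.proj o := by
  rw [proj, pauli, tensorOp_mul, tensorOp_mul]
  congr 1
  funext ⟨i, j⟩
  cases j with
  | inl j => simp
  | inr j => simp only [hz, hx, Sum.elim_inr, Axis.sigma_mul_proj, Axis.proj_mul_sigma]

/-- A product of measured observables takes a definite value on the range of the projector; that
value is a function of the outcome alone. -/
theorem pauli_mul_proj (o t : Fin n × Fin r → ZMod 2) {z x : Fin n × (Fin k ⊕ Fin r) → ZMod 2}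
    (hz : ∀ i j, z (i, Sum.inr j) = t (i, j) * (T.axes j i).zBit)
    (hx : ∀ i j, x (i, Sum.inr j) = t (i, j) * (T.axes j i).xBit)
    (hz0 : ∀ i j, z (i, Sum.inl j) = 0) (hx0 : ∀ i j, x (i, Sum.inl j) = 0) :
    ∃ a : ℂ, pauli z x * T.proj o = a • T.proj o := by
  refine ⟨∏ q : Fin n × (Fin k ⊕ Fin r),
    Sum.elim (fun _ => 1) (fun j => sign (t (q.1, j) * o (q.1, j))) q.2, ?_⟩
  rw [proj, pauli, tensorOp_mul, ← tensorOp_smul]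
  congr 1
  funext ⟨i, j⟩
  cases j with
  | inl j =>
    have h := Axis.sigma_bits Axis.z 0
    simp only [zero_mul, if_true] at h
    simp [hz0, hx0, h]
  | inr j => simp only [hz, hx, Sum.elim_inr, Axis.sigma_mul_proj]

theorem sum_conjTranspose_proj_mul_proj :
    ∑ o, (T.proj o).conjTranspose * T.proj o = 1 := by
  have h : ∀ o, (T.proj o).conjTranspose * T.proj o = T.proj o := by
    intro o
    rw [proj, conjTranspose_tensorOp, tensorOp_mul]
    congr 1
    funext ⟨i, j⟩
    cases j <;> simp [Axis.conjTranspose_proj_mul_proj]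
  simp only [h]
  ext x y
  rw [Matrix.sum_apply, ← tensorOp_one]
  have h2 : ∀ o, T.proj o x y =
      (∏ q : Fin n × Fin k, (1 : Matrix (ZMod 2) (ZMod 2) ℂ) (x (q.1, Sum.inl q.2))
        (y (q.1, Sum.inl q.2))) *
      ∏ q : Fin n × Fin r, (T.axes q.2 q.1).proj (o q) (x (q.1, Sum.inr q.2))
        (y (q.1, Sum.inr q.2)) := by
    intro o
    simp only [proj, tensorOp, Fintype.prod_prod_type, Fintype.prod_sum_type,
      Finset.prod_mul_distrib]
    rfl
  simp only [h2, ← Finset.mul_sum]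
  rw [← Fintype.piFinset_univ, ← Finset.prod_univ_sum (fun _ => Finset.univ)
    (fun (q : Fin n × Fin r) s => (T.axes q.2 q.1).proj s (x (q.1, Sum.inr q.2))
      (y (q.1, Sum.inr q.2)))]
  simp only [← Matrix.sum_apply, Axis.sum_proj]
  simp only [tensorOp, Fintype.prod_prod_type, Fintype.prod_sum_type, Finset.prod_mul_distrib]

theorem sum_norm_sq_proj (φ : (Fin n × (Fin k ⊕ Fin r) → ZMod 2) → ℂ) :
    ∑ o, ∑ x, ‖((T.proj o).mulVec φ) x‖ ^ 2 = ∑ x, ‖φ x‖ ^ 2 := by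
  have h : ∀ o, ((∑ x, ‖((T.proj o).mulVec φ) x‖ ^ 2 : ℝ) : ℂ) =
      star φ ⬝ᵥ ((T.proj o).conjTranspose * T.proj o).mulVec φ := by
    intro o
    rw [← star_dotProduct_self, Matrix.star_mulVec, ← Matrix.mulVec_mulVec,
      Matrix.dotProduct_mulVec, Matrix.dotProduct_mulVec, Matrix.dotProduct_mulVec]
  have h2 : ((∑ o, ∑ x, ‖((T.proj o).mulVec φ) x‖ ^ 2 : ℝ) : ℂ) =
      ((∑ x, ‖φ x‖ ^ 2 : ℝ) : ℂ) := by
    rw [Complex.ofReal_sum]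
    simp only [h]
    rw [← dotProduct_sum, ← Matrix.sum_mulVec, sum_conjTranspose_proj_mul_proj,
      Matrix.one_mulVec, star_dotProduct_self]
  exact_mod_cast h2

theorem outcomeProb_nonneg (ψ : (Fin n → ZMod 2) → (Fin n → ZMod 2) → ℂ)
    (b : Fin k → Fin n → ZMod 2) (o : Fin n × Fin r → ZMod 2) : 0 ≤ T.outcomeProb ψ b o :=
  Finset.sum_nonneg fun _ _ => by positivity

variable {S : Matrix (Fin n ⊕ Fin n) (Fin n) (ZMod 2)}
  {ψ : (Fin n → ZMod 2) → (Fin n → ZMod 2) → ℂ}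

/-- The state before the measurement is again a product of stabilizer states. -/
theorem exists_unitary_inputKet (hψ : ∀ b, IsStabilizerState S b (ψ b)) :
    ∃ s : Fin n × (Fin k ⊕ Fin r) → ZMod 2, ∀ b, ∃ a : ℂ, ‖a‖ = 1 ∧
      T.unitary.mulVec (inputKet r ψ b) = a • copyKet ψ (act T.A (allPhases r b) + s) := by
  obtain ⟨c, hc⟩ := exists_stabilizerBasis hψ
  obtain ⟨s, hs⟩ := exists_copyKet_comp_act T.orthogonal hc
  refine ⟨s, fun b => ?_⟩
  rw [unitary_mulVec, inputKet_eq_copyKet]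
  exact hs _

theorem outcomeProb_eq {b : Fin k → Fin n → ZMod 2} {a : ℂ}
    {φ : (Fin n × (Fin k ⊕ Fin r) → ZMod 2) → ℂ} (ha : ‖a‖ = 1)
    (h : T.unitary.mulVec (inputKet r ψ b) = a • φ) (o : Fin n × Fin r → ZMod 2) :
    T.outcomeProb ψ b o = ∑ x, ‖((T.proj o).mulVec φ) x‖ ^ 2 := by
  rw [outcomeProb, ← Matrix.mulVec_mulVec, h, Matrix.mulVec_smul, sum_norm_sq_smul, ha, one_pow,
    one_mul]

theorem sum_outcomeProb (hψ : ∀ b, IsStabilizerState S b (ψ b)) (b : Fin k → Fin n → ZMod 2) :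
    ∑ o, T.outcomeProb ψ b o = 1 := by
  obtain ⟨c, hc⟩ := exists_stabilizerBasis hψ
  obtain ⟨s, hs⟩ := T.exists_unitary_inputKet hψ
  obtain ⟨a, ha, h⟩ := hs b
  simp only [T.outcomeProb_eq ha h, sum_norm_sq_proj]
  exact hc.copies.unit _

/-- The measurement distinguishes lists of phase vectors with a visible difference perfectly. -/
theorem unseen_of_outcomeProb_ne_zero (hψ : ∀ b, IsStabilizerState S b (ψ b))
    {b b' : Fin k → Fin n → ZMod 2} {o : Fin n × Fin r → ZMod 2}
    (h : T.outcomeProb ψ b o ≠ 0) (h' : T.outcomeProb ψ b' o ≠ 0) :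
    Unseen S T.A T.axes (b - b') := by
  intro j v hv
  obtain ⟨c, hc⟩ := exists_stabilizerBasis hψ
  obtain ⟨s, hs⟩ := T.exists_unitary_inputKet hψ
  obtain ⟨t, ht⟩ := exists_bits_of_mem_measSpace hv
  -- The stabilizer element `v` on the measured copy `j`. Its eigenvalue on the state is fixed by
  -- the phase bits, and its value in the measurement is fixed by the outcome.
  let V : Fin n × (Fin k ⊕ Fin r) → ZMod 2 := fun g => if g.2 = Sum.inr j then v g.1 else 0
  obtain ⟨μ, hμ, hV⟩ := (hc.copies (κ := Fin k ⊕ Fin r)).eigen_sum V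
  set z := ∑ g, V g • copyGen (fun i q => S (Sum.inl q) i) g with hzdef
  set x := ∑ g, V g • copyGen (fun i q => S (Sum.inr q) i) g with hxdef
  have hz : ∀ i l, z (i, l) = if l = Sum.inr j then t i * (T.axes j i).zBit else 0 := by
    intro i l
    rw [hzdef, sum_smul_copyGen, ← (ht i).1, mulVec_apply_eq_sum]
    by_cases hl : l = Sum.inr j <;> simp [V, hl]
  have hx : ∀ i l, x (i, l) = if l = Sum.inr j then t i * (T.axes j i).xBit else 0 := by
    intro i l
    rw [hxdef, sum_smul_copyGen, ← (ht i).2, mulVec_apply_eq_sum]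
    by_cases hl : l = Sum.inr j <;> simp [V, hl]
  let t' : Fin n × Fin r → ZMod 2 := fun q => if q.2 = j then t q.1 else 0
  have hz1 : ∀ i l, z (i, Sum.inr l) = t' (i, l) * (T.axes l i).zBit := by
    intro i l
    rw [hz]
    by_cases hl : l = j <;> simp [t', hl]
  have hx1 : ∀ i l, x (i, Sum.inr l) = t' (i, l) * (T.axes l i).xBit := by
    intro i l
    rw [hx]
    by_cases hl : l = j <;> simp [t', hl]
  have hcomm := T.proj_mul_pauli o t' hz1 hx1
  obtain ⟨a, ha⟩ := T.pauli_mul_proj o t' hz1 hx1 (fun i l => by simp [hz])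
    (fun i l => by simp [hx])
  -- If the projected state is nonzero, both values of the stabilizer element must agree. As `a`
  -- depends on `o` and not on `b`, two inputs that allow `o` have the same bit.
  have key : ∀ b, T.outcomeProb ψ b o ≠ 0 →
      a = pauliPhase z x * (μ * sign (V ⬝ᵥ (act T.A (allPhases r b) + s))) := by
    intro b hb
    obtain ⟨a', ha', hU⟩ := hs b
    rw [T.outcomeProb_eq ha' hU] at hb
    have h1 := congrArg
      (fun Q => Matrix.mulVec Q (copyKet ψ (act T.A (allPhases r b) + s))) (hcomm.trans ha)
    simp only [← Matrix.mulVec_mulVec, pauli_mulVec, hV, Matrix.mulVec_smul, smul_smul,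
      Matrix.smul_mulVec] at h1
    by_contra hne
    apply hb
    have h2 : (T.proj o).mulVec (copyKet ψ (act T.A (allPhases r b) + s)) = 0 := by
      rw [← sub_eq_zero, ← sub_smul, smul_eq_zero, sub_eq_zero] at h1
      exact h1.resolve_left fun h => hne h.symm
    simp [h2]
  have h3 := (key b h).symm.trans (key b' h')
  have h4 := sign_injective
    (mul_left_cancel₀ hμ (mul_left_cancel₀ (pauliPhase_ne_zero z x) h3))
  rw [dotProduct_add, dotProduct_add, add_left_inj] at h4
  have h5 : ∀ b, V ⬝ᵥ act T.A (allPhases r b) = v ⬝ᵥ syndrome T.A b j := by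
    intro b
    simp only [dotProduct, ← act_allPhases_inr]
    simp [V, Fintype.sum_prod_type]
  rw [h5, h5] at h4
  rw [syndrome_sub, dotProduct_sub, h4, sub_self]

/-- Lists of phase vectors with an invisible difference lead to the same outcome probabilities. -/
theorem outcomeProb_eq_of_unseen (hS : IsStabilizerMatrix S)
    (hψ : ∀ b, IsStabilizerState S b (ψ b)) {b b' : Fin k → Fin n → ZMod 2}
    (h : Unseen S T.A T.axes (b - b')) (o : Fin n × Fin r → ZMod 2) :
    T.outcomeProb ψ b o = T.outcomeProb ψ b' o := by
  obtain ⟨c, hc⟩ := exists_stabilizerBasis hψ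
  obtain ⟨s, hs⟩ := T.exists_unitary_inputKet hψ
  have hex : ∀ j : Fin r, ∃ t : Fin n → ZMod 2, ∀ i,
      ((fun q => S (Sum.inl q) i) ⬝ᵥ fun q => t q * (T.axes j q).xBit) +
      ((fun q => S (Sum.inr q) i) ⬝ᵥ fun q => t q * (T.axes j q).zBit) =
        syndrome T.A (b - b') j i := fun j => exists_axis_pauli (h j)
  choose t ht using hex
  have hex2 : ∀ l : Fin k, ∃ z x : Fin n → ZMod 2, ∀ i,
      ((fun q => S (Sum.inl q) i) ⬝ᵥ x) + ((fun q => S (Sum.inr q) i) ⬝ᵥ z) =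
        act T.A (allPhases r (b - b')) (i, Sum.inl l) := fun l =>
    exists_pauli hS.linearIndependent fun i => act T.A (allPhases r (b - b')) (i, Sum.inl l)
  choose z0 x0 h0 using hex2
  -- A Pauli that carries the state of `b'` to that of `b`: along the measured axes on the measured
  -- copies, where invisibility makes this possible, and unrestricted on the others. It commutes
  -- with the projectors, so the norms after projection agree.
  let z : Fin n × (Fin k ⊕ Fin r) → ZMod 2 := fun q =>
    Sum.elim (fun l => z0 l q.1) (fun j => t j q.1 * (T.axes j q.1).zBit) q.2
  let x : Fin n × (Fin k ⊕ Fin r) → ZMod 2 := fun q =>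
    Sum.elim (fun l => x0 l q.1) (fun j => t j q.1 * (T.axes j q.1).xBit) q.2
  have hcomm := T.proj_mul_pauli o (fun q => t q.2 q.1) (z := z) (x := x) (fun _ _ => rfl)
    fun _ _ => rfl
  have hδ : (fun g : Fin n × (Fin k ⊕ Fin r) => copyGen (fun i q => S (Sum.inl q) i) g ⬝ᵥ x +
      copyGen (fun i q => S (Sum.inr q) i) g ⬝ᵥ z) = act T.A (allPhases r (b - b')) := by
    funext ⟨i, l⟩
    rw [copyGen_dotProduct, copyGen_dotProduct]
    cases l with
    | inl l => exact h0 l i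
    | inr j => rw [act_allPhases_inr]; exact ht j i
  obtain ⟨a, ha, hU⟩ := hs b
  obtain ⟨a', ha', hU'⟩ := hs b'
  obtain ⟨a2, ha2, hw⟩ := (hc.copies (κ := Fin k ⊕ Fin r)).weyl_eq_smul z x
    (act T.A (allPhases r b') + s)
  rw [hδ] at hw
  have hsum : act T.A (allPhases r b') + s + act T.A (allPhases r (b - b')) =
      act T.A (allPhases r b) + s := by
    rw [add_right_comm, ← act_add, allPhases_sub, add_sub_cancel]
  rw [hsum] at hw
  rw [T.outcomeProb_eq ha hU, T.outcomeProb_eq ha' hU']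
  have h1 : (T.proj o).mulVec ((pauli z x).mulVec (copyKet ψ (act T.A (allPhases r b') + s))) =
      (pauli z x).mulVec ((T.proj o).mulVec (copyKet ψ (act T.A (allPhases r b') + s))) := by
    rw [Matrix.mulVec_mulVec, hcomm, ← Matrix.mulVec_mulVec]
  rw [pauli_mulVec, hw, pauli_mulVec, smul_smul, Matrix.mulVec_smul] at h1
  have h2 := congrArg (fun φ => ∑ y, ‖φ y‖ ^ 2) h1
  simp only [sum_norm_sq_smul, sum_norm_sq_weyl, norm_mul, ha2, norm_pauliPhase, one_pow,
    one_mul] at h2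
  exact h2

end Protocol

/-! ### Fidelity -/

theorem mul_ketbra_mul_conjTranspose {X Y : Type} [Fintype X] [Fintype Y] (M : Matrix Y X ℂ)
    (φ : X → ℂ) : M * ketbra φ * M.conjTranspose = ketbra (M.mulVec φ) := by
  rw [ketbra, ketbra, Matrix.mul_vecMulVec, Matrix.vecMulVec_mul, Matrix.star_mulVec]

theorem inputState_eq_sum {n k r : ℕ} (ψ : (Fin n → ZMod 2) → (Fin n → ZMod 2) → ℂ)
    (p : (Fin n → ZMod 2) → ℝ) :
    inputState k r ψ p = ∑ b : Fin k → Fin n → ZMod 2, ((∏ j, p (b j) : ℝ) : ℂ) •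
      ketbra (inputKet r ψ b) := by
  ext x y
  have h : (∏ j : Fin k, mixedState ψ p (fun i => x (i, Sum.inl j)) fun i => y (i, Sum.inl j)) =
      ∑ b : Fin k → Fin n → ZMod 2, ∏ j, ((p (b j) : ℂ) *
        ketbra (ψ (b j)) (fun i => x (i, Sum.inl j)) fun i => y (i, Sum.inl j)) := by
    simp only [mixedState, Matrix.sum_apply, Matrix.smul_apply, smul_eq_mul]
    rw [Finset.prod_univ_sum, Fintype.piFinset_univ]
  rw [inputState, h, Finset.sum_mul, Matrix.sum_apply]
  refine Finset.sum_congr rfl fun b _ => ?_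
  simp only [Matrix.smul_apply, smul_eq_mul, ketbra, Matrix.vecMulVec_apply, inputKet,
    Pi.star_apply, star_mul', star_prod, Finset.prod_mul_distrib, Complex.ofReal_prod]
  ring

theorem discard_sum {n k r : ℕ} {β : Type} (s : Finset β)
    (F : β → Matrix (Fin n × (Fin k ⊕ Fin r) → ZMod 2) (Fin n × (Fin k ⊕ Fin r) → ZMod 2) ℂ) :
    discard (∑ b ∈ s, F b) = ∑ b ∈ s, discard (F b) := by
  ext x y
  simp only [discard, Matrix.sum_apply]
  exact Finset.sum_comm

theorem discard_smul {n k r : ℕ} (a : ℂ)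
    (F : Matrix (Fin n × (Fin k ⊕ Fin r) → ZMod 2) (Fin n × (Fin k ⊕ Fin r) → ZMod 2) ℂ) :
    discard (a • F) = a • discard F := by
  ext x y
  simp only [discard, Matrix.smul_apply, Finset.smul_sum]

/-- The tensor product of kets of the two groups of copies. -/
def tensorKet {n k r : ℕ} (φ : (Fin n × Fin k → ZMod 2) → ℂ) (η : (Fin n × Fin r → ZMod 2) → ℂ) :
    (Fin n × (Fin k ⊕ Fin r) → ZMod 2) → ℂ :=
  fun x => φ (fun q => x (q.1, Sum.inl q.2)) * η fun q => x (q.1, Sum.inr q.2)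

/-- Labels of all copies as pairs of labels of the two groups of copies. -/
def splitEquiv (n k r : ℕ) : (Fin n × (Fin k ⊕ Fin r) → ZMod 2) ≃
    (Fin n × Fin k → ZMod 2) × (Fin n × Fin r → ZMod 2) where
  toFun x := (fun q => x (q.1, Sum.inl q.2), fun q => x (q.1, Sum.inr q.2))
  invFun xy q := Sum.elim (fun j => xy.1 (q.1, j)) (fun j => xy.2 (q.1, j)) q.2
  left_inv x := by
    funext ⟨i, j⟩
    cases j <;> rfl
  right_inv _ := rfl

theorem sum_split {R : Type} [AddCommMonoid R] {n k r : ℕ}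
    (F : (Fin n × Fin k → ZMod 2) → (Fin n × Fin r → ZMod 2) → R) :
    ∑ x : Fin n × (Fin k ⊕ Fin r) → ZMod 2,
      F (fun q => x (q.1, Sum.inl q.2)) (fun q => x (q.1, Sum.inr q.2)) = ∑ x, ∑ y, F x y := by
  rw [← Fintype.sum_prod_type']
  exact Equiv.sum_comp (splitEquiv n k r) fun xy => F xy.1 xy.2

theorem sum_norm_sq_tensorKet {n k r : ℕ} (φ : (Fin n × Fin k → ZMod 2) → ℂ)
    (η : (Fin n × Fin r → ZMod 2) → ℂ) :
    ∑ x, ‖tensorKet φ η x‖ ^ 2 = (∑ x, ‖φ x‖ ^ 2) * ∑ y, ‖η y‖ ^ 2 := by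
  simp only [tensorKet, norm_mul, mul_pow]
  rw [sum_split fun x y => ‖φ x‖ ^ 2 * ‖η y‖ ^ 2, Finset.sum_mul_sum]

theorem discard_ketbra_tensorKet {n k r : ℕ} (φ : (Fin n × Fin k → ZMod 2) → ℂ)
    (η : (Fin n × Fin r → ZMod 2) → ℂ) :
    discard (ketbra (tensorKet φ η)) = ((∑ y, ‖η y‖ ^ 2 : ℝ) : ℂ) • ketbra φ := by
  ext x y
  rw [← star_dotProduct_self]
  simp only [discard, ketbra, Matrix.vecMulVec_apply, tensorKet, Pi.star_apply, star_mul',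
    Matrix.smul_apply, smul_eq_mul, dotProduct, Finset.sum_mul]
  refine Finset.sum_congr rfl fun t _ => ?_
  simp only [Sum.elim_inl, Sum.elim_inr]
  ring

theorem copyKet_eq_tensorKet {n k r : ℕ} (ψ : (Fin n → ZMod 2) → (Fin n → ZMod 2) → ℂ)
    (b : Fin n × (Fin k ⊕ Fin r) → ZMod 2) :
    copyKet ψ b = tensorKet (copyKet ψ fun q : Fin n × Fin k => b (q.1, Sum.inl q.2))
      (copyKet ψ fun q : Fin n × Fin r => b (q.1, Sum.inr q.2)) := by
  funext x
  simp only [copyKet, tensorKet, Fintype.prod_sum_type]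

theorem star_dotProduct_ketbra_mulVec {X : Type} [Fintype X] (Φ φ : X → ℂ) :
    star Φ ⬝ᵥ (ketbra φ).mulVec Φ = ((‖star Φ ⬝ᵥ φ‖ ^ 2 : ℝ) : ℂ) := by
  rw [ketbra, Matrix.vecMulVec_mulVec, dotProduct_smul]
  have h : star φ ⬝ᵥ Φ = star (star Φ ⬝ᵥ φ) := by
    rw [← Matrix.star_dotProduct]
  rw [h, Complex.ofReal_pow, ← Complex.mul_conj']
  rfl

namespace Protocol
variable {n k r : ℕ} (T : Protocol n k r)

theorem proj_mulVec_tensorKet (o : Fin n × Fin r → ZMod 2) (φ : (Fin n × Fin k → ZMod 2) → ℂ)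
    (η : (Fin n × Fin r → ZMod 2) → ℂ) :
    (T.proj o).mulVec (tensorKet φ η) = tensorKet φ
      ((tensorOp fun q : Fin n × Fin r => (T.axes q.2 q.1).proj (o q)).mulVec η) := by
  funext x
  have h2 : ∀ y, T.proj o x y =
      (if (fun q : Fin n × Fin k => x (q.1, Sum.inl q.2)) = (fun q => y (q.1, Sum.inl q.2))
        then 1 else 0) *
      tensorOp (fun q : Fin n × Fin r => (T.axes q.2 q.1).proj (o q))
        (fun q => x (q.1, Sum.inr q.2)) fun q => y (q.1, Sum.inr q.2) := by
    intro y
    rw [← Matrix.one_apply, ← tensorOp_one]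
    simp only [proj, tensorOp, Fintype.prod_prod_type, Fintype.prod_sum_type,
      Finset.prod_mul_distrib]
    rfl
  simp only [Matrix.mulVec, dotProduct, h2, tensorKet]
  rw [sum_split fun y1 y2 => (if (fun q : Fin n × Fin k => x (q.1, Sum.inl q.2)) = y1
        then 1 else 0) *
      tensorOp (fun q : Fin n × Fin r => (T.axes q.2 q.1).proj (o q))
        (fun q => x (q.1, Sum.inr q.2)) y2 * (φ y1 * η y2)]
  simp only [ite_mul, one_mul, zero_mul, Finset.sum_ite_irrel, Finset.sum_const_zero,
    Finset.sum_ite_eq, Finset.mem_univ, if_true, Finset.mul_sum]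
  exact Finset.sum_congr rfl fun y _ => by ring

/-- With suitable corrections the fidelity is at least the probability of a correct guess. -/
theorem exists_corrections {S : Matrix (Fin n ⊕ Fin n) (Fin n) (ZMod 2)}
    {ψ : (Fin n → ZMod 2) → (Fin n → ZMod 2) → ℂ} (hS : IsStabilizerMatrix S)
    (hψ : ∀ b, IsStabilizerState S b (ψ b))
    {p : (Fin n → ZMod 2) → ℝ} (hp : ∀ b, 0 ≤ p b) (hp1 : ∑ b, p b = 1) :
    ∃ cz cx, 1 - T.errorProb ψ p ≤ ({ T with corrZ := cz, corrX := cx } : Protocol n k r).fidelity ψ p ∧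
      ({ T with corrZ := cz, corrX := cx } : Protocol n k r).fidelity ψ p ≤ 1 := by
  obtain ⟨c, hc⟩ := exists_stabilizerBasis hψ
  obtain ⟨s, hs⟩ := T.exists_unitary_inputKet hψ
  have hk := hc.copies (κ := Fin k)
  choose a ha hU using hs
  -- The phase vectors of the remaining copies after the circuit. The correction for outcome `o`
  -- shifts them by `β (T.decode o)`.
  let β : (Fin k → Fin n → ZMod 2) → Fin n × Fin k → ZMod 2 := fun b q =>
    (act T.A (allPhases r b) + s) (q.1, Sum.inl q.2)
  have hex : ∀ (o : Fin n × Fin r → ZMod 2) (l : Fin k), ∃ z x : Fin n → ZMod 2, ∀ i,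
      ((fun q => S (Sum.inl q) i) ⬝ᵥ x) + ((fun q => S (Sum.inr q) i) ⬝ᵥ z) =
        β (T.decode o) (i, l) := fun o l =>
    exists_pauli hS.linearIndependent fun i => β (T.decode o) (i, l)
  choose z x hzx using hex
  refine ⟨fun o q => z o q.2 q.1, fun o q => x o q.2 q.1, ?_⟩
  set T' : Protocol n k r := { T with corrZ := fun o q => z o q.2 q.1,
                                       corrX := fun o q => x o q.2 q.1 } with hT'
  let C : (Fin n × Fin r → ZMod 2) → Matrix (Fin n × Fin k → ZMod 2) (Fin n × Fin k → ZMod 2) ℂ :=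
    fun o => pauli (T'.corrZ o) (T'.corrX o)
  have hC : ∀ o b, ∃ a' : ℂ, ‖a'‖ = 1 ∧
      (C o).mulVec (copyKet ψ (β b)) = a' • copyKet ψ (β b + β (T.decode o)) := by
    intro o b
    obtain ⟨a', ha', hw⟩ := hk.weyl_eq_smul (T'.corrZ o) (T'.corrX o) (β b)
    refine ⟨pauliPhase (T'.corrZ o) (T'.corrX o) * a', by
      rw [norm_mul, norm_pauliPhase, ha', one_mul], ?_⟩
    simp only [C, pauli_mulVec]
    rw [hw, smul_smul]
    congr 3
    funext ⟨i, l⟩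
    rw [copyGen_dotProduct, copyGen_dotProduct]
    exact hzx o l i
  have htarget : targetKet k ψ = copyKet ψ (0 : Fin n × Fin k → ZMod 2) := rfl
  let F : (Fin n × Fin r → ZMod 2) → (Fin k → Fin n → ZMod 2) → ℝ := fun o b =>
    ‖star (targetKet k ψ) ⬝ᵥ (C o).mulVec (copyKet ψ (β b))‖ ^ 2
  -- Products of stabilizer states are orthonormal, so the corrected state either is the target up
  -- to phase or is orthogonal to it. A wrong guess with the same `β` still gives the target, hence
  -- only an inequality below.
  have hF : ∀ o b, F o b = if β b = β (T.decode o) then 1 else 0 := by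
    intro o b
    obtain ⟨a', ha', h⟩ := hC o b
    have hiff : (0 = β b + β (T.decode o)) ↔ β b = β (T.decode o) := by
      constructor
      · intro h0
        funext q
        have := congrFun h0 q
        simp only [Pi.add_apply, Pi.zero_apply] at this
        exact CharTwo.add_eq_zero.1 this.symm
      · intro h0
        rw [h0, add_self_bits]
    simp only [F]
    rw [h, dotProduct_smul, htarget, hk.orthonormal]
    simp only [hiff]
    split_ifs <;> simp [ha']
  have hterm : ∀ o b, star (targetKet k ψ) ⬝ᵥ (C o * discard (T.proj o * (T.unitary *
      ketbra (inputKet r ψ b) * T.unitary.conjTranspose) * (T.proj o).conjTranspose) *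
      (C o).conjTranspose).mulVec (targetKet k ψ) = ((T.outcomeProb ψ b o * F o b : ℝ) : ℂ) := by
    intro o b
    -- The measurement acts on the second tensor factor only: discarding that factor leaves the pure
    -- state with label `β b`, weighted by the outcome probability.
    have h1 : (T.proj o).mulVec (T.unitary.mulVec (inputKet r ψ b)) =
        tensorKet (copyKet ψ (β b)) (a b •
          (tensorOp fun q : Fin n × Fin r => (T.axes q.2 q.1).proj (o q)).mulVec
            (copyKet ψ fun q : Fin n × Fin r =>
              (act T.A (allPhases r b) + s) (q.1, Sum.inr q.2))) := by
      rw [hU, Matrix.mulVec_smul, copyKet_eq_tensorKet, proj_mulVec_tensorKet]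
      funext y
      simp only [tensorKet, Pi.smul_apply, smul_eq_mul, β]
      ring
    rw [mul_ketbra_mul_conjTranspose, mul_ketbra_mul_conjTranspose, h1, discard_ketbra_tensorKet,
      Matrix.mul_smul, Matrix.smul_mul, mul_ketbra_mul_conjTranspose, Matrix.smul_mulVec,
      dotProduct_smul, star_dotProduct_ketbra_mulVec, smul_eq_mul, ← Complex.ofReal_mul]
    congr 2
    rw [outcomeProb, ← Matrix.mulVec_mulVec, h1, sum_norm_sq_tensorKet, hk.unit, one_mul]
  have hfid : T'.fidelity ψ p = ∑ o, ∑ b : Fin k → Fin n → ZMod 2,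
      (∏ j, p (b j)) * (T.outcomeProb ψ b o * F o b) := by
    have hout : T'.output ψ p = ∑ o, ∑ b : Fin k → Fin n → ZMod 2, ((∏ j, p (b j) : ℝ) : ℂ) •
        (C o * discard (T.proj o * (T.unitary *
          ketbra (inputKet r ψ b) * T.unitary.conjTranspose) * (T.proj o).conjTranspose) *
          (C o).conjTranspose) := by
      change ∑ o, C o * discard (T.proj o * (T.unitary * inputState k r ψ p *
        T.unitary.conjTranspose) * (T.proj o).conjTranspose) * (C o).conjTranspose = _
      refine Finset.sum_congr rfl fun o _ => ?_
      rw [inputState_eq_sum]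
      simp only [Matrix.mul_sum, Matrix.sum_mul, Matrix.mul_smul, Matrix.smul_mul, discard_sum,
        discard_smul]
    rw [fidelity, hout]
    simp only [Matrix.sum_mulVec, dotProduct_sum, Matrix.smul_mulVec, dotProduct_smul, hterm,
      smul_eq_mul]
    simp only [← Complex.ofReal_mul, ← Complex.ofReal_sum, Complex.ofReal_re]
  have hpp : ∀ b : Fin k → Fin n → ZMod 2, 0 ≤ ∏ j, p (b j) := fun b =>
    Finset.prod_nonneg fun j _ => hp _
  have hpp1 : ∑ b : Fin k → Fin n → ZMod 2, ∏ j, p (b j) = 1 := by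
    rw [← Fintype.piFinset_univ, ← Finset.prod_univ_sum (fun _ => Finset.univ) fun _ x => p x]
    simp [hp1]
  have htot : ∑ b : Fin k → Fin n → ZMod 2, (∏ j, p (b j)) * ∑ o, T.outcomeProb ψ b o = 1 := by
    simp only [T.sum_outcomeProb hψ, mul_one, hpp1]
  rw [hfid, Finset.sum_comm]
  simp only [← Finset.mul_sum]
  constructor
  · rw [← htot, errorProb, ← Finset.sum_sub_distrib]
    refine Finset.sum_le_sum fun b _ => ?_
    rw [← mul_sub, ← Finset.sum_sub_distrib]
    refine mul_le_mul_of_nonneg_left (Finset.sum_le_sum fun o _ => ?_) (hpp b)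
    rw [hF]
    by_cases hb : T.decode o = b
    · simp [hb]
    · rw [if_neg hb, sub_self]
      exact mul_nonneg (T.outcomeProb_nonneg ψ b o) (by split_ifs <;> simp)
  · rw [← htot]
    refine Finset.sum_le_sum fun b _ =>
      mul_le_mul_of_nonneg_left (Finset.sum_le_sum fun o _ => ?_) (hpp b)
    refine mul_le_of_le_one_right (T.outcomeProb_nonneg ψ b o) ?_
    rw [hF]
    split_ifs <;> simp

end Protocol

/-! ### Orthogonal complements -/

section perp
variable {n : ℕ}

theorem mem_perp {G : Submodule (ZMod 2) (Fin n → ZMod 2)} {v : Fin n → ZMod 2} :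
    v ∈ perp G ↔ ∀ g ∈ G, g ⬝ᵥ v = 0 := Iff.rfl

/-- A vector outside `G` is separated from `G` by a functional, and every functional is a dot
product. -/
theorem perp_perp (G : Submodule (ZMod 2) (Fin n → ZMod 2)) : perp (perp G) = G := by
  apply le_antisymm
  · intro v hv
    by_contra hvG
    obtain ⟨f, hf, hle⟩ := Submodule.exists_le_ker_of_notMem hvG
    have hfe : ∀ w, f w = (fun i => f (Pi.single i 1)) ⬝ᵥ w := by
      intro w
      conv_lhs => rw [pi_eq_sum_univ' w]
      simp [dotProduct, mul_comm]
    apply hf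
    rw [hfe]
    refine hv _ fun g hg => ?_
    rw [dotProduct_comm, ← hfe]
    exact hle hg
  · intro v hv w hw
    rw [dotProduct_comm]
    exact hw v hv

theorem perp_anti {G G' : Submodule (ZMod 2) (Fin n → ZMod 2)} (h : G ≤ G') :
    perp G' ≤ perp G := fun _ hv g hg => hv g (h hg)

theorem perp_top : perp (⊤ : Submodule (ZMod 2) (Fin n → ZMod 2)) = ⊥ := by
  rw [eq_bot_iff]
  intro v hv
  rw [Submodule.mem_bot]
  funext i
  simpa using hv (Pi.single i 1) trivial

theorem perp_sup (G G' : Submodule (ZMod 2) (Fin n → ZMod 2)) :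
    perp (G ⊔ G') = perp G ⊓ perp G' := by
  apply le_antisymm
  · exact le_inf (perp_anti le_sup_left) (perp_anti le_sup_right)
  · rintro v ⟨h1, h2⟩ g hg
    obtain ⟨a, ha, b, hb, rfl⟩ := Submodule.mem_sup.1 hg
    rw [add_dotProduct, h1 a ha, h2 b hb, add_zero]

theorem finrank_add_finrank_perp (G : Submodule (ZMod 2) (Fin n → ZMod 2)) :
    Module.finrank (ZMod 2) G + Module.finrank (ZMod 2) (perp G) = n := by
  have h := Subspace.finrank_add_finrank_dualAnnihilator_eq G
  rw [Module.finrank_fin_fun] at h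
  have hp : perp G = G.dualAnnihilator.comap
      (dotProductEquiv (ZMod 2) (Fin n)).toLinearMap := by
    ext v
    simp only [mem_perp, Submodule.mem_comap, Submodule.mem_dualAnnihilator]
    exact forall₂_congr fun g _ => by rw [dotProduct_comm]; rfl
  rw [hp]
  refine Eq.trans ?_ h
  congr 1
  exact LinearEquiv.finrank_eq
    ((dotProductEquiv (ZMod 2) (Fin n)).ofSubmodule' G.dualAnnihilator)

/-- The rank of the dot product pairing between `V` and `W`, computed from either side. -/
theorem finrank_inf_perp_add (V W : Submodule (ZMod 2) (Fin n → ZMod 2)) :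
    Module.finrank (ZMod 2) (W ⊓ perp V : Submodule (ZMod 2) (Fin n → ZMod 2)) +
      Module.finrank (ZMod 2) V =
    Module.finrank (ZMod 2) W +
      Module.finrank (ZMod 2) (V ⊓ perp W : Submodule (ZMod 2) (Fin n → ZMod 2)) := by
  have h1 : perp (perp W ⊔ V) = W ⊓ perp V := by rw [perp_sup, perp_perp]
  have h2 := finrank_add_finrank_perp (perp W ⊔ V)
  rw [h1] at h2
  have h3 := Submodule.finrank_sup_add_finrank_inf_eq (perp W) V
  rw [inf_comm] at h3
  have h4 := finrank_add_finrank_perp W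
  omega

end perp

/-! ### Coset entropies -/

section entropy
variable {n : ℕ} {p : (Fin n → ZMod 2) → ℝ}

open Classical in
/-- The probability of the coset of `perp G` that contains `b`. -/
def cosetMass (p : (Fin n → ZMod 2) → ℝ) (G : Submodule (ZMod 2) (Fin n → ZMod 2))
    (b : Fin n → ZMod 2) : ℝ := ∑ b' with b' - b ∈ perp G, p b'

/-- Written as an expectation over `b` itself, the coset entropy for every `G` is accessible to the
law of large numbers on one sample space. -/
theorem cosetEntropy_eq (p : (Fin n → ZMod 2) → ℝ) (G : Submodule (ZMod 2) (Fin n → ZMod 2)) :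
    cosetEntropy p G = -∑ b, p b * Real.logb 2 (cosetMass p G b) := by
  classical
  have h : ∀ b, cosetMass p G b =
      ∑ b' with (Submodule.Quotient.mk b' : (Fin n → ZMod 2) ⧸ perp G) = Submodule.Quotient.mk b,
        p b' := by
    intro b
    simp only [cosetMass, Submodule.Quotient.eq]
  rw [cosetEntropy, entropy]
  congr 1
  simp only [Finset.sum_mul]
  rw [← Finset.sum_fiberwise Finset.univ
    (fun b => (Submodule.Quotient.mk b : (Fin n → ZMod 2) ⧸ perp G))]
  refine Finset.sum_congr (by congr!) fun Ω _ => Finset.sum_congr (by congr!) fun b hb => ?_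
  rw [h, (Finset.mem_filter.1 hb).2]

theorem cosetMass_top (b : Fin n → ZMod 2) : cosetMass p ⊤ b = p b := by
  classical
  rw [cosetMass, perp_top]
  simp only [Submodule.mem_bot, sub_eq_zero, Finset.sum_filter, Finset.sum_ite_eq',
    Finset.mem_univ, if_true]

theorem cosetEntropy_top (p : (Fin n → ZMod 2) → ℝ) : cosetEntropy p ⊤ = entropy p := by
  simp only [cosetEntropy_eq, cosetMass_top, entropy]

theorem cosetMass_anti (hp : ∀ b, 0 ≤ p b) {G G' : Submodule (ZMod 2) (Fin n → ZMod 2)}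
    (h : G ≤ G') (b : Fin n → ZMod 2) : cosetMass p G' b ≤ cosetMass p G b := by
  classical
  exact Finset.sum_le_sum_of_subset_of_nonneg
    (Finset.monotone_filter_right _ fun _ _ hb => perp_anti h hb) fun _ _ _ => hp _

theorem le_cosetMass (hp : ∀ b, 0 ≤ p b) (G : Submodule (ZMod 2) (Fin n → ZMod 2))
    (b : Fin n → ZMod 2) : p b ≤ cosetMass p G b := by
  rw [← cosetMass_top (p := p)]
  exact cosetMass_anti hp le_top b

theorem cosetMass_le_one (hp : ∀ b, 0 ≤ p b) (hp1 : ∑ b, p b = 1)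
    (G : Submodule (ZMod 2) (Fin n → ZMod 2)) (b : Fin n → ZMod 2) : cosetMass p G b ≤ 1 := by
  classical
  rw [← hp1]
  exact Finset.sum_le_sum_of_subset_of_nonneg (Finset.filter_subset _ _) fun _ _ _ => hp _

theorem cosetEntropy_mono (hp : ∀ b, 0 ≤ p b) {G G' : Submodule (ZMod 2) (Fin n → ZMod 2)}
    (h : G ≤ G') : cosetEntropy p G ≤ cosetEntropy p G' := by
  rw [cosetEntropy_eq, cosetEntropy_eq, neg_le_neg_iff]
  refine Finset.sum_le_sum fun b _ => ?_
  rcases (hp b).eq_or_lt with h0 | h0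
  · simp [← h0]
  · have h1 := h0.trans_le (le_cosetMass hp G' b)
    exact mul_le_mul_of_nonneg_left
      (Real.logb_le_logb_of_le one_lt_two h1 (cosetMass_anti hp h b)) (hp b)

theorem cosetEntropy_nonneg (hp : ∀ b, 0 ≤ p b) (hp1 : ∑ b, p b = 1)
    (G : Submodule (ZMod 2) (Fin n → ZMod 2)) : 0 ≤ cosetEntropy p G := by
  rw [cosetEntropy_eq, neg_nonneg]
  refine Finset.sum_nonpos fun b _ => mul_nonpos_of_nonneg_of_nonpos (hp b) ?_
  exact Real.logb_nonpos one_lt_two ((hp b).trans (le_cosetMass hp G b))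
    (cosetMass_le_one hp hp1 G b)

end entropy

/-! ### Independent copies -/

section iid
variable {X : Type} [Fintype X] {p : X → ℝ}

/-- The probability of a list of independent samples. -/
def listMass {k : ℕ} (p : X → ℝ) (b : Fin k → X) : ℝ := ∏ j, p (b j)

theorem listMass_nonneg {k : ℕ} (hp : ∀ b, 0 ≤ p b) (b : Fin k → X) : 0 ≤ listMass p b :=
  Finset.prod_nonneg fun _ _ => hp _

theorem sum_fin_succ_arrow {k : ℕ} (F : (Fin (k + 1) → X) → ℝ) :
    ∑ b, F b = ∑ x, ∑ b : Fin k → X, F (Fin.cons x b) := by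
  rw [← (Fin.consEquiv fun _ => X).sum_comp F, Fintype.sum_prod_type]
  rfl

theorem sum_listMass (hp1 : ∑ b, p b = 1) (k : ℕ) : ∑ b : Fin k → X, listMass p b = 1 := by
  induction k with
  | zero => simp [listMass]
  | succ k ih =>
    rw [sum_fin_succ_arrow]
    simp only [listMass, Fin.prod_univ_succ, Fin.cons_zero, Fin.cons_succ, ← Finset.mul_sum]
    change ∑ x, p x * ∑ b : Fin k → X, listMass p b = 1
    simp [ih, hp1]

theorem sum_listMass_mul_sum (hp1 : ∑ b, p b = 1) {Y : X → ℝ} (hY : ∑ x, p x * Y x = 0) (k : ℕ) :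
    ∑ b : Fin k → X, listMass p b * ∑ j, Y (b j) = 0 := by
  induction k with
  | zero => simp [listMass]
  | succ k ih =>
    rw [sum_fin_succ_arrow]
    have h : ∀ x (b : Fin k → X), listMass p (Fin.cons x b : Fin (k + 1) → X) *
        ∑ j, Y ((Fin.cons x b : Fin (k + 1) → X) j) =
        (p x * Y x) * listMass p b + p x * (listMass p b * ∑ j, Y (b j)) := by
      intro x b
      simp only [listMass, Fin.prod_univ_succ, Fin.sum_univ_succ, Fin.cons_zero, Fin.cons_succ]
      ring
    simp only [h, Finset.sum_add_distrib, ← Finset.mul_sum, ih, sum_listMass hp1, mul_one, hY,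
      mul_zero, add_zero]

/-- Additivity of the variance; the cross terms vanish because `Y` is centred. -/
theorem sum_listMass_mul_sum_sq (hp1 : ∑ b, p b = 1) {Y : X → ℝ} (hY : ∑ x, p x * Y x = 0)
    (k : ℕ) :
    ∑ b : Fin k → X, listMass p b * (∑ j, Y (b j)) ^ 2 = k * ∑ x, p x * Y x ^ 2 := by
  induction k with
  | zero => simp [listMass]
  | succ k ih =>
    rw [sum_fin_succ_arrow]
    have h : ∀ x (b : Fin k → X), listMass p (Fin.cons x b : Fin (k + 1) → X) *
        (∑ j, Y ((Fin.cons x b : Fin (k + 1) → X) j)) ^ 2 =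
        (p x * Y x ^ 2) * listMass p b + (2 * (p x * Y x)) * (listMass p b * ∑ j, Y (b j)) +
          p x * (listMass p b * (∑ j, Y (b j)) ^ 2) := by
      intro x b
      simp only [listMass, Fin.prod_univ_succ, Fin.sum_univ_succ, Fin.cons_zero, Fin.cons_succ]
      ring
    simp only [h, Finset.sum_add_distrib, ← Finset.mul_sum, ih, sum_listMass hp1, mul_one,
      sum_listMass_mul_sum hp1 hY, mul_zero, add_zero, ← Finset.sum_mul, hp1]
    push_cast
    ring

open Classical in
-- Chebyshev's inequality for a sum over independent samples.
theorem sum_listMass_deviation_le (hp : ∀ b, 0 ≤ p b) (hp1 : ∑ b, p b = 1) (Y : X → ℝ) {ε : ℝ}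
    (hε : 0 < ε) {k : ℕ} (hk : 0 < k) :
    ∑ b : Fin k → X with ¬ |∑ j, Y (b j) - k * ∑ x, p x * Y x| ≤ k * ε, listMass p b ≤
      (∑ x, p x * (Y x - ∑ x, p x * Y x) ^ 2) / ε ^ 2 / k := by
  set μ := ∑ x, p x * Y x with hμ
  have h0 : ∑ x, p x * (Y x - μ) = 0 := by
    simp only [mul_sub, Finset.sum_sub_distrib, ← Finset.sum_mul, hp1, one_mul, ← hμ, sub_self]
  have h2 := sum_listMass_mul_sum_sq hp1 h0 k
  have hk' : (0 : ℝ) < k := by exact_mod_cast hk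
  have hke : 0 < (k * ε) ^ 2 := by positivity
  rw [div_div, le_div_iff₀ (by positivity)]
  have h3 : (∑ b : Fin k → X with ¬ |∑ j, Y (b j) - k * μ| ≤ k * ε, listMass p b) * (k * ε) ^ 2 ≤
      ∑ b : Fin k → X, listMass p b * (∑ j, (Y (b j) - μ)) ^ 2 := by
    rw [Finset.sum_mul]
    refine (Finset.sum_le_sum fun b hb => ?_).trans (Finset.sum_le_sum_of_subset_of_nonneg
      (Finset.filter_subset _ _) fun b _ _ => mul_nonneg (listMass_nonneg hp b) (sq_nonneg _))
    refine mul_le_mul_of_nonneg_left ?_ (listMass_nonneg hp b)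
    have hb' := not_le.1 (Finset.mem_filter.1 hb).2
    have h4 : ∑ j, (Y (b j) - μ) = ∑ j, Y (b j) - k * μ := by
      simp [Finset.sum_sub_distrib]
    rw [h4, ← sq_abs (∑ j, Y (b j) - k * μ)]
    exact pow_le_pow_left₀ (by positivity) hb'.le 2
  rw [h2] at h3
  refine le_of_mul_le_mul_left ?_ hk'
  linarith [h3]

end iid

/-! ### Typical lists of phase vectors -/

section typical
variable {n : ℕ} {p : (Fin n → ZMod 2) → ℝ}

open Classical in
/-- The lists of phase vectors for which all empirical coset entropies are close to their
expectations. -/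
def typical (p : (Fin n → ZMod 2) → ℝ) (k : ℕ) (ε : ℝ) : Finset (Fin k → Fin n → ZMod 2) :=
  {b | (∀ j, 0 < p (b j)) ∧ ∀ G : Submodule (ZMod 2) (Fin n → ZMod 2),
    |∑ j, Real.logb 2 (cosetMass p G (b j)) + k * cosetEntropy p G| ≤ k * ε}

/-- A union of finitely many Chebyshev bounds, one for each subspace. The positivity clause of
`typical` excludes only lists of mass zero; it guards against the value `Real.logb 2 0 = 0`. -/
theorem tendsto_sum_not_typical (hp : ∀ b, 0 ≤ p b) (hp1 : ∑ b, p b = 1) {ε : ℝ} (hε : 0 < ε) :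
    Tendsto (fun k => ∑ b ∈ (typical p k ε)ᶜ, listMass p b) atTop (𝓝 0) := by
  classical
  let V : Submodule (ZMod 2) (Fin n → ZMod 2) → ℝ := fun G =>
    (∑ x, p x * (Real.logb 2 (cosetMass p G x) -
      ∑ x, p x * Real.logb 2 (cosetMass p G x)) ^ 2) / ε ^ 2
  have hlim : Tendsto (fun k : ℕ => ∑ G, V G / (k : ℝ)) atTop (𝓝 0) := by
    rw [← Finset.sum_const_zero (s := (Finset.univ : Finset (Submodule (ZMod 2) (Fin n → ZMod 2))))]
    exact tendsto_finsetSum _ fun G _ => tendsto_const_div_atTop_nhds_zero_nat _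
  refine tendsto_of_tendsto_of_tendsto_of_le_of_le' tendsto_const_nhds hlim
    (Eventually.of_forall fun k => Finset.sum_nonneg fun b _ => listMass_nonneg hp b) ?_
  filter_upwards [eventually_gt_atTop 0] with k hk
  refine le_trans ?_ (Finset.sum_le_sum fun G _ =>
    sum_listMass_deviation_le hp hp1 (fun x => Real.logb 2 (cosetMass p G x)) hε hk)
  simp only [Finset.sum_filter]
  rw [Finset.sum_comm, ← Finset.sum_subset (Finset.subset_univ (typical p k ε)ᶜ)]
  · refine Finset.sum_le_sum fun b hb => ?_
    by_cases hpos : ∀ j, 0 < p (b j)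
    · have hb' : ¬ ∀ G : Submodule (ZMod 2) (Fin n → ZMod 2),
          |∑ j, Real.logb 2 (cosetMass p G (b j)) + k * cosetEntropy p G| ≤ k * ε := by
        intro h
        exact Finset.mem_compl.1 hb (Finset.mem_filter.2 ⟨Finset.mem_univ _, hpos, h⟩)
      obtain ⟨G, hG⟩ := not_forall.1 hb'
      rw [cosetEntropy_eq, mul_neg, ← sub_eq_add_neg] at hG
      refine le_trans ?_ (Finset.single_le_sum (fun G _ => ?_) (Finset.mem_univ G))
      · rw [if_pos hG]
      · split_ifs
        · exact le_rfl
        · exact listMass_nonneg hp b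
    · obtain ⟨j, hj⟩ := not_forall.1 hpos
      have h0 : listMass p b = 0 :=
        Finset.prod_eq_zero (Finset.mem_univ j) (le_antisymm (not_lt.1 hj) (hp _))
      simp [h0]
  · intro b _ hb
    have hb' := (Finset.mem_filter.1 (not_not.1 fun h => hb (Finset.mem_compl.2 h))).2.2
    refine Finset.sum_eq_zero fun G _ => if_neg (not_not.2 ?_)
    have := hb' G
    rwa [cosetEntropy_eq, mul_neg, ← sub_eq_add_neg] at this

variable {k : ℕ} {ε : ℝ}

theorem prod_cosetMass_eq (hp : ∀ b, 0 ≤ p b) {b : Fin k → Fin n → ZMod 2}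
    (hb : b ∈ typical p k ε) (G : Submodule (ZMod 2) (Fin n → ZMod 2)) :
    ∏ j, cosetMass p G (b j) = (2 : ℝ) ^ ∑ j, Real.logb 2 (cosetMass p G (b j)) := by
  have hpos := (Finset.mem_filter.1 hb).2.1
  rw [Real.rpow_sum_of_pos two_pos]
  exact Finset.prod_congr rfl fun j _ =>
    (Real.rpow_logb two_pos (by norm_num) ((hpos j).trans_le (le_cosetMass hp G _))).symm

theorem prod_cosetMass_le (hp : ∀ b, 0 ≤ p b) {b : Fin k → Fin n → ZMod 2}
    (hb : b ∈ typical p k ε) (G : Submodule (ZMod 2) (Fin n → ZMod 2)) :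
    ∏ j, cosetMass p G (b j) ≤ (2 : ℝ) ^ (-(k * (cosetEntropy p G - ε))) := by
  rw [prod_cosetMass_eq hp hb]
  refine Real.rpow_le_rpow_of_exponent_le one_le_two ?_
  linarith [(abs_le.1 ((Finset.mem_filter.1 hb).2.2 G)).2]

theorem le_prod_cosetMass (hp : ∀ b, 0 ≤ p b) {b : Fin k → Fin n → ZMod 2}
    (hb : b ∈ typical p k ε) (G : Submodule (ZMod 2) (Fin n → ZMod 2)) :
    (2 : ℝ) ^ (-(k * (cosetEntropy p G + ε))) ≤ ∏ j, cosetMass p G (b j) := by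
  rw [prod_cosetMass_eq hp hb]
  refine Real.rpow_le_rpow_of_exponent_le one_le_two ?_
  linarith [(abs_le.1 ((Finset.mem_filter.1 hb).2.2 G)).1]

theorem listMass_le (hp : ∀ b, 0 ≤ p b) {b : Fin k → Fin n → ZMod 2}
    (hb : b ∈ typical p k ε) : listMass p b ≤ (2 : ℝ) ^ (-(k * (entropy p - ε))) := by
  have := prod_cosetMass_le hp hb ⊤
  simp only [cosetMass_top, cosetEntropy_top] at this
  exact this

theorem le_listMass (hp : ∀ b, 0 ≤ p b) {b : Fin k → Fin n → ZMod 2}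
    (hb : b ∈ typical p k ε) : (2 : ℝ) ^ (-(k * (entropy p + ε))) ≤ listMass p b := by
  have := le_prod_cosetMass hp hb ⊤
  simp only [cosetMass_top, cosetEntropy_top] at this
  exact this

open Classical in
theorem sum_listMass_coset (G : Submodule (ZMod 2) (Fin n → ZMod 2)) (b : Fin k → Fin n → ZMod 2) :
    ∑ b' : Fin k → Fin n → ZMod 2 with ∀ j, b' j - b j ∈ perp G, listMass p b' =
      ∏ j, cosetMass p G (b j) := by
  simp only [cosetMass]
  rw [Finset.prod_univ_sum]
  refine Finset.sum_congr ?_ fun _ _ => rfl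
  ext b'
  simp [Fintype.mem_piFinset]

open Classical in
/-- The number of typical lists in the same cosets as a given one. -/
theorem card_typical_coset_le (hp : ∀ b, 0 ≤ p b) {b : Fin k → Fin n → ZMod 2}
    (hb : b ∈ typical p k ε) (G : Submodule (ZMod 2) (Fin n → ZMod 2)) :
    (((typical p k ε).filter fun b' => ∀ j, b' j - b j ∈ perp G).card : ℝ) ≤
      (2 : ℝ) ^ (k * (entropy p - cosetEntropy p G + 2 * ε)) := by
  -- Each of these lists has mass at least `2 ^ (-k(H + ε))`, while their cosets together have mass
  -- at most `2 ^ (-k(C(G) - ε))`.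
  have h1 : (((typical p k ε).filter fun b' => ∀ j, b' j - b j ∈ perp G).card : ℝ) *
      (2 : ℝ) ^ (-(k * (entropy p + ε))) ≤ (2 : ℝ) ^ (-(k * (cosetEntropy p G - ε))) := by
    refine le_trans ?_ (prod_cosetMass_le hp hb G)
    rw [← sum_listMass_coset, ← nsmul_eq_mul]
    refine (Finset.card_nsmul_le_sum _ (fun b' => listMass p b') _ fun b' hb' =>
      le_listMass hp (Finset.mem_filter.1 hb').1).trans ?_
    refine Finset.sum_le_sum_of_subset_of_nonneg (fun b' hb' => ?_)
      fun b' _ _ => listMass_nonneg hp b'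
    exact Finset.mem_filter.2 ⟨Finset.mem_univ _, (Finset.mem_filter.1 hb').2⟩
  rw [Real.rpow_neg two_pos.le, ← div_eq_mul_inv, div_le_iff₀ (Real.rpow_pos_of_pos two_pos _),
    ← Real.rpow_add two_pos] at h1
  refine h1.trans (le_of_eq ?_)
  congr 1
  ring

open Classical in
/-- The number of lists of cosets that contain typical lists. -/
theorem card_image_typical_le (hp : ∀ b, 0 ≤ p b) (hp1 : ∑ b, p b = 1)
    (G : Submodule (ZMod 2) (Fin n → ZMod 2)) :
    (((typical p k ε).image fun b j =>
      (Submodule.Quotient.mk (b j) : (Fin n → ZMod 2) ⧸ perp G)).card : ℝ) ≤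
      (2 : ℝ) ^ (k * (cosetEntropy p G + ε)) := by
  set cl : (Fin k → Fin n → ZMod 2) → Fin k → (Fin n → ZMod 2) ⧸ perp G :=
    fun b j => Submodule.Quotient.mk (b j) with hcl
  -- The classes are disjoint, and one that contains a typical list has mass at least `2 ^ (-k(C(G)
  -- + ε))`.
  have h1 : (((typical p k ε).image cl).card : ℝ) *
      (2 : ℝ) ^ (-(k * (cosetEntropy p G + ε))) ≤ 1 := by
    rw [← sum_listMass hp1 k, ← nsmul_eq_mul]
    refine (Finset.card_nsmul_le_sum _ (fun c => ∑ b' with cl b' = c, listMass p b') _ ?_).trans ?_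
    · intro c hc
      obtain ⟨b, hb, rfl⟩ := Finset.mem_image.1 hc
      refine (le_prod_cosetMass hp hb G).trans (le_of_eq ?_)
      rw [← sum_listMass_coset]
      refine Finset.sum_congr ?_ fun _ _ => rfl
      ext b'
      simp only [Finset.mem_filter, Finset.mem_univ, true_and, hcl, funext_iff,
        Submodule.Quotient.eq]
    · rw [Finset.sum_fiberwise_eq_sum_filter]
      exact Finset.sum_le_sum_of_subset_of_nonneg (Finset.filter_subset _ _)
        fun b _ _ => listMass_nonneg hp b
  rw [Real.rpow_neg two_pos.le, ← div_eq_mul_inv, div_le_iff₀ (Real.rpow_pos_of_pos two_pos _),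
    one_mul] at h1
  exact h1

end typical

/-! ### Uniformly random orthogonal matrices -/

section orthogonal
variable {κ : Type} [Fintype κ] [DecidableEq κ]

/-- Independence makes every right-hand side solvable, and all `2 ^ m` solution sets are translates
of each other. -/
theorem card_affine {m : ℕ} {w : Fin m → κ → ZMod 2} (hw : LinearIndependent (ZMod 2) w)
    (c : Fin m → ZMod 2) :
    (Finset.univ.filter fun u : κ → ZMod 2 => ∀ i, w i ⬝ᵥ u = c i).card * 2 ^ m =
      2 ^ Fintype.card κ := by
  have hsurj : ∀ c : Fin m → ZMod 2, ∃ u, ∀ i, w i ⬝ᵥ u = c i := by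
    intro c
    obtain ⟨u, hu⟩ := exists_mulVec_eq (Matrix.of w) c (by
      intro v hv
      have h0 : v = 0 := by
        funext i
        refine Fintype.linearIndependent_iff.1 hw v ?_ i
        rw [← hv]
        funext j
        simp [Matrix.vecMul, dotProduct]
      rw [h0, zero_dotProduct])
    exact ⟨u, fun i => congrFun hu i⟩
  have hcard : ∀ c' : Fin m → ZMod 2,
      (Finset.univ.filter fun u : κ → ZMod 2 => (fun i => w i ⬝ᵥ u) = c').card =
      (Finset.univ.filter fun u : κ → ZMod 2 => ∀ i, w i ⬝ᵥ u = c i).card := by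
    intro c'
    obtain ⟨u0, hu0⟩ := hsurj (c - c')
    refine Finset.card_equiv (Equiv.addRight u0) fun u => ?_
    simp only [Finset.mem_filter, Finset.mem_univ, true_and, Equiv.coe_addRight, dotProduct_add,
      hu0, funext_iff, Pi.sub_apply]
    refine forall_congr' fun i => ?_
    constructor <;> intro h
    · rw [h]; abel
    · linear_combination h
  have htot := Finset.card_eq_sum_card_fiberwise (f := fun u : κ → ZMod 2 => fun i => w i ⬝ᵥ u)
    (s := Finset.univ) (t := Finset.univ) fun _ _ => Finset.mem_coe.2 (Finset.mem_univ _)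
  simp only [hcard, Finset.sum_const, smul_eq_mul] at htot
  rw [mul_comm]
  simpa [ZMod.card] using htot.symm

/-- The orthogonal binary matrices. -/
def orthogonalMatrices (κ : Type) [Fintype κ] [DecidableEq κ] : Finset (Matrix κ κ (ZMod 2)) :=
  Finset.univ.filter fun A => A * A.transpose = 1

theorem mem_orthogonalMatrices {A : Matrix κ κ (ZMod 2)} :
    A ∈ orthogonalMatrices κ ↔ A * A.transpose = 1 := by
  simp [orthogonalMatrices]

theorem one_mem_orthogonalMatrices : (1 : Matrix κ κ (ZMod 2)) ∈ orthogonalMatrices κ := by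
  simp [mem_orthogonalMatrices]

theorem isotropic_transvection_orthogonal {u : κ → ZMod 2} (hu : u ⬝ᵥ u = 0) :
    (1 + Matrix.vecMulVec u u) * (1 + Matrix.vecMulVec u u).transpose = 1 := by
  have h2 : Matrix.vecMulVec u u + Matrix.vecMulVec u u = 0 := by
    ext i j
    exact CharTwo.add_self_eq_zero _
  rw [Matrix.transpose_add, Matrix.transpose_one, Matrix.transpose_vecMulVec, mul_add,
    mul_one, add_mul, one_mul, Matrix.vecMulVec_mul_vecMulVec, hu, zero_smul,
    Matrix.vecMulVec_zero, add_zero, add_assoc, h2, add_zero]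

/-- A uniformly random orthogonal matrix maps a list of vectors that is independent of the all-ones
vector to a list that is uniform up to a constant factor. -/
theorem card_orthogonal_map_le {d : ℕ} (e z : Fin d → κ → ZMod 2)
    (he : LinearIndependent (ZMod 2) (Fin.cons 1 e : Fin (d + 1) → κ → ZMod 2)) :
    ((orthogonalMatrices κ).filter fun A => ∀ i, A.mulVec (e i) = z i).card *
      2 ^ (Fintype.card κ * d) ≤ (orthogonalMatrices κ).card * 2 ^ (d * (d + 1)) := by
  induction d with
  | zero => simp
  | succ d ih =>
    have he' : LinearIndependent (ZMod 2)
        (Fin.cons 1 fun i : Fin d => e i.castSucc : Fin (d + 1) → κ → ZMod 2) := by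
      have h := he.comp Fin.castSucc (Fin.castSucc_injective _)
      convert h using 1
      funext i
      refine Fin.cases ?_ (fun i => ?_) i
      · rfl
      · rw [Function.comp_apply, ← Fin.succ_castSucc, Fin.cons_succ, Fin.cons_succ]
    have ih' := ih (fun i => e i.castSucc) (fun i => z i.castSucc) he'
    -- Vectors orthogonal to the all-ones vector satisfy `u ⬝ᵥ u = 0`, so `1 + u uᵀ` is orthogonal.
    -- The other conditions make it fix the first `d` vectors and move the last one by `u`. Hence
    -- `(A, u) ↦ A (1 + u uᵀ)` maps solutions for `d + 1` vectors, together with `U`, into the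
    -- solutions for `d` vectors.
    let U : Finset (κ → ZMod 2) := Finset.univ.filter fun u => ∀ i,
      (Fin.cons 1 e : Fin (d + 2) → κ → ZMod 2) i ⬝ᵥ u = if i = Fin.last (d + 1) then 1 else 0
    have hU : U.card * 2 ^ (d + 2) = 2 ^ Fintype.card κ := card_affine he _
    have hUe : ∀ u ∈ U, u ⬝ᵥ u = 0 ∧ (∀ i : Fin d, e i.castSucc ⬝ᵥ u = 0) ∧
        e (Fin.last d) ⬝ᵥ u = 1 := by
      intro u hu
      have h := (Finset.mem_filter.1 hu).2
      refine ⟨?_, fun i => ?_, ?_⟩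
      · have h0 := h 0
        rw [Fin.cons_zero, if_neg (Fin.last_pos).ne] at h0
        rw [← h0]
        refine Finset.sum_congr rfl fun q _ => ?_
        rcases zmod_two_cases (u q) with hq | hq <;> simp [hq]
      · have h1 := h i.castSucc.succ
        rwa [Fin.cons_succ, if_neg] at h1
        rw [← Fin.succ_last]
        exact fun h => (Fin.castSucc_lt_last i).ne (Fin.succ_injective _ h)
      · have h1 := h (Fin.last d).succ
        rwa [Fin.cons_succ, if_pos (Fin.succ_last d)] at h1
    have hmul : ∀ (A : Matrix κ κ (ZMod 2)) (u v : κ → ZMod 2),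
        (A * (1 + Matrix.vecMulVec u u)).mulVec v = A.mulVec v + (v ⬝ᵥ u) • A.mulVec u := by
      intro A u v
      rw [← Matrix.mulVec_mulVec, Matrix.add_mulVec, Matrix.one_mulVec, Matrix.vecMulVec_mulVec,
        Matrix.mulVec_add, dotProduct_comm u v]
      congr 1
      rw [op_smul_eq_smul, Matrix.mulVec_smul]
    have hle : ((orthogonalMatrices κ).filter fun A => ∀ i, A.mulVec (e i) = z i).card * U.card ≤
        ((orthogonalMatrices κ).filter fun A => ∀ i : Fin d,
          A.mulVec (e i.castSucc) = z i.castSucc).card := by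
      rw [← Finset.card_product]
      refine Finset.card_le_card_of_injOn
        (fun Au => Au.1 * (1 + Matrix.vecMulVec Au.2 Au.2)) ?_ ?_
      · rintro ⟨A, u⟩ hAu
        obtain ⟨hA, hu⟩ := Finset.mem_product.1 hAu
        obtain ⟨hA1, hA2⟩ := Finset.mem_filter.1 hA
        obtain ⟨hu1, hu2, -⟩ := hUe u hu
        refine Finset.mem_filter.2 ⟨?_, fun i => ?_⟩
        · rw [mem_orthogonalMatrices] at hA1 ⊢
          rw [Matrix.transpose_mul, mul_assoc, ← mul_assoc (1 + _),
            isotropic_transvection_orthogonal hu1, one_mul, hA1]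
        · rw [hmul, hu2, zero_smul, add_zero]
          exact hA2 _
      · rintro ⟨A, u⟩ hAu ⟨B, v⟩ hBv h
        simp only at h
        obtain ⟨hA, hu⟩ := Finset.mem_product.1 hAu
        obtain ⟨hB, hv⟩ := Finset.mem_product.1 hBv
        obtain ⟨hA1, hA2⟩ := Finset.mem_filter.1 hA
        obtain ⟨hB1, hB2⟩ := Finset.mem_filter.1 hB
        simp only at hA2 hB2
        obtain ⟨hu1, -, hu3⟩ := hUe u hu
        obtain ⟨hv1, -, hv3⟩ := hUe v hv
        have h1 : A.mulVec u = B.mulVec v := by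
          have h2 := congrArg (fun Q => Matrix.mulVec Q (e (Fin.last d))) h
          simp only [hmul, hu3, hv3, one_smul, hA2, hB2] at h2
          exact add_left_cancel h2
        -- Injectivity: isotropy shows that the common product sends `u` to `A u` and `v` to `B v`.
        -- These are equal and the product is invertible, so `u = v`.
        have h3 : (A * (1 + Matrix.vecMulVec u u)).mulVec u =
            (A * (1 + Matrix.vecMulVec u u)).mulVec v := by
          conv_rhs => rw [h]
          rw [hmul, hmul, hu1, hv1, zero_smul, zero_smul, add_zero, add_zero, h1]
        have hQ : (A * (1 + Matrix.vecMulVec u u)).transpose * (A * (1 + Matrix.vecMulVec u u)) =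
            1 := by
          rw [mul_eq_one_comm, Matrix.transpose_mul, mul_assoc, ← mul_assoc (1 + _),
            isotropic_transvection_orthogonal hu1, one_mul]
          exact mem_orthogonalMatrices.1 hA1
        have huv : u = v := by
          have := congrArg (Matrix.mulVec (A * (1 + Matrix.vecMulVec u u)).transpose) h3
          rwa [Matrix.mulVec_mulVec, Matrix.mulVec_mulVec, hQ, Matrix.one_mulVec,
            Matrix.one_mulVec] at this
        subst huv
        have hAB : A = B := by
          have := congrArg (· * (1 + Matrix.vecMulVec u u).transpose) h
          simp only [mul_assoc, isotropic_transvection_orthogonal hu1, mul_one] at this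
          exact this
        rw [hAB]
    have hpos : 0 < 2 ^ (d + 2) := by positivity
    calc ((orthogonalMatrices κ).filter fun A => ∀ i, A.mulVec (e i) = z i).card *
          2 ^ (Fintype.card κ * (d + 1))
        = ((orthogonalMatrices κ).filter fun A => ∀ i, A.mulVec (e i) = z i).card * U.card *
          2 ^ (d + 2) * 2 ^ (Fintype.card κ * d) := by
          rw [mul_assoc _ U.card, hU, mul_add, mul_one, pow_add]; ring
      _ ≤ ((orthogonalMatrices κ).filter fun A => ∀ i : Fin d,
          A.mulVec (e i.castSucc) = z i.castSucc).card * 2 ^ (d + 2) *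
          2 ^ (Fintype.card κ * d) := by gcongr
      _ ≤ (orthogonalMatrices κ).card * 2 ^ (d * (d + 1)) * 2 ^ (d + 2) := by
          rw [mul_right_comm]; gcongr
      -- Each induction step loses a factor `2 ^ (d + 2)`; the quadratic exponent is a convenient
      -- bound for the accumulated loss and is independent of the size of `κ`.
      _ ≤ (orthogonalMatrices κ).card * 2 ^ ((d + 1) * (d + 1 + 1)) := by
          rw [mul_assoc, ← pow_add]
          gcongr
          · norm_num
          · nlinarith

end orthogonal

/-! ### The probability that a difference is not seen -/

section unseen
variable {n : ℕ}

/-- The number of bits that a measurement `M` reveals about the vectors of `W`. -/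
def seenDim (S : Matrix (Fin n ⊕ Fin n) (Fin n) (ZMod 2))
    (W : Submodule (ZMod 2) (Fin n → ZMod 2)) (M : Partition n) : ℕ :=
  measDim S M - Module.finrank (ZMod 2)
    (measSpace S M ⊓ perp W : Submodule (ZMod 2) (Fin n → ZMod 2))

variable {S : Matrix (Fin n ⊕ Fin n) (Fin n) (ZMod 2)}

theorem finrank_add_seenDim (W : Submodule (ZMod 2) (Fin n → ZMod 2)) (M : Partition n) :
    Module.finrank (ZMod 2)
      (measSpace S M ⊓ perp W : Submodule (ZMod 2) (Fin n → ZMod 2)) + seenDim S W M =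
      measDim S M :=
  Nat.add_sub_cancel' (Submodule.finrank_mono inf_le_left)

/-- By symmetry of the pairing rank, `seenDim` is also a codimension inside `W`: a uniform vector of
`W` is invisible to `M` with probability `2 ^ (-seenDim S W M)`. -/
theorem finrank_inf_perp_add_seenDim (W : Submodule (ZMod 2) (Fin n → ZMod 2)) (M : Partition n) :
    Module.finrank (ZMod 2)
      (W ⊓ perp (measSpace S M) : Submodule (ZMod 2) (Fin n → ZMod 2)) + seenDim S W M =
      Module.finrank (ZMod 2) W := by
  have h1 := finrank_add_seenDim (S := S) W M
  have h2 := finrank_inf_perp_add (measSpace S M) W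
  rw [measDim] at h1
  omega

theorem exists_mem_measSpace (v : Fin n → ZMod 2) : ∃ M : Partition n, v ∈ measSpace S M := by
  refine ⟨fun q => if S.mulVec v (Sum.inl q) = 1 then
    (if S.mulVec v (Sum.inr q) = 1 then Axis.y else Axis.z) else Axis.x, fun q => ?_⟩
  by_cases h1 : S.mulVec v (Sum.inl q) = 1 <;> by_cases h2 : S.mulVec v (Sum.inr q) = 1 <;>
    simp [h1, h2]

/-- The spaces `measSpace S M` cover everything, so if none of them saw `W`, then `perp W` would be
the whole space. This makes `seenDim S W` an admissible `f` in the linear program. -/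
theorem seenDim_ne_zero {W : Submodule (ZMod 2) (Fin n → ZMod 2)} (hW : W ≠ ⊥) :
    seenDim S W ≠ 0 := by
  intro h0
  apply hW
  have htop : perp W = ⊤ := by
    rw [eq_top_iff]
    intro v _
    obtain ⟨M, hM⟩ := exists_mem_measSpace (S := S) v
    have h := finrank_add_seenDim (S := S) W M
    rw [h0, Pi.zero_apply, add_zero] at h
    have h2 := Submodule.eq_of_le_of_finrank_eq
      (inf_le_left : measSpace S M ⊓ perp W ≤ measSpace S M) h
    exact (inf_eq_left.1 h2) hM
  rw [← perp_perp W, htop, perp_top]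

theorem card_combination_mem_le {d : ℕ} {w : Fin d → Fin n → ZMod 2}
    (hw : LinearIndependent (ZMod 2) w) {W : Submodule (ZMod 2) (Fin n → ZMod 2)}
    (hwW : ∀ l, w l ∈ W) (V : Submodule (ZMod 2) (Fin n → ZMod 2))
    [DecidablePred fun y : Fin d → ZMod 2 => ∑ l, y l • w l ∈ V] :
    (Finset.univ.filter fun y : Fin d → ZMod 2 => ∑ l, y l • w l ∈ V).card ≤
      2 ^ Module.finrank (ZMod 2) (W ⊓ V : Submodule (ZMod 2) (Fin n → ZMod 2)) := by
  classical
  have hc : Fintype.card (W ⊓ V : Submodule (ZMod 2) (Fin n → ZMod 2)) =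
      2 ^ Module.finrank (ZMod 2) (W ⊓ V : Submodule (ZMod 2) (Fin n → ZMod 2)) := by
    rw [Module.card_eq_pow_finrank (K := ZMod 2), ZMod.card]
  rw [← hc, ← Fintype.card_subtype]
  refine Fintype.card_le_of_injective (fun y => ⟨∑ l, y.1 l • w l,
    W.sum_mem fun l _ => W.smul_mem _ (hwW l), y.2⟩) ?_
  intro y y' h
  have h1 : ∑ l, y.1 l • w l = ∑ l, y'.1 l • w l := congrArg Subtype.val h
  apply Subtype.ext
  funext l
  have h2 : ∑ l, (y.1 l - y'.1 l) • w l = 0 := by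
    simp only [sub_smul, Finset.sum_sub_distrib, h1, sub_self]
  exact sub_eq_zero.1 (Fintype.linearIndependent_iff.1 hw _ h2 l)

open Classical in
/-- A nonzero difference is overlooked by few orthogonal matrices. -/
theorem card_unseen_le {k r : ℕ} (hr : 0 < r) (axes : Fin r → Partition n)
    (Δ : Fin k → Fin n → ZMod 2) :
    ((orthogonalMatrices (Fin k ⊕ Fin r)).filter fun A => Unseen S A axes Δ).card *
      2 ^ (∑ j, seenDim S (Submodule.span (ZMod 2) (Set.range Δ)) (axes j)) ≤
      (orthogonalMatrices (Fin k ⊕ Fin r)).card * 2 ^ (n * (n + 1)) := by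
  set W := Submodule.span (ZMod 2) (Set.range Δ) with hW
  set d := Module.finrank (ZMod 2) W with hd
  have hdn : d ≤ n := by
    have := Submodule.finrank_le W
    rwa [Module.finrank_fin_fun] at this
  let B := Module.finBasis (ZMod 2) W
  let w : Fin d → Fin n → ZMod 2 := fun l => (B l : Fin n → ZMod 2)
  have hw : LinearIndependent (ZMod 2) w :=
    B.linearIndependent.map' W.subtype (Submodule.ker_subtype W)
  have hΔW : ∀ i, Δ i ∈ W := fun i => Submodule.subset_span ⟨i, rfl⟩
  -- The coordinates of the differences in a basis of `W`, with zeros on the pure copies. The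
  -- syndromes depend on `A` only through the `d` images `A (E l)`, and `d ≤ n` is bounded
  -- independently of `k`.
  let E : Fin d → Fin k ⊕ Fin r → ZMod 2 := fun l =>
    Sum.elim (fun i => B.repr ⟨Δ i, hΔW i⟩ l) 0
  have hΔ : ∀ i, Δ i = ∑ l, E l (Sum.inl i) • w l := by
    intro i
    have h := congrArg Subtype.val (B.sum_repr ⟨Δ i, hΔW i⟩)
    simp only [AddSubmonoidClass.coe_finsetSum, Submodule.coe_smul] at h
    exact h.symm
  have hE : LinearIndependent (ZMod 2) E := by
    rw [Fintype.linearIndependent_iff]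
    intro g hg l
    let f : W →ₗ[ZMod 2] ZMod 2 := ∑ l, g l • B.coord l
    have hf : ∀ x (hx : x ∈ W), f ⟨x, hx⟩ = 0 := by
      intro x hx
      refine Submodule.span_induction (p := fun x hx => f ⟨x, hx⟩ = 0) ?_ ?_ ?_ ?_ hx
      · rintro _ ⟨i, rfl⟩
        have := congrFun hg (Sum.inl i)
        simpa [E, f] using this
      · exact f.map_zero
      · intro x y hx hy h1 h2
        have := f.map_add ⟨x, hx⟩ ⟨y, hy⟩
        rw [h1, h2, add_zero] at this
        exact this
      · intro a x hx h1
        have := f.map_smul a ⟨x, hx⟩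
        rw [h1, smul_zero] at this
        exact this
    have h1 := hf (B l) (B l).2
    simpa [f, Finsupp.single_apply] using h1
  -- All `E l` vanish on the pure copies, of which there is at least one; hence the all-ones vector
  -- is not in their span.
  have hE1 : LinearIndependent (ZMod 2) (Fin.cons 1 E : Fin (d + 1) → Fin k ⊕ Fin r → ZMod 2) := by
    rw [linearIndependent_finCons]
    refine ⟨hE, fun h => ?_⟩
    have h0 : ∀ x ∈ Submodule.span (ZMod 2) (Set.range E), x (Sum.inr ⟨0, hr⟩) = 0 := by
      intro x hx
      refine Submodule.span_induction (p := fun x _ => x (Sum.inr ⟨0, hr⟩) = 0) ?_ ?_ ?_ ?_ hx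
      · rintro _ ⟨l, rfl⟩
        simp [E]
      · rfl
      · intro x y _ _ h1 h2
        rw [Pi.add_apply, h1, h2, add_zero]
      · intro a x _ h1
        rw [Pi.smul_apply, h1, smul_zero]
    exact one_ne_zero (h0 1 h)
  have hsyn : ∀ (A : Matrix (Fin k ⊕ Fin r) (Fin k ⊕ Fin r) (ZMod 2)) j,
      syndrome A Δ j = ∑ l, A.mulVec (E l) (Sum.inr j) • w l := by
    intro A j
    have h1 : ∀ l, A.mulVec (E l) (Sum.inr j) =
        ∑ i, A (Sum.inr j) (Sum.inl i) * E l (Sum.inl i) := by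
      intro l
      simp [Matrix.mulVec, dotProduct, Fintype.sum_sum_type, E]
    simp only [h1, Finset.sum_smul, syndrome]
    rw [Finset.sum_comm]
    refine Finset.sum_congr rfl fun i _ => ?_
    conv_lhs => rw [hΔ i]
    rw [Finset.smul_sum]
    simp only [mul_smul]
  -- The coordinate images that keep the difference invisible: no condition on the noisy copies, and
  -- on measured copy `j` the combination must lie in `W ⊓ perp (measSpace S (axes j))`.
  let t : Fin k ⊕ Fin r → Finset (Fin d → ZMod 2) := Sum.elim (fun _ => Finset.univ)
    fun j => Finset.univ.filter fun y => ∑ l, y l • w l ∈ perp (measSpace S (axes j))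
  let good : Finset (Fin k ⊕ Fin r → Fin d → ZMod 2) := Fintype.piFinset t
  have hgood : good.card ≤ 2 ^ (k * d) *
      ∏ j, 2 ^ Module.finrank (ZMod 2)
        (W ⊓ perp (measSpace S (axes j)) : Submodule (ZMod 2) (Fin n → ZMod 2)) := by
    rw [Fintype.card_piFinset, Fintype.prod_sum_type]
    refine Nat.mul_le_mul ?_ (Finset.prod_le_prod' fun j _ =>
      card_combination_mem_le hw (fun l => (B l).2) _)
    simp [t, ZMod.card, pow_mul, mul_comm k d]
  have hsub : (orthogonalMatrices (Fin k ⊕ Fin r)).filter (fun A => Unseen S A axes Δ) ⊆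
      good.biUnion fun Z => (orthogonalMatrices (Fin k ⊕ Fin r)).filter
        fun A => ∀ l, A.mulVec (E l) = fun x => Z x l := by
    intro A hA
    obtain ⟨hA1, hA2⟩ := Finset.mem_filter.1 hA
    refine Finset.mem_biUnion.2 ⟨fun x l => A.mulVec (E l) x, ?_,
      Finset.mem_filter.2 ⟨hA1, fun l => rfl⟩⟩
    refine Fintype.mem_piFinset.2 fun x => ?_
    cases x with
    | inl i => exact Finset.mem_univ _
    | inr j =>
      refine Finset.mem_filter.2 ⟨Finset.mem_univ _, fun v hv => ?_⟩
      rw [← hsyn]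
      exact hA2 j v hv
  have hbound : ((orthogonalMatrices (Fin k ⊕ Fin r)).filter fun A => Unseen S A axes Δ).card *
      2 ^ ((k + r) * d) ≤ good.card *
        ((orthogonalMatrices (Fin k ⊕ Fin r)).card * 2 ^ (d * (d + 1))) := by
    refine (Nat.mul_le_mul_right _ ((Finset.card_le_card hsub).trans
      Finset.card_biUnion_le)).trans ?_
    rw [Finset.sum_mul]
    refine (Finset.sum_le_card_nsmul _ _
      ((orthogonalMatrices (Fin k ⊕ Fin r)).card * 2 ^ (d * (d + 1))) fun Z _ => ?_).trans_eq
      (smul_eq_mul _ _)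
    have := card_orthogonal_map_le E (fun l x => Z x l) hE1
    rwa [Fintype.card_sum, Fintype.card_fin, Fintype.card_fin] at this
  have hpow : 2 ^ ((k + r) * d) = (2 ^ (k * d) * ∏ j, 2 ^ Module.finrank (ZMod 2)
        (W ⊓ perp (measSpace S (axes j)) : Submodule (ZMod 2) (Fin n → ZMod 2))) *
      2 ^ (∑ j, seenDim S W (axes j)) := by
    rw [Finset.prod_pow_eq_pow_sum, ← pow_add, ← pow_add]
    congr 1
    rw [add_assoc, ← Finset.sum_add_distrib]
    simp only [finrank_inf_perp_add_seenDim, Finset.sum_const, Finset.card_univ, Fintype.card_fin,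
      smul_eq_mul]
    rw [add_mul]
  rw [hpow] at hbound
  set P := 2 ^ (k * d) * ∏ j, 2 ^ Module.finrank (ZMod 2)
        (W ⊓ perp (measSpace S (axes j)) : Submodule (ZMod 2) (Fin n → ZMod 2)) with hP
  have hPpos : 0 < P := by positivity
  refine Nat.le_of_mul_le_mul_left ?_ hPpos
  calc _ = _ := by rw [mul_left_comm, hP]
    _ ≤ _ := hbound
    _ ≤ P * ((orthogonalMatrices (Fin k ⊕ Fin r)).card * 2 ^ (d * (d + 1))) := by gcongr
    _ ≤ _ := by gcongr; norm_num

end unseen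

/-! ### Random coding -/

section coding
variable {n : ℕ} {S : Matrix (Fin n ⊕ Fin n) (Fin n) (ZMod 2)}
  {ψ : (Fin n → ZMod 2) → (Fin n → ZMod 2) → ℂ} {p : (Fin n → ZMod 2) → ℝ}

theorem minEntropy_le (hp : ∀ b, 0 ≤ p b) (hp1 : ∑ b, p b = 1) {f : Partition n → ℕ}
    {𝒢 : Partition n → Submodule (ZMod 2) (Fin n → ZMod 2)}
    (h : ∀ M, 𝒢 M ≤ measSpace S M ∧ Module.finrank (ZMod 2) (𝒢 M) + f M = measDim S M) :
    minEntropy S p f ≤ cosetEntropy p (⨆ M, 𝒢 M) := by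
  refine csInf_le ⟨0, ?_⟩ ⟨𝒢, h, rfl⟩
  rintro _ ⟨𝒢', -, rfl⟩
  exact cosetEntropy_nonneg hp hp1 _

/-- Use the constraint for `f = seenDim S W` with the subspaces `measSpace S M ⊓ perp W`. Their sum
lies in `perp W`, and coset entropy is monotone, so `H_f ≤ C(perp W)`. -/
theorem Feasible.entropy_sub_lt {m : Partition n → ℝ} (hm : Feasible S p m)
    (hp : ∀ b, 0 ≤ p b) (hp1 : ∑ b, p b = 1)
    {W : Submodule (ZMod 2) (Fin n → ZMod 2)} (hW : W ≠ ⊥) :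
    entropy p - cosetEntropy p (perp W) < ∑ M, m M * seenDim S W M := by
  have h1 := hm.2 (seenDim S W) (fun M => Nat.sub_le _ _) (seenDim_ne_zero hW)
  have h2 : minEntropy S p (seenDim S W) ≤ cosetEntropy p (perp W) :=
    (minEntropy_le hp hp1 fun M => ⟨inf_le_left, finrank_add_seenDim W M⟩).trans
      (cosetEntropy_mono hp (iSup_le fun M => inf_le_right))
  linarith

open Classical in
-- The probabilistic method: the bound holds on average over all orthogonal matrices. It is a union
-- bound over the typical competitors `b'`, sorted by the span `W` of their difference from `b`.
theorem exists_orthogonal_few_confusions (hp : ∀ b, 0 ≤ p b) (hp1 : ∑ b, p b = 1) {k r : ℕ}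
    (hr : 0 < r) (axes : Fin r → Partition n) (ε : ℝ) :
    ∃ A ∈ orthogonalMatrices (Fin k ⊕ Fin r),
      ∑ b ∈ typical p k ε, listMass p b *
        (if ∃ b' ∈ typical p k ε, b' ≠ b ∧ Unseen S A axes (b - b') then 1 else 0) ≤
      ∑ W : Submodule (ZMod 2) (Fin n → ZMod 2) with W ≠ ⊥,
        (2 : ℝ) ^ (k * (entropy p - cosetEntropy p (perp W) + 2 * ε)) * 2 ^ (n * (n + 1)) /
          2 ^ (∑ j, seenDim S W (axes j)) := by
  set 𝒪 := orthogonalMatrices (Fin k ⊕ Fin r) with h𝒪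
  set R : ℝ := ∑ W : Submodule (ZMod 2) (Fin n → ZMod 2) with W ≠ ⊥,
        (2 : ℝ) ^ (k * (entropy p - cosetEntropy p (perp W) + 2 * ε)) * 2 ^ (n * (n + 1)) /
          2 ^ (∑ j, seenDim S W (axes j)) with hR
  refine Finset.exists_le_of_sum_le ⟨1, one_mem_orthogonalMatrices⟩ ?_
  rw [Finset.sum_comm, Finset.sum_const, nsmul_eq_mul]
  let sp : (Fin k → Fin n → ZMod 2) → Submodule (ZMod 2) (Fin n → ZMod 2) :=
    fun Δ => Submodule.span (ZMod 2) (Set.range Δ)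
  have hind : ∀ A, ∀ b ∈ typical p k ε,
      (if ∃ b' ∈ typical p k ε, b' ≠ b ∧ Unseen S A axes (b - b') then (1 : ℝ) else 0) ≤
      ∑ W : Submodule (ZMod 2) (Fin n → ZMod 2) with W ≠ ⊥,
        ∑ b' ∈ typical p k ε with sp (b - b') = W,
          if Unseen S A axes (b - b') then (1 : ℝ) else 0 := by
    intro A b _
    have h0 : ∀ (b' : Fin k → Fin n → ZMod 2),
        (0 : ℝ) ≤ if Unseen S A axes (b - b') then (1 : ℝ) else 0 := by
      intro b'; split_ifs <;> norm_num
    split_ifs with h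
    · obtain ⟨b', hb', hne, hun⟩ := h
      have hW : sp (b - b') ≠ ⊥ := by
        intro h0
        rw [Submodule.span_eq_bot] at h0
        apply hne
        funext j
        exact (sub_eq_zero.1 (h0 _ ⟨j, rfl⟩)).symm
      refine le_trans ?_ (Finset.single_le_sum
        (fun W _ => Finset.sum_nonneg fun b' _ => h0 b')
        (Finset.mem_filter.2 ⟨Finset.mem_univ (sp (b - b')), hW⟩))
      refine le_trans ?_ (Finset.single_le_sum (fun b' _ => h0 b')
        (Finset.mem_filter.2 ⟨hb', rfl⟩))
      rw [if_pos hun]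
    · exact Finset.sum_nonneg fun W _ => Finset.sum_nonneg fun b' _ => h0 b'
  have hb : ∀ b ∈ typical p k ε, ∑ A ∈ 𝒪,
      (if ∃ b' ∈ typical p k ε, b' ≠ b ∧ Unseen S A axes (b - b') then (1 : ℝ) else 0) ≤
      𝒪.card * R := by
    intro b hb
    refine (Finset.sum_le_sum fun A _ => hind A b hb).trans ?_
    rw [Finset.sum_comm, hR, Finset.mul_sum]
    refine Finset.sum_le_sum fun W _ => ?_
    rw [Finset.sum_comm]
    have hone : ∀ b' ∈ (typical p k ε).filter (fun b' => sp (b - b') = W),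
        ∑ A ∈ 𝒪, (if Unseen S A axes (b - b') then (1 : ℝ) else 0) ≤
          𝒪.card * 2 ^ (n * (n + 1)) / 2 ^ (∑ j, seenDim S W (axes j)) := by
      intro b' hb'
      rw [Finset.sum_boole, le_div_iff₀ (by positivity)]
      have h := card_unseen_le (S := S) hr axes (b - b')
      rw [show Submodule.span (ZMod 2) (Set.range (b - b')) = W from (Finset.mem_filter.1 hb').2]
        at h
      exact_mod_cast h
    refine (Finset.sum_le_card_nsmul _ _ _ hone).trans ?_
    rw [nsmul_eq_mul]
    -- Differences that span `W` lie in `W = perp (perp W)`, so these competitors share the cosets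
    -- of `b` for the subspace `perp W`.
    have hcard : (((typical p k ε).filter fun b' => sp (b - b') = W).card : ℝ) ≤
        (2 : ℝ) ^ (k * (entropy p - cosetEntropy p (perp W) + 2 * ε)) := by
      refine le_trans ?_ (card_typical_coset_le hp hb (perp W))
      rw [perp_perp]
      refine Nat.cast_le.2 (Finset.card_le_card fun b' hb' => ?_)
      obtain ⟨h1, h2⟩ := Finset.mem_filter.1 hb'
      refine Finset.mem_filter.2 ⟨h1, fun j => ?_⟩
      rw [← neg_sub, ← h2]
      exact Submodule.neg_mem _ (Submodule.subset_span ⟨j, rfl⟩)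
    calc _ ≤ (2 : ℝ) ^ (k * (entropy p - cosetEntropy p (perp W) + 2 * ε)) *
          (𝒪.card * 2 ^ (n * (n + 1)) / 2 ^ (∑ j, seenDim S W (axes j))) := by gcongr
      _ = _ := by ring
  calc ∑ b ∈ typical p k ε, ∑ A ∈ 𝒪, listMass p b *
        (if ∃ b' ∈ typical p k ε, b' ≠ b ∧ Unseen S A axes (b - b') then (1 : ℝ) else 0)
      ≤ ∑ b ∈ typical p k ε, listMass p b * (𝒪.card * R) := by
        refine Finset.sum_le_sum fun b hb' => ?_
        rw [← Finset.mul_sum]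
        exact mul_le_mul_of_nonneg_left (hb b hb') (listMass_nonneg hp b)
    _ ≤ ∑ b, listMass p b * (𝒪.card * R) := by
        refine Finset.sum_le_sum_of_subset_of_nonneg (Finset.subset_univ _) fun b _ _ => ?_
        have hR0 : 0 ≤ R := Finset.sum_nonneg fun W _ => by positivity
        exact mul_nonneg (listMass_nonneg hp b) (by positivity)
    _ = 𝒪.card * R := by rw [← Finset.sum_mul, sum_listMass hp1, one_mul]

open Classical in
/-- A protocol whose decoder looks for a typical list of phase vectors. -/
theorem exists_protocol_errorProb_le (hψ : ∀ b, IsStabilizerState S b (ψ b)) (hp : ∀ b, 0 ≤ p b)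
    {k r : ℕ} {A : Matrix (Fin k ⊕ Fin r) (Fin k ⊕ Fin r) (ZMod 2)}
    (hA : A * A.transpose = 1) (axes : Fin r → Partition n) (ε : ℝ) :
    ∃ T : Protocol n k r, T.axes = axes ∧
      T.errorProb ψ p ≤ ∑ b ∈ (typical p k ε)ᶜ, listMass p b +
        ∑ b ∈ typical p k ε, listMass p b *
          (if ∃ b' ∈ typical p k ε, b' ≠ b ∧ Unseen S A axes (b - b') then 1 else 0) := by
  obtain ⟨L, hL⟩ := exists_circuit A (by
    intro h0
    have := congrArg Matrix.det hA
    rw [Matrix.det_mul, h0, zero_mul, Matrix.det_one] at this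
    exact zero_ne_one this)
  let T0 : Protocol n k r := ⟨A, hA, L, hL, axes, fun _ _ _ => 0, fun _ _ => 0, fun _ _ => 0⟩
  let T : Protocol n k r := { T0 with
    -- The guess is any typical list compatible with the outcome; the default `0` is never used when
    -- the true list is typical and the outcome has positive probability.
    decode := fun o => if h : ∃ b ∈ typical p k ε, T0.outcomeProb ψ b o ≠ 0 then h.choose else 0 }
  refine ⟨T, rfl, ?_⟩
  have herr : ∀ b, ∑ o, (if T.decode o = b then 0 else T.outcomeProb ψ b o) ≤ 1 := by
    intro b
    rw [← T.sum_outcomeProb hψ b]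
    refine Finset.sum_le_sum fun o _ => ?_
    split_ifs
    · exact T.outcomeProb_nonneg ψ b o
    · exact le_rfl
  have hgood : ∀ b ∈ typical p k ε,
      (¬ ∃ b' ∈ typical p k ε, b' ≠ b ∧ Unseen S A axes (b - b')) →
      ∑ o, (if T.decode o = b then 0 else T.outcomeProb ψ b o) = 0 := by
    intro b hb hno
    refine Finset.sum_eq_zero fun o _ => ?_
    split_ifs with hdec
    · rfl
    · by_contra hne
      apply hdec
      have hex : ∃ b ∈ typical p k ε, T0.outcomeProb ψ b o ≠ 0 := ⟨b, hb, hne⟩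
      have hd : T.decode o = hex.choose := dif_pos hex
      obtain ⟨h1, h2⟩ := hex.choose_spec
      rw [hd]
      by_contra hneq
      exact hno ⟨hex.choose, h1, hneq, T0.unseen_of_outcomeProb_ne_zero hψ hne h2⟩
  have htot : T.errorProb ψ p = ∑ b, listMass p b *
      ∑ o, (if T.decode o = b then 0 else T.outcomeProb ψ b o) := rfl
  rw [htot, ← Finset.sum_compl_add_sum (typical p k ε)]
  refine add_le_add (Finset.sum_le_sum fun b _ =>
    mul_le_of_le_one_right (listMass_nonneg hp b) (herr b)) (Finset.sum_le_sum fun b hb => ?_)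
  refine mul_le_mul_of_nonneg_left ?_ (listMass_nonneg hp b)
  split_ifs with h
  · exact herr b
  · exact (hgood b hb h).le

/-! ### Measurement frequencies and achievability of feasible points -/

/-- Lists of measurements with prescribed multiplicities. -/
theorem exists_axes (c : Partition n → ℕ) :
    ∃ axes : Fin (∑ M, c M) → Partition n,
      (∀ M, (Finset.univ.filter fun j => axes j = M).card = c M) := by
  classical
  have hcard : Fintype.card (Σ M, Fin (c M)) = ∑ M, c M := by simp
  let e := Fintype.equivFinOfCardEq hcard
  refine ⟨fun j => (e.symm j).1, fun M => ?_⟩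
  have h1 : (Finset.univ.filter fun j => (e.symm j).1 = M).card =
      (Finset.univ.filter fun x : Σ M, Fin (c M) => x.1 = M).card :=
    Finset.card_equiv e.symm fun j => by simp
  rw [h1]
  have h2 : (Finset.univ.filter fun x : Σ M, Fin (c M) => x.1 = M) =
      Finset.univ.map (Function.Embedding.sigmaMk (β := fun M => Fin (c M)) M) := by
    ext ⟨M', x⟩
    simp only [Finset.mem_filter, Finset.mem_univ, true_and, Finset.mem_map,
      Function.Embedding.sigmaMk_apply]
    constructor
    · rintro rfl
      exact ⟨x, rfl⟩
    · rintro ⟨y, hy⟩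
      exact (Sigma.mk.inj_iff.1 hy).1.symm
  rw [h2, Finset.card_map, Finset.card_univ, Fintype.card_fin]

theorem sum_axes {r : ℕ} (axes : Fin r → Partition n) (f : Partition n → ℕ) :
    ∑ j, f (axes j) = ∑ M, (Finset.univ.filter fun j => axes j = M).card * f M := by
  rw [← Finset.sum_fiberwise Finset.univ axes]
  refine Finset.sum_congr rfl fun M _ => ?_
  rw [Finset.sum_congr rfl fun j hj => by rw [(Finset.mem_filter.1 hj).2], Finset.sum_const,
    smul_eq_mul]

theorem sum_card_axes {r : ℕ} (axes : Fin r → Partition n) :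
    ∑ M, (Finset.univ.filter fun j => axes j = M).card = r := by
  have := sum_axes axes fun _ => 1
  simpa using this.symm

theorem tendsto_ceil_add_one_div {a : ℝ} (ha : 0 ≤ a) :
    Tendsto (fun k : ℕ => ((⌈a * k⌉₊ + 1 : ℕ) : ℝ) / (k : ℝ)) atTop (𝓝 a) := by
  have h1 : Tendsto (fun k : ℕ => a + 2 / (k : ℝ)) atTop (𝓝 a) := by
    simpa using tendsto_const_nhds.add (tendsto_const_div_atTop_nhds_zero_nat (2 : ℝ))
  refine tendsto_of_tendsto_of_tendsto_of_le_of_le' tendsto_const_nhds h1 ?_ ?_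
  · filter_upwards [eventually_gt_atTop 0] with k hk
    have hk' : (0 : ℝ) < k := by exact_mod_cast hk
    rw [le_div_iff₀ hk']
    push_cast
    linarith [Nat.le_ceil (a * k)]
  · filter_upwards [eventually_gt_atTop 0] with k hk
    have hk' : (0 : ℝ) < k := by exact_mod_cast hk
    rw [div_le_iff₀ hk', add_mul, div_mul_cancel₀ _ hk'.ne']
    push_cast
    linarith [Nat.ceil_lt_add_one (mul_nonneg ha hk'.le)]

theorem tendsto_two_rpow_neg_mul {ε : ℝ} (hε : 0 < ε) :
    Tendsto (fun k : ℕ => (2 : ℝ) ^ (-((k : ℝ) * ε))) atTop (𝓝 0) := by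
  have h1 : ∀ k : ℕ, (2 : ℝ) ^ (-((k : ℝ) * ε)) = ((2 : ℝ) ^ (-ε)) ^ k := by
    intro k
    rw [← Real.rpow_natCast, ← Real.rpow_mul two_pos.le]
    congr 1
    ring
  simp only [h1]
  exact tendsto_pow_atTop_nhds_zero_of_lt_one (by positivity)
    (Real.rpow_lt_one_of_one_lt_of_neg one_lt_two (neg_lt_zero.2 hε))

/-- Every feasible point is attained by a succeeding sequence of protocols. -/
theorem Feasible.exists_protocols (hS : IsStabilizerMatrix S)
    (hψ : ∀ b, IsStabilizerState S b (ψ b)) (hp : ∀ b, 0 ≤ p b) (hp1 : ∑ b, p b = 1)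
    {m : Partition n → ℝ} (hm : Feasible S p m) :
    ∃ (r : ℕ → ℕ) (T : ∀ k, Protocol n k (r k)),
      (∀ M : Partition n,
        Tendsto (fun k : ℕ =>
          (((Finset.univ.filter fun j => (T k).axes j = M).card : ℕ) : ℝ) / (k : ℝ))
          atTop (𝓝 (m M))) ∧
      Tendsto (fun k => yield k (r k)) atTop (𝓝 (1 - ∑ M, m M)) ∧ Succeeds ψ p T := by
  classical
  -- Finitely many strict inequalities leave a uniform gap. Of the `3 * ε`, two are spent on
  -- counting typical lists and one makes the error decay.
  obtain ⟨ε, hε, hgap⟩ : ∃ ε : ℝ, 0 < ε ∧ ∀ W : Submodule (ZMod 2) (Fin n → ZMod 2), W ≠ ⊥ →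
      entropy p - cosetEntropy p (perp W) + 3 * ε ≤ ∑ M, m M * seenDim S W M := by
    let s : Finset (Submodule (ZMod 2) (Fin n → ZMod 2)) := Finset.univ.filter fun W => W ≠ ⊥
    let g : Submodule (ZMod 2) (Fin n → ZMod 2) → ℝ := fun W =>
      (∑ M, m M * seenDim S W M - (entropy p - cosetEntropy p (perp W))) / 3
    have hg : ∀ W ∈ s, 0 < g W := fun W hW => by
      have := hm.entropy_sub_lt hp hp1 (Finset.mem_filter.1 hW).2
      simp only [g]
      linarith
    rcases s.eq_empty_or_nonempty with hs | hs
    · refine ⟨1, one_pos, fun W hW => ?_⟩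
      have : W ∈ s := Finset.mem_filter.2 ⟨Finset.mem_univ _, hW⟩
      rw [hs] at this
      exact absurd this (Finset.notMem_empty _)
    · obtain ⟨W0, hW0, hmin⟩ := s.exists_min_image g hs
      refine ⟨g W0, hg W0 hW0, fun W hW => ?_⟩
      have := hmin W (Finset.mem_filter.2 ⟨Finset.mem_univ _, hW⟩)
      simp only [g] at this ⊢
      linarith
  -- The extra `1` guarantees a measured copy even if `m = 0`, as the random matrix bound requires,
  -- and does not affect the limiting frequency.
  let cnt : ℕ → Partition n → ℕ := fun k M => ⌈m M * k⌉₊ + 1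
  let r : ℕ → ℕ := fun k => ∑ M, cnt k M
  have hr : ∀ k, 0 < r k := fun k =>
    Finset.sum_pos (fun M _ => Nat.succ_pos _) ⟨fun _ => Axis.z, Finset.mem_univ _⟩
  have hprot : ∀ k, ∃ T : Protocol n k (r k),
      (∀ M, (Finset.univ.filter fun j => T.axes j = M).card = cnt k M) ∧
      T.errorProb ψ p ≤ ∑ b ∈ (typical p k ε)ᶜ, listMass p b +
        ∑ W : Submodule (ZMod 2) (Fin n → ZMod 2) with W ≠ ⊥,
          (2 : ℝ) ^ (n * (n + 1)) * (2 : ℝ) ^ (-((k : ℝ) * ε)) ∧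
      1 - T.errorProb ψ p ≤ T.fidelity ψ p ∧ T.fidelity ψ p ≤ 1 := by
    intro k
    obtain ⟨axes, haxes⟩ := exists_axes (cnt k)
    obtain ⟨A, hA, hconf⟩ := exists_orthogonal_few_confusions (S := S) (k := k) hp hp1 (hr k) axes ε
    obtain ⟨T, hT, herr⟩ := exists_protocol_errorProb_le hψ hp (mem_orthogonalMatrices.1 hA) axes ε
    obtain ⟨cz, cx, hf1, hf2⟩ := T.exists_corrections hS hψ hp hp1
    -- Replacing the corrections changes neither the outcomes nor the guess, so the error bound
    -- carries over.
    refine ⟨{ T with corrZ := cz, corrX := cx }, ?_, ?_, hf1, hf2⟩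
    · intro M
      rw [← haxes M, ← hT]
    · refine le_trans herr (add_le_add le_rfl (hconf.trans (Finset.sum_le_sum fun W hW => ?_)))
      have h1 : (k : ℝ) * ∑ M, m M * seenDim S W M ≤ ((∑ j, seenDim S W (axes j) : ℕ) : ℝ) := by
        rw [sum_axes, Finset.mul_sum]
        push_cast
        refine Finset.sum_le_sum fun M _ => ?_
        rw [haxes, ← mul_assoc]
        refine mul_le_mul_of_nonneg_right ?_ (Nat.cast_nonneg _)
        simp only [cnt]
        push_cast
        linarith [Nat.le_ceil (m M * k)]
      have h2 := hgap W (Finset.mem_filter.1 hW).2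
      have h3 := mul_le_mul_of_nonneg_left h2 (Nat.cast_nonneg (α := ℝ) k)
      rw [mul_comm ((2 : ℝ) ^ (_ : ℝ)), mul_div_assoc]
      refine mul_le_mul_of_nonneg_left ?_ (by positivity)
      rw [← Real.rpow_natCast 2 (∑ j, seenDim S W (axes j)), ← Real.rpow_sub two_pos]
      refine Real.rpow_le_rpow_of_exponent_le one_le_two ?_
      linarith
  choose T hT1 hT2 hT3 hT4 using hprot
  have hlim1 : ∀ M, Tendsto (fun k : ℕ => (cnt k M : ℝ) / (k : ℝ)) atTop (𝓝 (m M)) :=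
    fun M => tendsto_ceil_add_one_div (hm.1 M)
  have herr : Tendsto (fun k => (T k).errorProb ψ p) atTop (𝓝 0) := by
    have hb := (tendsto_sum_not_typical hp hp1 hε).add
      (tendsto_finsetSum (Finset.univ.filter fun W : Submodule (ZMod 2) (Fin n → ZMod 2) => W ≠ ⊥)
        fun W _ => (tendsto_two_rpow_neg_mul hε).const_mul ((2 : ℝ) ^ (n * (n + 1))))
    simp only [mul_zero, Finset.sum_const_zero, add_zero] at hb
    refine tendsto_of_tendsto_of_tendsto_of_le_of_le tendsto_const_nhds hb (fun k => ?_) hT2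
    linarith [hT3 k, hT4 k]
  refine ⟨r, T, fun M => ?_, ?_, herr, ?_⟩
  · simp only [hT1]
    exact hlim1 M
  · have h1 : Tendsto (fun k : ℕ => 1 - ∑ M, (cnt k M : ℝ) / (k : ℝ)) atTop
        (𝓝 (1 - ∑ M, m M)) := tendsto_const_nhds.sub (tendsto_finsetSum _ fun M _ => hlim1 M)
    refine h1.congr' ?_
    filter_upwards [eventually_gt_atTop 0] with k hk
    have hk' : (k : ℝ) ≠ 0 := by exact_mod_cast hk.ne'
    rw [yield, sub_div, div_self hk', ← Finset.sum_div]
    simp only [r, Nat.cast_sum]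
  · have h1 : Tendsto (fun k => 1 - (T k).errorProb ψ p) atTop (𝓝 1) := by
      simpa using tendsto_const_nhds.sub herr
    exact tendsto_of_tendsto_of_tendsto_of_le_of_le h1 tendsto_const_nhds hT3 hT4

end coding

/-! ### The converse bound -/

section converse
variable {n : ℕ} {S : Matrix (Fin n ⊕ Fin n) (Fin n) (ZMod 2)}
  {ψ : (Fin n → ZMod 2) → (Fin n → ZMod 2) → ℂ} {p : (Fin n → ZMod 2) → ℝ}

/-- Intersecting a complement of `G` with `V` gives, by the modular law, a complement within `V`.
Its basis provides the `f` additional bits that a measurement reveals beyond `G`. -/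
theorem exists_complement_vectors {G V : Submodule (ZMod 2) (Fin n → ZMod 2)} {f : ℕ} (hGV : G ≤ V)
    (hf : Module.finrank (ZMod 2) G + f = Module.finrank (ZMod 2) V) :
    ∃ v : Fin f → Fin n → ZMod 2, V = G ⊔ Submodule.span (ZMod 2) (Set.range v) := by
  obtain ⟨Q, hQ⟩ := G.exists_isCompl
  have hV : G ⊔ Q ⊓ V = V := by
    rw [← sup_inf_assoc_of_le Q hGV, hQ.sup_eq_top, top_inf_eq]
  have hd : G ⊓ (Q ⊓ V) = ⊥ := by
    rw [← inf_assoc, hQ.inf_eq_bot, bot_inf_eq]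
  have hfin := Submodule.finrank_sup_add_finrank_inf_eq G (Q ⊓ V)
  rw [hV, hd, finrank_bot, add_zero, ← hf] at hfin
  let B := Module.finBasisOfFinrankEq (ZMod 2) (Q ⊓ V : Submodule (ZMod 2) (Fin n → ZMod 2))
    (add_left_cancel hfin).symm
  refine ⟨fun l => (B l : Fin n → ZMod 2), ?_⟩
  have hs : Submodule.span (ZMod 2) (Set.range fun l => (B l : Fin n → ZMod 2)) = Q ⊓ V := by
    have h := congrArg (Submodule.map (Q ⊓ V).subtype) B.span_eq
    rw [Submodule.map_span, Submodule.map_top, Submodule.range_subtype, ← Set.range_comp] at h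
    exact h
  rw [hs, hV]

theorem mem_perp_span {ι : Type} {v : ι → Fin n → ZMod 2} {x : Fin n → ZMod 2}
    (h : ∀ l, v l ⬝ᵥ x = 0) : x ∈ perp (Submodule.span (ZMod 2) (Set.range v)) := by
  intro g hg
  refine Submodule.span_induction (p := fun g _ => g ⬝ᵥ x = 0) ?_ ?_ ?_ ?_ hg
  · rintro _ ⟨l, rfl⟩
    exact h l
  · exact zero_dotProduct x
  · intro a b _ _ ha hb
    rw [add_dotProduct, ha, hb, add_zero]
  · intro t a _ ha
    rw [smul_dotProduct, ha, smul_zero]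

/-- A guess from an outcome whose distribution depends on a label with few values is correct for
few inputs. -/
theorem sum_correct_le_card {B O L : Type} [Fintype B] [DecidableEq B] [Fintype O] [Fintype L]
    [DecidableEq L] (s : Finset B) (q : B → O → ℝ) (hq : ∀ b o, 0 ≤ q b o)
    (hq1 : ∀ b, ∑ o, q b o ≤ 1) (lab : B → L)
    (hlab : ∀ b ∈ s, ∀ b' ∈ s, lab b = lab b' → q b = q b') (dec : O → B) :
    ∑ b ∈ s, ∑ o, (if dec o = b then q b o else 0) ≤ Fintype.card L := by
  rw [← Finset.sum_fiberwise s lab, ← Finset.card_univ, ← nsmul_one]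
  refine Finset.sum_le_card_nsmul _ _ _ fun l _ => ?_
  rcases (s.filter fun b => lab b = l).eq_empty_or_nonempty with h0 | ⟨b0, hb0⟩
  · rw [h0, Finset.sum_empty]
    exact zero_le_one
  · obtain ⟨hb0s, hb0l⟩ := Finset.mem_filter.1 hb0
    refine le_trans ?_ (hq1 b0)
    -- Inputs with the same label share one distribution, and each outcome is a correct guess for at
    -- most one of them; each label therefore contributes at most the total probability `1`.
    rw [Finset.sum_comm]
    refine Finset.sum_le_sum fun o _ => ?_
    have h1 : ∀ b ∈ s.filter (fun b => lab b = l),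
        (if dec o = b then q b o else 0) = if dec o = b then q b0 o else 0 := by
      intro b hb
      obtain ⟨hbs, hbl⟩ := Finset.mem_filter.1 hb
      rw [hlab b hbs b0 hb0s (hbl.trans hb0l.symm)]
    rw [Finset.sum_congr rfl h1, Finset.sum_ite_eq]
    split_ifs
    · exact le_rfl
    · exact hq b0 o

open Classical in
-- Success on typical lists is at most (mass of one list) × (number of coset lists) ×
-- (distinguishable lists per coset list). Each factor is bounded separately; atypical lists are
-- conceded entirely.
theorem Protocol.one_sub_errorProb_le (hS : IsStabilizerMatrix S)
    (hψ : ∀ b, IsStabilizerState S b (ψ b)) (hp : ∀ b, 0 ≤ p b) (hp1 : ∑ b, p b = 1) {k r : ℕ}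
    (T : Protocol n k r) {f : Partition n → ℕ}
    {𝒢 : Partition n → Submodule (ZMod 2) (Fin n → ZMod 2)}
    (h𝒢 : ∀ M, 𝒢 M ≤ measSpace S M ∧ Module.finrank (ZMod 2) (𝒢 M) + f M = measDim S M) (ε : ℝ) :
    1 - T.errorProb ψ p ≤ ∑ b ∈ (typical p k ε)ᶜ, listMass p b +
      (2 : ℝ) ^ (k * (cosetEntropy p (⨆ M, 𝒢 M) - entropy p + 2 * ε)) *
        2 ^ (∑ j, f (T.axes j)) := by
  set G := ⨆ M, 𝒢 M with hG
  let cor : (Fin k → Fin n → ZMod 2) → ℝ := fun b =>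
    ∑ o, if T.decode o = b then T.outcomeProb ψ b o else 0
  have hcor0 : ∀ b, 0 ≤ cor b := fun b => Finset.sum_nonneg fun o _ => by
    split_ifs
    · exact T.outcomeProb_nonneg ψ b o
    · exact le_rfl
  have hcor1 : ∀ b, cor b ≤ 1 := by
    intro b
    rw [← T.sum_outcomeProb hψ b]
    refine Finset.sum_le_sum fun o _ => ?_
    split_ifs
    · exact le_rfl
    · exact T.outcomeProb_nonneg ψ b o
  have htot : 1 - T.errorProb ψ p = ∑ b, listMass p b * cor b := by
    have h1 : T.errorProb ψ p = ∑ b, listMass p b *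
        ∑ o, (if T.decode o = b then 0 else T.outcomeProb ψ b o) := rfl
    rw [h1, ← sum_listMass hp1 k, ← Finset.sum_sub_distrib]
    refine Finset.sum_congr rfl fun b _ => ?_
    rw [← mul_one_sub, ← T.sum_outcomeProb hψ b, ← Finset.sum_sub_distrib]
    congr 1
    refine Finset.sum_congr rfl fun o _ => ?_
    split_ifs <;> simp
  have hvec : ∀ M, ∃ v : Fin (f M) → Fin n → ZMod 2,
      measSpace S M = 𝒢 M ⊔ Submodule.span (ZMod 2) (Set.range v) := fun M =>
    exists_complement_vectors (h𝒢 M).1 (h𝒢 M).2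
  choose v hv using hvec
  let cl : (Fin k → Fin n → ZMod 2) → Fin k → (Fin n → ZMod 2) ⧸ perp G :=
    fun b j => Submodule.Quotient.mk (b j)
  -- Within one list of cosets, the syndromes are known modulo `perp G`, so these `∑ j, f (T.axes
  -- j)` bits determine everything that the measurement can see.
  let lab : (Fin k → Fin n → ZMod 2) → (Σ j : Fin r, Fin (f (T.axes j))) → ZMod 2 :=
    fun b x => v (T.axes x.1) x.2 ⬝ᵥ syndrome T.A b x.1
  have hclass : ∀ c, ∑ b ∈ typical p k ε with cl b = c, cor b ≤ 2 ^ (∑ j, f (T.axes j)) := by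
    intro c
    refine (sum_correct_le_card _ (T.outcomeProb ψ) (T.outcomeProb_nonneg ψ)
      (fun b => (T.sum_outcomeProb hψ b).le) lab ?_ T.decode).trans_eq ?_
    · intro b hb b' hb' hl
      have hcl : cl b = cl b' := (Finset.mem_filter.1 hb).2.trans (Finset.mem_filter.1 hb').2.symm
      funext o
      refine T.outcomeProb_eq_of_unseen hS hψ (fun j => ?_) o
      change syndrome T.A (b - b') j ∈ perp (measSpace S (T.axes j))
      rw [hv, perp_sup]
      refine ⟨?_, mem_perp_span fun l => ?_⟩
      · refine perp_anti (le_iSup 𝒢 (T.axes j)) ?_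
        refine Submodule.sum_mem _ fun i _ => Submodule.smul_mem _ _ ?_
        exact (Submodule.Quotient.eq _).1 (congrFun hcl i)
      · have := congrFun hl ⟨j, l⟩
        simp only [lab] at this
        rw [syndrome_sub, dotProduct_sub, this, sub_self]
    · simp [ZMod.card]
  have htyp : ∑ b ∈ typical p k ε, cor b ≤
      (2 : ℝ) ^ (k * (cosetEntropy p G + ε)) * 2 ^ (∑ j, f (T.axes j)) := by
    rw [← Finset.sum_fiberwise_of_maps_to (g := cl) (t := (typical p k ε).image cl)
      fun b hb => Finset.mem_image_of_mem _ hb]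
    refine (Finset.sum_le_card_nsmul _ _ _ fun c _ => hclass c).trans ?_
    rw [nsmul_eq_mul]
    exact mul_le_mul_of_nonneg_right (card_image_typical_le hp hp1 G) (by positivity)
  rw [htot, ← Finset.sum_compl_add_sum (typical p k ε)]
  refine add_le_add (Finset.sum_le_sum fun b _ =>
    mul_le_of_le_one_right (listMass_nonneg hp b) (hcor1 b)) ?_
  calc ∑ b ∈ typical p k ε, listMass p b * cor b
      ≤ ∑ b ∈ typical p k ε, (2 : ℝ) ^ (-(k * (entropy p - ε))) * cor b :=
        Finset.sum_le_sum fun b hb => mul_le_mul_of_nonneg_right (listMass_le hp hb) (hcor0 b)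
    _ ≤ (2 : ℝ) ^ (-(k * (entropy p - ε))) *
        ((2 : ℝ) ^ (k * (cosetEntropy p G + ε)) * 2 ^ (∑ j, f (T.axes j))) := by
        rw [← Finset.mul_sum]
        exact mul_le_mul_of_nonneg_left htyp (by positivity)
    _ = _ := by
        rw [← mul_assoc, ← Real.rpow_add two_pos]
        congr 2
        ring

/-- If the inequality failed, the success probability would be bounded by the atypical mass plus `2
^ (-k * ε)`. For large `k` this is impossible, since both of these and the error probability tend to
zero. -/
theorem eventually_le_sum_axes (hS : IsStabilizerMatrix S)
    (hψ : ∀ b, IsStabilizerState S b (ψ b)) (hp : ∀ b, 0 ≤ p b) (hp1 : ∑ b, p b = 1) {r : ℕ → ℕ}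
    {T : ∀ k, Protocol n k (r k)} (hT : Tendsto (fun k => (T k).errorProb ψ p) atTop (𝓝 0))
    {f : Partition n → ℕ} {𝒢 : Partition n → Submodule (ZMod 2) (Fin n → ZMod 2)}
    (h𝒢 : ∀ M, 𝒢 M ≤ measSpace S M ∧ Module.finrank (ZMod 2) (𝒢 M) + f M = measDim S M) {ε : ℝ}
    (hε : 0 < ε) :
    ∀ᶠ k : ℕ in atTop, (k : ℝ) * (entropy p - cosetEntropy p (⨆ M, 𝒢 M) - 3 * ε) ≤
      ((∑ j, f ((T k).axes j) : ℕ) : ℝ) := by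
  have h1 := ((tendsto_sum_not_typical hp hp1 hε).add (tendsto_two_rpow_neg_mul hε)).add hT
  rw [add_zero, add_zero] at h1
  filter_upwards [h1.eventually (gt_mem_nhds one_pos)] with k hk
  by_contra! hcon
  have h2 := (T k).one_sub_errorProb_le hS hψ hp hp1 h𝒢 ε
  have h3 : (2 : ℝ) ^ (k * (cosetEntropy p (⨆ M, 𝒢 M) - entropy p + 2 * ε)) *
      2 ^ (∑ j, f ((T k).axes j)) ≤ (2 : ℝ) ^ (-((k : ℝ) * ε)) := by
    rw [← Real.rpow_natCast 2 (∑ j, f ((T k).axes j)), ← Real.rpow_add two_pos]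
    refine Real.rpow_le_rpow_of_exponent_le one_le_two ?_
    linarith
  linarith

/-! ### Attained minima and feasible points of the linear program -/

theorem exists_minEntropy_eq {f : Partition n → ℕ} (hf : ∀ M, f M ≤ measDim S M) :
    ∃ 𝒢 : Partition n → Submodule (ZMod 2) (Fin n → ZMod 2),
      (∀ M, 𝒢 M ≤ measSpace S M ∧ Module.finrank (ZMod 2) (𝒢 M) + f M = measDim S M) ∧
      minEntropy S p f = cosetEntropy p (⨆ M, 𝒢 M) := by
  have hex : ∀ M, ∃ G : Submodule (ZMod 2) (Fin n → ZMod 2),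
      G ≤ measSpace S M ∧ Module.finrank (ZMod 2) G + f M = measDim S M := by
    intro M
    let B := Module.finBasis (ZMod 2) (measSpace S M)
    let w : Fin (measDim S M - f M) → Fin n → ZMod 2 := fun l =>
      (B (Fin.castLE (Nat.sub_le _ _) l) : Fin n → ZMod 2)
    have hw : LinearIndependent (ZMod 2) w :=
      (B.linearIndependent.map' _ (Submodule.ker_subtype _)).comp _ (Fin.castLE_injective _)
    refine ⟨Submodule.span (ZMod 2) (Set.range w), Submodule.span_le.2 ?_, ?_⟩
    · rintro _ ⟨l, rfl⟩
      exact (B _).2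
    · rw [finrank_span_eq_card hw, Fintype.card_fin, Nat.sub_add_cancel (hf M)]
  choose 𝒢 h𝒢 using hex
  set s : Set ℝ := {c : ℝ | ∃ 𝒢 : Partition n → Submodule (ZMod 2) (Fin n → ZMod 2),
    (∀ M, 𝒢 M ≤ measSpace S M ∧ Module.finrank (ZMod 2) (𝒢 M) + f M = measDim S M) ∧
    c = cosetEntropy p (⨆ M, 𝒢 M)} with hs
  -- There are finitely many families of subspaces, so the nonempty set contains its infimum.
  have hfin : s.Finite := by
    refine (Set.finite_range fun 𝒢 : Partition n → Submodule (ZMod 2) (Fin n → ZMod 2) =>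
      cosetEntropy p (⨆ M, 𝒢 M)).subset ?_
    rintro _ ⟨𝒢, -, rfl⟩
    exact ⟨𝒢, rfl⟩
  have hmem : sInf s ∈ s := Set.Nonempty.csInf_mem ⟨_, 𝒢, h𝒢, rfl⟩ hfin
  exact hmem

theorem Feasible.lpValue_le {m : Partition n → ℝ} (hm : Feasible S p m) :
    lpValue S p ≤ ∑ M, m M := by
  refine csInf_le ⟨0, ?_⟩ ⟨m, hm, rfl⟩
  rintro _ ⟨m', hm', rfl⟩
  exact Finset.sum_nonneg fun M _ => hm'.1 M

/-- A feasible point ensures that `lpValue` is a genuine infimum and not the default value of `sInf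
∅`. Since a nonzero `f` is at least `1` somewhere, `H + 1` exceeds every bound `H - H_f`. -/
theorem exists_feasible (hp : ∀ b, 0 ≤ p b) (hp1 : ∑ b, p b = 1) :
    Feasible S p fun _ => entropy p + 1 := by
  have hH : 0 ≤ entropy p := by
    rw [← cosetEntropy_top]
    exact cosetEntropy_nonneg hp hp1 _
  refine ⟨fun _ => by linarith, fun f hf hf0 => ?_⟩
  have h1 : 0 ≤ minEntropy S p f := by
    obtain ⟨𝒢, -, h⟩ := exists_minEntropy_eq (p := p) hf
    rw [h]
    exact cosetEntropy_nonneg hp hp1 _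
  obtain ⟨M, hM⟩ := Function.ne_iff.1 hf0
  have h2 : (1 : ℝ) ≤ f M := by exact_mod_cast Nat.one_le_iff_ne_zero.2 hM
  have h3 : (entropy p + 1) * f M ≤ ∑ M, (entropy p + 1) * (f M : ℝ) :=
    Finset.single_le_sum (f := fun M => (entropy p + 1) * (f M : ℝ))
      (fun M _ => mul_nonneg (by linarith) (Nat.cast_nonneg _)) (Finset.mem_univ M)
  nlinarith

/-- No succeeding sequence of protocols has a larger yield than the linear program allows. -/
theorem Achievable.le_one_sub_lpValue (hS : IsStabilizerMatrix S)
    (hψ : ∀ b, IsStabilizerState S b (ψ b)) (hp : ∀ b, 0 ≤ p b) (hp1 : ∑ b, p b = 1) {γ : ℝ}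
    (hγ : Achievable ψ p γ) : γ ≤ 1 - lpValue S p := by
  classical
  obtain ⟨r, T, ⟨hT, -⟩, hy⟩ := hγ
  have key : ∀ δ : ℝ, 0 < δ → lpValue S p ≤ 1 - γ + δ * Fintype.card (Partition n) := by
    intro δ hδ
    -- The observed frequencies satisfy the constraints up to `3 * (δ / 4)`. Adding `δ` in every
    -- coordinate gains at least `δ` for each `f ≠ 0`, which restores strict feasibility.
    let m : ℕ → Partition n → ℝ := fun k M =>
      ((Finset.univ.filter fun j => (T k).axes j = M).card : ℝ) / k + δ
    have hfeas : ∀ᶠ k in atTop, Feasible S p (m k) := by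
      -- Encoding the admissible `f` in a finite type allows one threshold on `k` for all
      -- constraints.
      have hev : ∀ᶠ k : ℕ in atTop, ∀ f : (M : Partition n) → Fin (measDim S M + 1),
          (k : ℝ) * (entropy p - minEntropy S p (fun M => f M) - 3 * (δ / 4)) ≤
            ((∑ j, (f ((T k).axes j) : ℕ) : ℕ) : ℝ) := by
        rw [eventually_all]
        intro f
        obtain ⟨𝒢, h𝒢, hmin⟩ := exists_minEntropy_eq (p := p) (f := fun M => (f M : ℕ))
          fun M => Nat.lt_succ_iff.1 (f M).2
        rw [hmin]
        exact eventually_le_sum_axes hS hψ hp hp1 hT h𝒢 (by positivity)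
      filter_upwards [hev, eventually_gt_atTop 0] with k hk hk0
      have hk' : (0 : ℝ) < k := by exact_mod_cast hk0
      refine ⟨fun M => by positivity, fun f hf hf0 => ?_⟩
      have h1 := hk fun M => ⟨f M, Nat.lt_succ_iff.2 (hf M)⟩
      simp only at h1
      rw [sum_axes (T k).axes f] at h1
      obtain ⟨M0, hM0⟩ := Function.ne_iff.1 hf0
      have h2 : (1 : ℝ) ≤ f M0 := by exact_mod_cast Nat.one_le_iff_ne_zero.2 hM0
      have h3 : (1 : ℝ) ≤ ∑ M, (f M : ℝ) := h2.trans
        (Finset.single_le_sum (f := fun M => (f M : ℝ)) (fun M _ => Nat.cast_nonneg _)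
          (Finset.mem_univ M0))
      have h4 : ∑ M, m k M * f M =
          ((∑ M, (Finset.univ.filter fun j => (T k).axes j = M).card * f M : ℕ) : ℝ) / k +
            δ * ∑ M, (f M : ℝ) := by
        simp only [m, add_mul, Finset.sum_add_distrib, ← Finset.mul_sum]
        congr 1
        push_cast
        rw [Finset.sum_div]
        exact Finset.sum_congr rfl fun M _ => by ring
      have h5 := (le_div_iff₀' hk').2 h1
      rw [h4]
      nlinarith
    have hev2 : ∀ᶠ k in atTop, lpValue S p ≤ 1 - yield k (r k) + δ * Fintype.card (Partition n) := by
      filter_upwards [hfeas, eventually_gt_atTop 0] with k hk hk0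
      have hk' : (k : ℝ) ≠ 0 := by exact_mod_cast hk0.ne'
      refine hk.lpValue_le.trans_eq ?_
      simp only [m, Finset.sum_add_distrib, ← Finset.sum_div, Finset.sum_const, Finset.card_univ,
        nsmul_eq_mul]
      rw [← Nat.cast_sum, sum_card_axes, yield, sub_div, div_self hk']
      ring
    exact ge_of_tendsto ((tendsto_const_nhds.sub hy).add tendsto_const_nhds) hev2
  have hlim : Tendsto (fun δ : ℝ => 1 - γ + δ * Fintype.card (Partition n)) (𝓝[>] 0)
      (𝓝 (1 - γ + 0 * Fintype.card (Partition n))) :=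
    ((continuous_const.add (continuous_id.mul continuous_const)).tendsto 0).mono_left
      nhdsWithin_le_nhds
  have h := ge_of_tendsto hlim (eventually_nhdsWithin_of_forall fun δ hδ => key δ hδ)
  linarith

/-! ### Attainment of the optimal yield -/

theorem exists_diagonal {α : ℕ → Type} [∀ k, Nonempty (α k)] (P : ℕ → ∀ k, α k → Prop)
    (h : ∀ i, ∀ᶠ k in atTop, ∃ a, P i k a) :
    ∃ a : ∀ k, α k, ∀ i, ∀ᶠ k in atTop, ∃ i' ≥ i, P i' k (a k) := by
  classical
  -- Stage `k` uses the best quality index up to `k` that is available there; any given index is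
  -- eventually reached or surpassed.
  let idx : ℕ → ℕ := fun k => Nat.findGreatest (fun i => ∃ a, P i k a) k
  refine ⟨fun k => if h : ∃ a, P (idx k) k a then h.choose else Classical.arbitrary _,
    fun i => ?_⟩
  filter_upwards [h i, eventually_ge_atTop i] with k hk hik
  have h1 : ∃ a, P (idx k) k a := Nat.findGreatest_spec (P := fun i => ∃ a, P i k a) hik hk
  refine ⟨idx k, Nat.le_findGreatest hik hk, ?_⟩
  rw [dif_pos h1]
  exact h1.choose_spec

/-- Since the constraints are strict, no feasible point need attain the infimum. Protocols from
feasible points that approach it are merged into a single sequence. -/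
theorem achievable_one_sub_lpValue (hS : IsStabilizerMatrix S)
    (hψ : ∀ b, IsStabilizerState S b (ψ b)) (hp : ∀ b, 0 ≤ p b) (hp1 : ∑ b, p b = 1) :
    Achievable ψ p (1 - lpValue S p) := by
  let P : ℕ → ∀ k, (Σ r, Protocol n k r) → Prop := fun i k T =>
    |T.2.errorProb ψ p| < 1 / (i + 1 : ℝ) ∧ |T.2.fidelity ψ p - 1| < 1 / (i + 1 : ℝ) ∧
      |yield k T.1 - (1 - lpValue S p)| < 1 / (i + 1 : ℝ)
  have hne : ∀ k, Nonempty (Σ r, Protocol n k r) := fun k =>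
    ⟨0, ⟨1, by simp, [], rfl, fun _ _ => Axis.z, fun _ _ _ => 0, fun _ _ => 0, fun _ _ => 0⟩⟩
  have hP : ∀ i, ∀ᶠ k in atTop, ∃ T, P i k T := by
    intro i
    have hi : (0 : ℝ) < 1 / (i + 1 : ℝ) := by positivity
    -- One half of the tolerance covers the distance of the feasible point from the infimum, the
    -- other half the convergence of its yields.
    have hi2 : (0 : ℝ) < 1 / (i + 1 : ℝ) / 2 := by positivity
    obtain ⟨_, ⟨m, hm, rfl⟩, hlt⟩ := exists_lt_of_csInf_lt
      (s := {t : ℝ | ∃ m : Partition n → ℝ, Feasible S p m ∧ t = ∑ M, m M})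
      ⟨_, _, exists_feasible hp hp1, rfl⟩ (lt_add_of_pos_right (lpValue S p) hi2)
    obtain ⟨r, T, -, hy, herr, hfid⟩ := hm.exists_protocols hS hψ hp hp1
    have hle := hm.lpValue_le
    filter_upwards [Metric.tendsto_nhds.1 herr _ hi, Metric.tendsto_nhds.1 hfid _ hi,
      Metric.tendsto_nhds.1 hy _ hi2] with k h1 h2 h3
    rw [Real.dist_eq] at h1 h2 h3
    rw [sub_zero] at h1
    refine ⟨⟨r k, T k⟩, h1, h2, ?_⟩
    rw [abs_lt] at h3 ⊢
    constructor <;> linarith [h3.1, h3.2]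
  obtain ⟨T, hT⟩ := exists_diagonal P hP
  have hlim : ∀ (x : ℕ → ℝ) (x0 : ℝ),
      (∀ i k, P i k (T k) → |x k - x0| < 1 / (i + 1 : ℝ)) → Tendsto x atTop (𝓝 x0) := by
    intro x x0 hx
    rw [Metric.tendsto_nhds]
    intro δ hδ
    obtain ⟨i, hi⟩ := exists_nat_one_div_lt hδ
    filter_upwards [hT i] with k ⟨i', hi', hPk⟩
    rw [Real.dist_eq]
    exact ((hx i' k hPk).trans_le (Nat.one_div_le_one_div hi')).trans hi
  exact ⟨fun k => (T k).1, fun k => (T k).2,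
    ⟨hlim _ _ fun i k h => by rw [sub_zero]; exact h.1, hlim _ _ fun i k h => h.2.1⟩,
    hlim _ _ fun i k h => h.2.2⟩

end converse

end Breeding

end
theorem mainTheorem1 (n : ℕ) (S : Matrix (Fin n ⊕ Fin n) (Fin n) (ZMod 2))
    (hS : Breeding.IsStabilizerMatrix S)
    (ψ : (Fin n → ZMod 2) → (Fin n → ZMod 2) → ℂ)
    (hψ : ∀ b, Breeding.IsStabilizerState S b (ψ b))
    (p : (Fin n → ZMod 2) → ℝ) (hp : ∀ b, 0 ≤ p b) (hp1 : ∑ b, p b = 1) :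
    (∀ m : Breeding.Partition n → ℝ, Breeding.Feasible S p m →
      ∃ (r : ℕ → ℕ) (T : ∀ k, Breeding.Protocol n k (r k)),
        (∀ M : Breeding.Partition n,
          Tendsto (fun k : ℕ => (((Finset.univ.filter fun j => (T k).axes j = M).card : ℕ) : ℝ) / (k : ℝ))
            atTop (𝓝 (m M))) ∧
        Tendsto (fun k => Breeding.yield k (r k)) atTop (𝓝 (1 - ∑ M, m M)) ∧
        Breeding.Succeeds ψ p T) ∧
    IsGreatest {γ : ℝ | Breeding.Achievable ψ p γ} (1 - Breeding.lpValue S p) :=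
  ⟨fun _ hm => hm.exists_protocols hS hψ hp hp1,
    Breeding.achievable_one_sub_lpValue hS hψ hp hp1,
    fun _ hγ => hγ.le_one_sub_lpValue hS hψ hp hp1⟩
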